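/- \textbf{Setting.} Let $\Sigma$ be a nonempty finite alphabet and $n\in\mathbb N$. Two players alternately append symbols to a word until it has length $n$; after a history $h\in\Sigma^{\le n}$ with $|h|<n$ it is our turn if $|h|$ is even and the adversary's turn if $|h|$ is odd. A \emph{strategy} is a function $\sigma:\Sigma^{\le n}\times\Sigma\to[0,1]$ such that $\sigma(h,\cdot)$ is a probability distribution on $\Sigma$ whenever $|h|<n$. If we play $\sigma$ and the adversary plays $\tau$, let $P_{\sigma,\tau}(\pi)$ be the probability of the play $\pi\in\Sigma^n$, let $P_{\sigma,\tau}(X)=\sum_{\pi\in X}P_{\sigma,\tau}(\pi)$ for $X\subseteq\Sigma^n$, and let $P_{\sigma,\tau}(\pi\mid h)$ be the probability that the play, started from the history $h$, continues with $\pi$. The \emph{width} of $X\subseteq\Sigma^n$ given $h\in\Sigma^{\le n}$ is $$W(X\mid h)=\max_\sigma\min_\tau\bigl|\{\pi : h\pi\in X,\ P_{\sigma,\tau}(\pi\mid h)>0\}\bigr| .$$ An \emph{RCI instance} $\mathcal C=(\mathcal H,\mathcal S,n,\epsilon,\rho)$ consists of specifications $\mathcal H,\mathcal S$ of languages over $\Sigma$,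 a length $n\in\mathbb N$, and $\epsilon,\rho\in[0,1]\cap\mathbb Q$. Its size $|\mathcal C|$ is the number of bits of its representation, with $n$ in unary and $\epsilon,\rho$ in binary. Put $I=L(\mathcal H)\cap\Sigma^n$ and $A=I\cap L(\mathcal S)$. A strategy $\sigma$ is \emph{improvising} if for every adversary strategy $\tau$: $P_{\sigma,\tau}(I)=1$, $P_{\sigma,\tau}(A)\ge 1-\epsilon$, and $P_{\sigma,\tau}(\pi)\le\rho$ for all $\pi\in I$. The instance is \emph{realizable} if an improvising strategy exists. An \emph{improviser} is an expected-finite time probabilistic algorithm (using fair coin tosses) whose output distribution on each input $h\in\Sigma^{\le n}$ is $\sigma(h,\cdot)$, for some improvising strategy $\sigma$. A \emph{polynomial-time improvisation scheme} for a class of instances is an algorithm $S$ such that: for each instance $\mathcal C$ of the class, $S(\mathcal C)$ is an improviser for $\mathcal C$ if $\mathcal C$ is realizable, and $S(\mathcal C)=\bot$ otherwise; the running time of $S$ on $\mathcal C$ is at most $p(|\mathcal C|)$ for a fixed polynomial $p$; and for a fixed polynomial $q$, whenever $G=S(\mathcal C)\neq\bot$, the expected running time of $G$ on every $h\in\Sigma^{\le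 n}$ is at most $q(|\mathcal C|)$. A \emph{reachability/safety game} is a finite state space with an initial state, a transition function driven by the symbols played, a set $T$ of target states and a set $U$ of unsafe states; a play is won if it visits $T$ and never visits $U$ (reachability games: $U=\emptyset$; safety games: all states are in $T$). It specifies the language of the words that are won. \textbf{Theorem.} \begin{enumerate} \item Let $D$ be a DFA over $\Sigma$ with states $V$, accepting states $F$ and transition function $\delta$, and for $v\in V$, $0\le i\le n$ let $$C(v,i)=\begin{cases}\mathbf 1_{v\in F} & i=n,\\ \min_{u\in\Sigma}C(\delta(v,u),i+1) & i<n,\ i\text{ odd},\\ \sum_{u\in\Sigma}C(\delta(v,u),i+1) & i<n,\ i\text{ even}.\end{cases}$$ Then $W(L(D)\cap\Sigma^n\mid h)=C(D(h),|h|)$ for every $h\in\Sigma^{\le n}$, where $D(h)$ is the state of $D$ reached on $h$. \item The product automaton of two DFAs $D$ and $E$ accepts $L(D)\cap L(E)$. \item The class of the RCI instances whose hard and soft specifications are DFAs has a polynomial-time improvisation scheme. \item So does the class of the RCI instances whose hard and soft specifications are reachability/safety games. \end{enumerate} -/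

import Mathlib

namespace RCI

/-! # Synthesis games on words of length `n` -/

/-- A (randomized) strategy for games of length `n` over the alphabet `α`: a `[0,1]`-valued
function of a history and a symbol which is a probability distribution over the symbols after each
history at which the game has not ended. Values at lists longer than `n` are never used. -/
structure Strategy (α : Type*) [Fintype α] (n : ℕ) where
  prob : List α → α → ℝ
  prob_nonneg : ∀ h u, 0 ≤ prob h u
  prob_le_one : ∀ h u, prob h u ≤ 1
  sum_prob : ∀ h, h.length < n → ∑ u, prob h u = 1

section Games

variable {α : Type*} [Fintype α] {n : ℕ}

/-- `P_{σ,τ}(w | h)`: the probability that the play continues with `w` after the history `h`. It is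
our turn (strategy `σ`) after histories of even length and the adversary's (strategy `τ`) after
histories of odd length. -/
noncomputable def condProb (σ τ : Strategy α n) : List α → List α → ℝ
  | _, [] => 1
  | h, u :: w =>
      (if Even h.length then σ.prob h u else τ.prob h u) * condProb σ τ (h ++ [u]) w

/-- `P_{σ,τ}(π)`. -/
noncomputable def playProb (σ τ : Strategy α n) (π : List α) : ℝ := condProb σ τ [] π

open Classical in
/-- `P_{σ,τ}(X)`, the probability that the play, a word of length `n`, lies in `X`. -/
noncomputable def setProb (σ τ : Strategy α n) (X : Set (List α)) : ℝ :=
  ∑ π : Fin n → α, if List.ofFn π ∈ X then playProb σ τ (List.ofFn π) else 0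

/-- `L ∩ Σ^n`. -/
def wordsOfLength {α : Type*} (L : Language α) (n : ℕ) : Set (List α) :=
  {w | w ∈ L ∧ w.length = n}

/-- The width `W(X | h) = max_σ min_τ |{π : hπ ∈ X, P_{σ,τ}(π | h) > 0}|` of a set `X` of words of
length `n` given a history `h`. All the cardinalities are at most `|Σ|^(n - |h|)`, so the supremum
in `ℕ` is a maximum. -/
noncomputable def width (n : ℕ) (X : Set (List α)) (h : List α) : ℕ :=
  ⨆ σ : Strategy α n, ⨅ τ : Strategy α n, {π : List α | h ++ π ∈ X ∧ 0 < condProb σ τ h π}.ncard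

open Classical in
/-- The quantities `C(v, i)`: acceptance of `v` when the game has ended, the minimum over the
symbols on the adversary's turns and the sum over the symbols on ours. -/
noncomputable def dpWidth {V : Type*} (D : DFA α V) (n : ℕ) (v : V) (i : ℕ) : ℕ :=
  if _h : i < n then
    if Odd i then ⨅ u : α, dpWidth D n (D.step v u) (i + 1)
    else ∑ u : α, dpWidth D n (D.step v u) (i + 1)
  else if v ∈ D.accept then 1 else 0
termination_by n - i

/-- `σ` is an improvising strategy for the hard language `H`, the soft language `S`, the length `n`
(a parameter of the type of `σ`), the error probability `ε` and the probability bound `ρ`. -/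
structure IsImprovising (H S : Language α) (ε ρ : ℚ) (σ : Strategy α n) : Prop where
  hard : ∀ τ : Strategy α n, setProb σ τ (wordsOfLength H n) = 1
  soft : ∀ τ : Strategy α n,
    1 - (ε : ℝ) ≤ setProb σ τ (wordsOfLength H n ∩ wordsOfLength S n)
  random : ∀ τ : Strategy α n, ∀ π ∈ wordsOfLength H n, playProb σ τ π ≤ (ρ : ℝ)

end Games

/-! # Probabilistic programs with a bit-cost running time -/

/-- The data that programs work on: binary trees with natural numbers at the leaves. -/
inductive Val where
  | num (a : ℕ)
  | pair (x y : Val)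

namespace Val

/-- The number of bits of a datum, the numbers being written in binary. -/
def size : Val → ℕ
  | num a => 1 + Nat.size a
  | pair x y => 1 + x.size + y.size

/-- Lists as data. -/
def ofList : List Val → Val
  | [] => num 0
  | x :: l => pair x (ofList l)

/-- The unary representation of a natural number. -/
def unary (n : ℕ) : Val := ofList (List.replicate n (num 0))

/-- A nonnegative rational as the pair of its numerator and its denominator, in binary. -/
def ofRat (r : ℚ) : Val := pair (num r.num.natAbs) (num r.den)

/-- A history: the list of its symbols. -/
def ofWord {k : ℕ} (h : List (Fin k)) : Val := ofList (h.map fun u => num u)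

end Val

/-- The basic operations. -/
inductive Prim where
  | nop
  | fst
  | snd
  | isPair
  | add
  | sub
  | mul
  | div

namespace Prim

/-- The effect of a basic operation. The arithmetic operations work on a pair of numbers, with
truncated subtraction and with the quotient rounded down. -/
def eval : Prim → Val → Val
  | nop, x => x
  | fst, .pair x _ => x
  | snd, .pair _ y => y
  | isPair, .pair _ _ => .num 1
  | add, .pair (.num a) (.num b) => .num (a + b)
  | sub, .pair (.num a) (.num b) => .num (a - b)
  | mul, .pair (.num a) (.num b) => .num (a * b)
  | div, .pair (.num a) (.num b) => .num (a / b)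
  | _, _ => .num 0

/-- The time of a basic operation: linear in the number of bits of its argument, and quadratic for
multiplication and division. -/
def cost : Prim → Val → ℕ
  | mul, x => (1 + x.size) ^ 2
  | div, x => (1 + x.size) ^ 2
  | _, x => 1 + x.size

/-- The number of a basic operation in the encoding of programs. -/
def index : Prim → ℕ
  | nop => 0
  | fst => 1
  | snd => 2
  | isPair => 3
  | add => 4
  | sub => 5
  | mul => 6
  | div => 7

end Prim

/-- Probabilistic programs; each takes a datum and, if it halts, returns a datum. -/
inductive Prog where
  /-- A basic operation. -/
  | prim (p : Prim)
  /-- Return a constant. -/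
  | const (v : Val)
  /-- Toss a fair coin and return `0` or `1`. -/
  | flip
  /-- Run `f`, then `g` on the result. -/
  | seq (f g : Prog)
  /-- Run `f` and `g` on the argument and return the pair of the results. -/
  | pair (f g : Prog)
  /-- Run `c` on the argument, and then, also on the argument, `f` if `c` did not return `0`, and
  `g` if it did. -/
  | ite (c f g : Prog)
  /-- While `c` does not return `0` on the current datum, replace that datum by the result of `f`
  on it. -/
  | loop (c f : Prog)

namespace Prog

/-- Programs as data. -/
def encode : Prog → Val
  | prim p => .pair (.num 0) (.num p.index)
  | const v => .pair (.num 1) v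
  | flip => .pair (.num 2) (.num 0)
  | seq f g => .pair (.num 3) (.pair f.encode g.encode)
  | pair f g => .pair (.num 4) (.pair f.encode g.encode)
  | ite c f g => .pair (.num 5) (.pair c.encode (.pair f.encode g.encode))
  | loop c f => .pair (.num 6) (.pair c.encode f.encode)

end Prog

/-- `Exec P x bits y t`: when `bits` are the outcomes of the coin tosses, the program `P` started on
`x` makes exactly these tosses and halts, after time `t`, with the result `y`. Each construct is
charged for the bits of the data that it reads or copies. -/
inductive Exec : Prog → Val → List Bool → Val → ℕ → Prop where
  | prim (p : Prim) (x : Val) : Exec (.prim p) x [] (p.eval x) (p.cost x)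
  | const (v x : Val) : Exec (.const v) x [] v (1 + x.size + v.size)
  | flip (b : Bool) (x : Val) : Exec .flip x [b] (.num b.toNat) (1 + x.size)
  | seq {f g : Prog} {x y z : Val} {b₁ b₂ : List Bool} {t₁ t₂ : ℕ} :
      Exec f x b₁ y t₁ → Exec g y b₂ z t₂ →
      Exec (.seq f g) x (b₁ ++ b₂) z (1 + t₁ + t₂)
  | pair {f g : Prog} {x y z : Val} {b₁ b₂ : List Bool} {t₁ t₂ : ℕ} :
      Exec f x b₁ y t₁ → Exec g x b₂ z t₂ →
      Exec (.pair f g) x (b₁ ++ b₂) (.pair y z) (1 + x.size + t₁ + t₂)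
  | ite_true {c f g : Prog} {x y z : Val} {b₁ b₂ : List Bool} {t₁ t₂ : ℕ} :
      Exec c x b₁ y t₁ → y ≠ .num 0 → Exec f x b₂ z t₂ →
      Exec (.ite c f g) x (b₁ ++ b₂) z (1 + x.size + t₁ + t₂)
  | ite_false {c f g : Prog} {x z : Val} {b₁ b₂ : List Bool} {t₁ t₂ : ℕ} :
      Exec c x b₁ (.num 0) t₁ → Exec g x b₂ z t₂ →
      Exec (.ite c f g) x (b₁ ++ b₂) z (1 + x.size + t₁ + t₂)
  | loop_done {c f : Prog} {x : Val} {b₁ : List Bool} {t₁ : ℕ} :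
      Exec c x b₁ (.num 0) t₁ →
      Exec (.loop c f) x b₁ x (1 + x.size + t₁)
  | loop_step {c f : Prog} {x y x' z : Val} {b₁ b₂ b₃ : List Bool} {t₁ t₂ t₃ : ℕ} :
      Exec c x b₁ y t₁ → y ≠ .num 0 → Exec f x b₂ x' t₂ → Exec (.loop c f) x' b₃ z t₃ →
      Exec (.loop c f) x (b₁ ++ b₂ ++ b₃) z (1 + x.size + t₁ + t₂ + t₃)

open scoped ENNReal

namespace Prog

open Classical in
/-- The probability that `P` halts on `x` with the result `y`: the sum of `2^(-|b|)` over the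
sequences `b` of coin tosses on which it does so. -/
noncomputable def outProb (P : Prog) (x y : Val) : ℝ≥0∞ :=
  ∑' b : List Bool, if ∃ t, Exec P x b y t then (2⁻¹ : ℝ≥0∞) ^ b.length else 0

open Classical in
/-- The probability that `P` halts on `x`. -/
noncomputable def haltProb (P : Prog) (x : Val) : ℝ≥0∞ :=
  ∑' b : List Bool, if ∃ y t, Exec P x b y t then (2⁻¹ : ℝ≥0∞) ^ b.length else 0

open Classical in
/-- The expected running time of `P` on `x`, infinite if `P` does not halt almost surely. -/
noncomputable def expectedTime (P : Prog) (x : Val) : ℝ≥0∞ :=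
  if P.haltProb x = 1 then
    ∑' bt : List Bool × ℕ,
      if ∃ y, Exec P x bt.1 y bt.2 then (2⁻¹ : ℝ≥0∞) ^ bt.1.length * (bt.2 : ℝ≥0∞) else 0
  else ∞

end Prog

/-! # Specifications, instances and improvisation schemes -/

/-- A class of specifications: the specifications over each alphabet `{0, …, k - 1}`, the language
that each of them defines, and its representation. -/
structure SpecClass where
  Spec : ℕ → Type
  lang : {k : ℕ} → Spec k → Language (Fin k)
  encode : {k : ℕ} → Spec k → Val

/-- An instance `(H, S, n, ε, ρ)` of reactive control improvisation with the hard specification from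
`HSpec` and the soft one from `SSpec`. -/
structure RCIInstance (HSpec SSpec : SpecClass) where
  k : ℕ
  k_pos : 0 < k
  H : HSpec.Spec k
  S : SSpec.Spec k
  n : ℕ
  ε : ℚ
  ρ : ℚ
  ε_nonneg : 0 ≤ ε
  ε_le_one : ε ≤ 1
  ρ_nonneg : 0 ≤ ρ
  ρ_le_one : ρ ≤ 1

namespace RCIInstance

variable {HSpec SSpec : SpecClass}

/-- The representation of an instance, with `n` in unary and `ε`, `ρ` in binary. -/
def encode (C : RCIInstance HSpec SSpec) : Val :=
  Val.ofList [.num C.k, HSpec.encode C.H, SSpec.encode C.S, Val.unary C.n,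
    Val.ofRat C.ε, Val.ofRat C.ρ]

/-- The size of an instance, the number of bits of its representation. -/
def size (C : RCIInstance HSpec SSpec) : ℕ := C.encode.size

/-- `σ` is an improvising strategy for the instance. -/
def IsImprovisingStrategy (C : RCIInstance HSpec SSpec) (σ : Strategy (Fin C.k) C.n) : Prop :=
  IsImprovising (HSpec.lang C.H) (SSpec.lang C.S) C.ε C.ρ σ

/-- The instance has an improvising strategy. -/
def Realizable (C : RCIInstance HSpec SSpec) : Prop :=
  ∃ σ, C.IsImprovisingStrategy σ

/-- `G` is an improviser: an expected-finite time probabilistic program whose output distribution on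
each history `h` of length at most `n` is `σ(h, ·)`, for some improvising strategy `σ`. -/
def IsImproviser (C : RCIInstance HSpec SSpec) (G : Prog) : Prop :=
  ∃ σ, C.IsImprovisingStrategy σ ∧ ∀ h : List (Fin C.k), h.length ≤ C.n →
    G.expectedTime (Val.ofWord h) < ∞ ∧
    ∀ u : Fin C.k, G.outProb (Val.ofWord h) (.num u) = ENNReal.ofReal (σ.prob h u)

end RCIInstance

/-- The output `⊥` of a scheme. -/
def botOutput : Val := .num 0

/-- The output of a scheme that consists of the improviser `G`. -/
def progOutput (G : Prog) : Val := .pair (.num 1) G.encode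

/-- The (deterministic) program `S` is a polynomial-time improvisation scheme for the class of the
instances with hard specifications from `HSpec` and soft specifications from `SSpec`. -/
structure IsPolyTimeImprovisationScheme (HSpec SSpec : SpecClass) (S : Prog) : Prop where
  correctness : ∀ C : RCIInstance HSpec SSpec,
    (C.Realizable → ∃ G t, Exec S C.encode [] (progOutput G) t ∧ C.IsImproviser G) ∧
    (¬ C.Realizable → ∃ t, Exec S C.encode [] botOutput t)
  scheme_efficiency : ∃ p : Polynomial ℕ, ∀ (C : RCIInstance HSpec SSpec) (bits : List Bool)
    (out : Val) (t : ℕ), Exec S C.encode bits out t → t ≤ p.eval C.size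
  improviser_efficiency : ∃ q : Polynomial ℕ, ∀ (C : RCIInstance HSpec SSpec) (G : Prog) (t : ℕ),
    Exec S C.encode [] (progOutput G) t → ∀ h : List (Fin C.k), h.length ≤ C.n →
      G.expectedTime (Val.ofWord h) ≤ ((q.eval C.size : ℕ) : ℝ≥0∞)

/-- A deterministic finite automaton over the alphabet `{0, …, k - 1}`. -/
structure DFASpec (k : ℕ) where
  m : ℕ
  D : DFA (Fin k) (Fin m)

open Classical in
/-- The class of deterministic finite automata. An automaton is represented by its initial state and
the list, over its states, of the acceptance bit together with the row of the transition table. -/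
noncomputable def dfaClass : SpecClass where
  Spec := DFASpec
  lang X := X.D.accepts
  encode X := .pair (.num X.D.start) (Val.ofList (List.ofFn fun v =>
    .pair (.num (if v ∈ X.D.accept then 1 else 0))
      (Val.ofList (List.ofFn fun u => .num (X.D.step v u)))))

/-- A reachability/safety game: the symbols played cause transitions in a finite state space, and a
play is won if it visits `target` and never visits `unsafeStates`. Reachability games are those in
which `unsafeStates` is empty, safety games those in which every state is in `target`. -/
structure RSGame (k : ℕ) where
  m : ℕ
  step : Fin m → Fin k → Fin m
  start : Fin m
  target : Set (Fin m)
  unsafeStates : Set (Fin m)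

namespace RSGame

/-- The state after the moves `w`. -/
def eval {k : ℕ} (X : RSGame k) (w : List (Fin k)) : Fin X.m := w.foldl X.step X.start

/-- The set of the plays that are won; the states visited include the first and the last one. -/
def wins {k : ℕ} (X : RSGame k) : Language (Fin k) :=
  {w | (∃ h, h <+: w ∧ X.eval h ∈ X.target) ∧ ∀ h, h <+: w → X.eval h ∉ X.unsafeStates}

end RSGame

open Classical in
/-- The class of reachability/safety games, represented in the same way as automata. -/
noncomputable def rsgClass : SpecClass where
  Spec := RSGame
  lang X := X.wins
  encode X := .pair (.num X.start) (Val.ofList (List.ofFn fun v =>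
    .pair (.pair (.num (if v ∈ X.target then 1 else 0)) (.num (if v ∈ X.unsafeStates then 1 else 0)))
      (Val.ofList (List.ofFn fun u => .num (X.step v u)))))

end RCI

namespace RCI

/-! # Executions of programs -/

/-! Width. Only the supports of the strategies matter. An adversary that always plays a symbol
attaining the minimum in `dpWidth` keeps the number of possible accepted plays at most `dpWidth`.
Uniform play on our side keeps it at least `dpWidth`: every symbol stays possible on our turns, and
some symbol is possible on the adversary's. Both bounds are inductions on the remaining length
(`width_eq_dpWidth`). The product automaton is `DFA.accepts_inter`.

Realizability. For automata, an instance is realizable iff `1 - ε ≤ ρ * W(A)` and `1 ≤ ρ * W(I)`.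
Necessity: against the minimizing adversary, plays of probability at most `ρ` have total mass at
most `ρ` times the width (`exists_setProb_le`, applied to `A` and to `I`). Sufficiency: after
clearing denominators, the unit mass becomes an integral budget, one part of which has to end in
`A`. On our turns it is distributed greedily over the symbols, within capacities proportional to the
widths of the successors. On the adversary's turns it passes undivided to every successor, whose
widths are no smaller. Playing symbols in proportion to their shares is then improvising
(`budgetStrategy_spec`): at the end a word of `I` holds at most the scaled `ρ`, a word outside `I`
holds nothing, and the part reserved for `A` lies in `A`.

Complexity. Widths can be exponential in `n` but have polynomially many bits, and `n` is given in
unary, so the tables of widths for the hard automaton and the product take polynomial time. `Comp`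
is a calculus of closure properties of polynomial time; iteration is allowed when the intermediate
data have polynomial size. The scheme checks the two inequalities and outputs a program that
contains the instance as a constant. On a history that program computes the integer weights of the
next symbols and samples by rejection from blocks of coin tosses, with a bounded expected number of
rounds (`exists_sampler`, `exists_generator`).

Games. A reachability/safety game becomes an automaton with three copies of its states. The language
is unchanged, so the improvising strategies and the improvisers are the same. -/

theorem eval_mono (p : Polynomial ℕ) {a b : ℕ} (h : a ≤ b) : p.eval a ≤ p.eval b := by
  rw [Polynomial.eval_eq_sum_range, Polynomial.eval_eq_sum_range]
  gcongr

theorem natSize_add_le (a b : ℕ) : Nat.size (a + b) ≤ Nat.size a + Nat.size b := by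
  rw [Nat.size_le, pow_add]
  have ha := Nat.lt_size_self a
  have hb := Nat.lt_size_self b
  nlinarith

theorem natSize_mul_le (a b : ℕ) : Nat.size (a * b) ≤ Nat.size a + Nat.size b := by
  rw [Nat.size_le, pow_add]
  exact Nat.mul_lt_mul'' (Nat.lt_size_self a) (Nat.lt_size_self b)

theorem Val.one_le_size (x : Val) : 1 ≤ x.size := by cases x <;> simp [Val.size, add_assoc]

theorem Prim.size_eval_le (p : Prim) (x : Val) : (p.eval x).size ≤ p.cost x := by
  rcases x with a | ⟨x, y⟩
  · cases p <;> simp [Prim.eval, Prim.cost, Val.size]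
    all_goals first | omega | (rw [pow_two]; nlinarith [Nat.zero_le (Nat.size a)])
  · have := x.one_le_size
    have := y.one_le_size
    rcases x with a | ⟨x, x'⟩ <;> rcases y with b | ⟨y, y'⟩ <;> cases p <;>
      simp [Prim.eval, Prim.cost, Val.size]
    all_goals try omega
    all_goals try (rw [pow_two]; nlinarith)
    · have := natSize_add_le a b; omega
    · have := Nat.size_le_size (Nat.sub_le a b); omega
    · have := natSize_mul_le a b; nlinarith
    · have := Nat.size_le_size (Nat.div_le_self a b)
      have := Nat.le_self_pow two_ne_zero (1 + (1 + (1 + a.size) + (1 + b.size)))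
      omega

theorem Exec.size_le {P : Prog} {x y : Val} {b : List Bool} {t : ℕ} (h : Exec P x b y t) :
    y.size ≤ t := by
  induction h with
  | prim p x => exact p.size_eval_le x
  | flip b x =>
      have := x.one_le_size
      cases b <;> (simp [Val.size]; try omega)
  | pair => simp only [Val.size]; omega
  | _ => omega

/-- The coin tosses consumed by the halting executions of a program form a prefix-free code. -/
theorem Exec.prefix_free {P : Prog} {x y : Val} {b : List Bool} {t : ℕ} (h : Exec P x b y t) :
    -- The tails `c`, `c'` are arbitrary so that the tosses of later subprograms can be absorbed
    -- into them when the hypothesis for the first subprogram is applied.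
    ∀ {b' : List Bool} {y' : Val} {t' : ℕ} {c c' : List Bool}, Exec P x b' y' t' →
      b ++ c = b' ++ c' → b = b' ∧ y = y' ∧ t = t' := by
  induction h with
  | prim => rintro _ _ _ _ _ ⟨⟩ _; simp
  | const => rintro _ _ _ _ _ ⟨⟩ _; simp
  | flip => rintro _ _ _ _ _ ⟨⟩ h; simp at h; simp [h]
  | seq _ _ ih₁ ih₂ =>
      intro _ _ _ c c' h e
      cases h with
      | seq h₁ h₂ =>
        simp only [List.append_assoc] at e
        obtain ⟨rfl, rfl, rfl⟩ := ih₁ h₁ e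
        obtain ⟨rfl, rfl, rfl⟩ := ih₂ h₂ (List.append_cancel_left e)
        simp
  | pair _ _ ih₁ ih₂ =>
      intro _ _ _ c c' h e
      cases h with
      | pair h₁ h₂ =>
        simp only [List.append_assoc] at e
        obtain ⟨rfl, rfl, rfl⟩ := ih₁ h₁ e
        obtain ⟨rfl, rfl, rfl⟩ := ih₂ h₂ (List.append_cancel_left e)
        simp
  | ite_true _ hy _ ih₁ ih₂ =>
      intro _ _ _ c c' h e
      cases h with
      | ite_true h₁ _ h₂ =>
        simp only [List.append_assoc] at e
        obtain ⟨rfl, rfl, rfl⟩ := ih₁ h₁ e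
        obtain ⟨rfl, rfl, rfl⟩ := ih₂ h₂ (List.append_cancel_left e)
        simp
      | ite_false h₁ h₂ =>
        simp only [List.append_assoc] at e
        exact absurd (ih₁ h₁ e).2.1 hy
  | ite_false _ _ ih₁ ih₂ =>
      intro _ _ _ c c' h e
      cases h with
      | ite_false h₁ h₂ =>
        simp only [List.append_assoc] at e
        obtain ⟨rfl, -, rfl⟩ := ih₁ h₁ e
        obtain ⟨rfl, rfl, rfl⟩ := ih₂ h₂ (List.append_cancel_left e)
        simp
      | ite_true h₁ hy h₂ =>
        simp only [List.append_assoc] at e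
        exact absurd (ih₁ h₁ e).2.1.symm hy
  | loop_done _ ih₁ =>
      intro _ _ _ c c' h e
      cases h with
      | loop_done h₁ =>
        obtain ⟨rfl, -, rfl⟩ := ih₁ h₁ e
        simp
      | loop_step h₁ hy h₂ h₃ =>
        simp only [List.append_assoc] at e
        exact absurd (ih₁ h₁ e).2.1.symm hy
  | loop_step _ hy _ _ ih₁ ih₂ ih₃ =>
      intro _ _ _ c c' h e
      cases h with
      | loop_done h₁ =>
        simp only [List.append_assoc] at e
        exact absurd (ih₁ h₁ e).2.1 hy
      | loop_step h₁ _ h₂ h₃ =>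
        simp only [List.append_assoc] at e
        obtain ⟨rfl, rfl, rfl⟩ := ih₁ h₁ e
        have e := List.append_cancel_left e
        obtain ⟨rfl, rfl, rfl⟩ := ih₂ h₂ e
        obtain ⟨rfl, rfl, rfl⟩ := ih₃ h₃ (List.append_cancel_left e)
        simp

/-- A program with a halting execution without coin tosses has no other halting execution. -/
theorem Exec.deterministic {P : Prog} {x y y' : Val} {b : List Bool} {t t' : ℕ}
    (h : Exec P x [] y t) (h' : Exec P x b y' t') : b = [] ∧ y' = y ∧ t' = t := by
  obtain ⟨h₁, h₂, h₃⟩ := h.prefix_free (c := b) (c' := []) h' (by simp)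
  exact ⟨h₁.symm, h₂.symm, h₃.symm⟩

/-! # Polynomially bounded functions -/

/-- `t` is bounded by a polynomial in `b`. -/
def PBdd {ι : Type} (b t : ι → ℕ) : Prop := ∃ p : Polynomial ℕ, ∀ i, t i ≤ p.eval (b i)

namespace PBdd

variable {ι : Type} {b s t : ι → ℕ}

theorem self : PBdd b b := ⟨.X, fun i => by simp⟩

theorem const (c : ℕ) : PBdd b fun _ => c := ⟨.C c, fun i => by simp⟩

theorem mono (ht : PBdd b t) (h : ∀ i, s i ≤ t i) : PBdd b s :=
  ht.imp fun _ hp i => (h i).trans (hp i)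

theorem add (hs : PBdd b s) (ht : PBdd b t) : PBdd b fun i => s i + t i := by
  obtain ⟨p, hp⟩ := hs
  obtain ⟨q, hq⟩ := ht
  exact ⟨p + q, fun i => by simpa using Nat.add_le_add (hp i) (hq i)⟩

theorem mul (hs : PBdd b s) (ht : PBdd b t) : PBdd b fun i => s i * t i := by
  obtain ⟨p, hp⟩ := hs
  obtain ⟨q, hq⟩ := ht
  exact ⟨p * q, fun i => by simpa using Nat.mul_le_mul (hp i) (hq i)⟩

theorem pow (hs : PBdd b s) (n : ℕ) : PBdd b fun i => s i ^ n := by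
  obtain ⟨p, hp⟩ := hs
  exact ⟨p ^ n, fun i => by simpa using Nat.pow_le_pow_left (hp i) n⟩

theorem trans (hs : PBdd b s) (ht : PBdd s t) : PBdd b t := by
  obtain ⟨p, hp⟩ := hs
  obtain ⟨q, hq⟩ := ht
  exact ⟨q.comp p, fun i => by
    simpa using (hq i).trans (eval_mono q (hp i))⟩

theorem eval (hs : PBdd b s) (q : Polynomial ℕ) : PBdd b fun i => q.eval (s i) :=
  hs.trans ⟨q, fun _ => le_rfl⟩

end PBdd

/-! # Encoded data -/

/-- Types whose elements are represented as data. -/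
class Enc (β : Type) where
  enc : β → Val

open Enc (enc)

instance : Enc Val := ⟨fun v => v⟩
instance : Enc ℕ := ⟨Val.num⟩
instance {β γ : Type} [Enc β] [Enc γ] : Enc (β × γ) := ⟨fun x => .pair (enc x.1) (enc x.2)⟩
instance {β : Type} [Enc β] : Enc (List β) := ⟨fun l => Val.ofList (l.map enc)⟩

section EncLemmas

variable {β γ : Type} [Enc β] [Enc γ]

theorem enc_val (v : Val) : enc v = v := rfl

theorem enc_nat (a : ℕ) : enc a = Val.num a := rfl

theorem enc_prod (x : β) (y : γ) : enc (x, y) = Val.pair (enc x) (enc y) := rfl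

theorem size_enc_nil : (enc ([] : List β)).size = 1 := rfl

theorem size_enc_cons (x : β) (l : List β) :
    (enc (x :: l)).size = 1 + (enc x).size + (enc l).size := rfl

theorem size_enc_nat (a : ℕ) : (enc a).size = 1 + Nat.size a := rfl

theorem size_enc_prod (x : β) (y : γ) : (enc (x, y)).size = 1 + (enc x).size + (enc y).size := rfl

theorem length_lt_size_enc (l : List β) : l.length < (enc l).size := by
  induction l with
  | nil => simp [size_enc_nil]
  | cons x l ih => rw [size_enc_cons, List.length_cons]; omega

theorem size_enc_le_of_mem {x : β} {l : List β} (h : x ∈ l) : (enc x).size < (enc l).size := by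
  induction l with
  | nil => simp at h
  | cons y l ih =>
    rw [size_enc_cons]
    rcases List.mem_cons.1 h with rfl | h
    · omega
    · have := ih h; omega

theorem size_enc_append (l l' : List β) :
    (enc (l ++ l')).size + 1 = (enc l).size + (enc l').size := by
  induction l with
  | nil => rw [List.nil_append, size_enc_nil]; omega
  | cons x l ih => rw [List.cons_append, size_enc_cons, size_enc_cons]; omega

theorem size_enc_reverse (l : List β) : (enc l.reverse).size = (enc l).size := by
  induction l with
  | nil => rfl
  | cons x l ih =>
    have := size_enc_append l.reverse [x]
    rw [size_enc_cons, size_enc_nil] at this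
    rw [List.reverse_cons, size_enc_cons]
    omega

theorem size_enc_list_le {l : List β} {B : ℕ} (h : ∀ x ∈ l, (enc x).size ≤ B) :
    (enc l).size ≤ 1 + l.length * (1 + B) := by
  induction l with
  | nil => simp [size_enc_nil]
  | cons x l ih =>
    have h1 := h x (by simp)
    have h2 := ih fun y hy => h y (by simp [hy])
    rw [size_enc_cons, List.length_cons, add_mul]
    omega

theorem size_enc_take_le (l : List β) (j : ℕ) : (enc (l.take j)).size ≤ (enc l).size := by
  have := size_enc_append (l.take j) (l.drop j)
  rw [List.take_append_drop] at this
  have := (enc (l.drop j)).one_le_size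
  omega

theorem size_enc_drop_le (l : List β) (j : ℕ) : (enc (l.drop j)).size ≤ (enc l).size := by
  have := size_enc_append (l.take j) (l.drop j)
  rw [List.take_append_drop] at this
  have := (enc (l.take j)).one_le_size
  omega

theorem size_enc_sum_le (l : List ℕ) : (enc l.sum).size ≤ (enc l).size := by
  induction l with
  | nil => simp [size_enc_nil, size_enc_nat]
  | cons x l ih =>
    have := natSize_add_le x l.sum
    rw [size_enc_nat] at *
    rw [size_enc_cons, List.sum_cons, size_enc_nat]
    omega

end EncLemmas

/-! # Functions computable in polynomial time -/

/-- Some deterministic program computes `f i` from the datum `e i`, in polynomial time. -/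
def Comp {ι β : Type} [Enc β] (e : ι → Val) (f : ι → β) : Prop :=
  ∃ (P : Prog) (p : Polynomial ℕ), ∀ i, ∃ t, t ≤ p.eval (e i).size ∧ Exec P (e i) [] (enc (f i)) t

/-- The datum `e i` together with an element of a further type. -/
def ext {ι : Type} (e : ι → Val) (β : Type) [Enc β] : ι × β → Val :=
  fun z => .pair (e z.1) (enc z.2)

namespace Comp

variable {ι κ β γ δ : Type} [Enc β] [Enc γ] [Enc δ] {e : ι → Val}

theorem pbdd {f : ι → β} (hf : Comp e f) :
    PBdd (fun i => (e i).size) fun i => (enc (f i)).size := by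
  obtain ⟨P, p, h⟩ := hf
  refine ⟨p, fun i => ?_⟩
  obtain ⟨t, ht, h⟩ := h i
  exact h.size_le.trans ht

theorem pbdd_nat {f : ι → ℕ} (hf : Comp e f) :
    PBdd (fun i => (e i).size) fun i => Nat.size (f i) :=
  hf.pbdd.mono fun i => by rw [size_enc_nat]; omega

theorem pbdd_length {f : ι → List β} (hf : Comp e f) :
    PBdd (fun i => (e i).size) fun i => (f i).length :=
  hf.pbdd.mono fun _ => (length_lt_size_enc _).le

theorem of_pbdd {f : ι → β} (P : Prog) {t : ι → ℕ} (ht : PBdd (fun i => (e i).size) t)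
    (h : ∀ i, Exec P (e i) [] (enc (f i)) (t i)) : Comp e f := by
  obtain ⟨p, hp⟩ := ht
  exact ⟨P, p, fun i => ⟨t i, hp i, h i⟩⟩

theorem iff_time {f : ι → β} : Comp e f ↔ ∃ (P : Prog) (t : ι → ℕ),
    PBdd (fun i => (e i).size) t ∧ ∀ i, Exec P (e i) [] (enc (f i)) (t i) := by
  refine ⟨fun ⟨P, p, h⟩ => ?_, fun ⟨P, t, ht, h⟩ => of_pbdd P ht h⟩
  choose t ht h using h
  exact ⟨P, t, ⟨p, ht⟩, h⟩

/-- Only the encoding matters, so a datum may be read at another type: a tuple as a `Val`, or a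
nonempty list as the pair of its head and tail. -/
theorem congr_enc {f : ι → β} {g : ι → γ} (hf : Comp e f) (h : ∀ i, enc (f i) = enc (g i)) :
    Comp e g := by
  unfold Comp at *
  simpa only [← h] using hf

theorem congr {f g : ι → β} (hf : Comp e f) (h : ∀ i, f i = g i) : Comp e g :=
  hf.congr_enc fun i => by rw [h]

theorem reindex {f : ι → β} (hf : Comp e f) (r : κ → ι) :
    Comp (fun k => e (r k)) fun k => f (r k) := by
  obtain ⟨P, p, h⟩ := hf
  exact ⟨P, p, fun k => h (r k)⟩

theorem self : Comp e e :=
  of_pbdd (.prim .nop) ((PBdd.const 1).add .self) fun i => by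
    have h := Exec.prim .nop (e i)
    rwa [show Prim.nop.eval (e i) = e i by cases e i <;> rfl] at h

theorem comp {f : ι → β} {g : ι → γ} (hf : Comp e f) (hg : Comp (fun i => enc (f i)) g) :
    Comp e g := by
  have hb := hf.pbdd
  obtain ⟨P, s, hs, h⟩ := iff_time.1 hf
  obtain ⟨Q, t, ht, h'⟩ := iff_time.1 hg
  exact of_pbdd (P.seq Q) (((PBdd.const 1).add hs).add (hb.trans ht)) fun i => (h i).seq (h' i)

theorem const (v : β) : Comp e fun _ => v :=
  of_pbdd (.const (enc v)) (((PBdd.const 1).add .self).add (.const _)) fun _ => .const _ _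

theorem pair {f : ι → β} {g : ι → γ} (hf : Comp e f) (hg : Comp e g) :
    Comp e fun i => (f i, g i) := by
  obtain ⟨P, s, hs, h⟩ := iff_time.1 hf
  obtain ⟨Q, t, ht, h'⟩ := iff_time.1 hg
  exact of_pbdd (P.pair Q) ((((PBdd.const 1).add .self).add hs).add ht) fun i => (h i).pair (h' i)

theorem of_prim (p : Prim) {f : ι → β} {g : ι → γ} (hf : Comp e f)
    (h : ∀ i, p.eval (enc (f i)) = enc (g i)) : Comp e g := by
  refine hf.comp (of_pbdd (.prim p) (t := fun i => p.cost (enc (f i))) ?_ fun i => ?_)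
  · have : PBdd (fun i => (enc (f i)).size) fun i => 1 + (enc (f i)).size :=
      (PBdd.const 1).add .self
    cases p <;> first | exact this | exact this.pow 2
  · rw [← h]
    exact .prim p _

theorem fst {f : ι → β × γ} (hf : Comp e f) : Comp e fun i => (f i).1 :=
    hf.of_prim .fst fun _ => rfl

theorem snd {f : ι → β × γ} (hf : Comp e f) : Comp e fun i => (f i).2 :=
    hf.of_prim .snd fun _ => rfl

theorem add {f g : ι → ℕ} (hf : Comp e f) (hg : Comp e g) : Comp e fun i => f i + g i :=
  (hf.pair hg).of_prim .add fun _ => rfl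

theorem sub {f g : ι → ℕ} (hf : Comp e f) (hg : Comp e g) : Comp e fun i => f i - g i :=
  (hf.pair hg).of_prim .sub fun _ => rfl

theorem mul {f g : ι → ℕ} (hf : Comp e f) (hg : Comp e g) : Comp e fun i => f i * g i :=
  (hf.pair hg).of_prim .mul fun _ => rfl

theorem div {f g : ι → ℕ} (hf : Comp e f) (hg : Comp e g) : Comp e fun i => f i / g i :=
  (hf.pair hg).of_prim .div fun _ => rfl

/-- `wk` and `var` treat `ext e γ` as a context with one more variable, in the manner of de Bruijn
indices; this is how bodies of folds and maps refer to the outer data. -/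
theorem wk {f : ι → β} (hf : Comp e f) : Comp (ext e γ) fun z => f z.1 := by
  have h : Comp (ext e γ) fun z => e z.1 :=
    (self.congr_enc (g := fun z : ι × γ => (e z.1, z.2)) fun _ => rfl).fst
  exact h.comp (hf.reindex Prod.fst)

theorem var : Comp (ext e γ) fun z => z.2 :=
  (self.congr_enc (g := fun z : ι × γ => (e z.1, z.2)) fun _ => rfl).snd

theorem ite {c : ι → ℕ} {f g : ι → β} (hc : Comp e c) (hf : Comp e f) (hg : Comp e g) :
    Comp e fun i => if c i = 0 then g i else f i := by
  obtain ⟨C, r, hr, h⟩ := iff_time.1 hc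
  obtain ⟨P, s, hs, h'⟩ := iff_time.1 hf
  obtain ⟨Q, t, ht, h''⟩ := iff_time.1 hg
  refine of_pbdd (.ite C P Q) (t := fun i => 1 + (e i).size + r i + if c i = 0 then t i else s i)
    ((((PBdd.const 1).add .self).add hr).add ((hs.add ht).mono fun i => ?_)) fun i => ?_
  · split_ifs <;> omega
  · have h := h i
    split_ifs with hi
    · rw [hi] at h
      exact h.ite_false (h'' i)
    · exact h.ite_true (fun h => hi (Val.num.inj h)) (h' i)

theorem ite_le {a b : ι → ℕ} {f g : ι → β} (ha : Comp e a) (hb : Comp e b) (hf : Comp e f)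
    (hg : Comp e g) : Comp e fun i => if a i ≤ b i then f i else g i :=
  ((ha.sub hb).ite hg hf).congr fun i => by simp only [Nat.sub_eq_zero_iff_le]

theorem ite_eq {a b : ι → ℕ} {f g : ι → β} (ha : Comp e a) (hb : Comp e b) (hf : Comp e f)
    (hg : Comp e g) : Comp e fun i => if a i = b i then f i else g i :=
  (((ha.sub hb).add (hb.sub ha)).ite hg hf).congr fun i => by
    by_cases h : a i = b i
    · rw [if_pos (by omega), if_pos h]
    · rw [if_neg (by omega), if_neg h]

theorem min {a b : ι → ℕ} (ha : Comp e a) (hb : Comp e b) : Comp e fun i => min (a i) (b i) :=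
  (ha.ite_le hb ha hb).congr fun i => by rw [min_def]

theorem ite_odd {a : ι → ℕ} {f g : ι → β} (ha : Comp e a) (hf : Comp e f) (hg : Comp e g) :
    Comp e fun i => if Odd (a i) then f i else g i :=
  ((ha.sub ((const 2).mul (ha.div (const 2)))).ite hf hg).congr fun i => by
    rcases Nat.even_or_odd' (a i) with ⟨c, h | h⟩
    · have : ¬ Odd (a i) := by rw [h]; simp
      rw [if_pos (by omega), if_neg this]
    · have : Odd (a i) := by rw [h]; simp
      rw [if_neg (by omega), if_pos this]

/-! ## Iteration -/

/-- There are polynomially many rounds, each on a datum of size at most `B i`, so the time is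
polynomial; without the size bound, repeated squaring would be a counterexample. The subtypes ask
for the test and the body only on states that occur. -/
theorem loop (N : ι → ℕ) (s : ι → ℕ → Val) (h0 : Comp e fun i => s i 0)
    (hc : Comp (fun z : {z : ι × ℕ // z.2 ≤ N z.1} => s z.1.1 z.1.2)
      fun z => if z.1.2 < N z.1.1 then (1 : ℕ) else 0)
    (hb : Comp (fun z : {z : ι × ℕ // z.2 < N z.1} => s z.1.1 z.1.2) fun z => s z.1.1 (z.1.2 + 1))
    (hN : PBdd (fun i => (e i).size) N) {B : ι → ℕ} (hB : PBdd (fun i => (e i).size) B)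
    (hs : ∀ i, ∀ j ≤ N i, (s i j).size ≤ B i) : Comp e fun i => s i (N i) := by
  obtain ⟨P, p, hp, hP⟩ := iff_time.1 h0
  obtain ⟨C, c, hC⟩ := hc
  obtain ⟨F, f, hF⟩ := hb
  -- Induction on the number `m` of rounds still to be made, since an execution of a loop is built
  -- from its last round backwards.
  have key : ∀ m i j, j + m = N i → ∃ t, t ≤ (m + 1) * (1 + B i + c.eval (B i) + f.eval (B i)) ∧
      Exec (.loop C F) (s i j) [] (s i (N i)) t := by
    intro m
    induction m with
    | zero =>
      intro i j hj
      obtain ⟨t, ht, h⟩ := hC ⟨(i, j), by simp; omega⟩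
      obtain rfl : j = N i := by omega
      simp only [lt_irrefl, if_false] at h
      have h1 := hs i (N i) le_rfl
      have h2 := eval_mono c h1
      exact ⟨_, by simp only at ht; omega, Exec.loop_done h⟩
    | succ m ih =>
      intro i j hj
      obtain ⟨t, ht, h⟩ := hC ⟨(i, j), by simp; omega⟩
      obtain ⟨t', ht', h'⟩ := hF ⟨(i, j), by simp; omega⟩
      obtain ⟨t'', ht'', h''⟩ := ih i (j + 1) (by omega)
      simp only [if_pos (show j < N i by omega)] at h
      have h1 := hs i j (by omega)
      have h2 := eval_mono c h1
      have h3 := eval_mono f h1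
      refine ⟨_, ?_, Exec.loop_step h (by simp [enc_nat]) h' h''⟩
      rw [add_mul (m + 1)]
      dsimp only at ht ht'
      omega
  choose t ht h using fun i => key (N i) i 0 (by simp)
  refine of_pbdd (P.seq (.loop C F)) (t := fun i => 1 + p i + t i) ?_ fun i => (hP i).seq (h i)
  refine ((PBdd.const 1).add hp).add (PBdd.mono ?_ ht)
  exact (hN.add (.const 1)).mul ((((PBdd.const 1).add hB).add (hB.eval c)).add (hB.eval f))

theorem isPair {f : ι → Val} (hf : Comp e f) :
    Comp e fun i => match f i with
      | .num _ => 0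
      | .pair _ _ => 1 :=
  hf.of_prim .isPair fun i => by
    rw [enc_val]
    cases f i <;> rfl

/-- The size of the accumulator has to be bounded after every prefix of the list, not just at the
end; all later list operations supply such a bound. -/
theorem foldl {L : ι → List β} {a : ι → γ} {F : (ι × γ) × β → γ} (hL : Comp e L) (ha : Comp e a)
    (hF : Comp (ext (ext e γ) β) F) {B : ι → ℕ} (hB : PBdd (fun i => (e i).size) B)
    (hs : ∀ i, ∀ l, l <+: L i → (enc (l.foldl (fun c x => F ((i, c), x)) (a i))).size ≤ B i) :
    Comp e fun i => (L i).foldl (fun c x => F ((i, c), x)) (a i) := by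
  let A : ι → ℕ → γ := fun i j => ((L i).take j).foldl (fun c x => F ((i, c), x)) (a i)
  have h : Comp e fun i => enc ((L i).drop (L i).length, (e i, A i (L i).length)) := by
    -- The loop state consists of the unread rest of the list, the context `e i` that `F` may
    -- consult, and the accumulator. An encoded list is a pair exactly when it is nonempty, which
    -- gives the loop test.
    refine loop (fun i => (L i).length) (fun i j => enc ((L i).drop j, (e i, A i j)))
      ((hL.pair (self.pair ha)).congr_enc fun _ => rfl) ?_ ?_ hL.pbdd_length
      ((((PBdd.const 2).add hL.pbdd).add .self).add hB) fun i j hj => ?_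
    · refine ((self.congr_enc (g := fun z : {z : ι × ℕ // z.2 ≤ (L z.1).length} =>
        ((enc ((L z.1.1).drop z.1.2) : Val),
        enc (e z.1.1, A z.1.1 z.1.2))) fun z => rfl).fst.isPair).congr fun z => ?_
      rcases hd : (L z.1.1).drop z.1.2 with _ | ⟨x, l⟩
      · rw [List.drop_eq_nil_iff] at hd
        rw [if_neg (by omega)]
        rfl
      · have : (L z.1.1).drop z.1.2 ≠ [] := by simp [hd]
        rw [ne_eq, List.drop_eq_nil_iff] at this
        rw [if_pos (by omega)]
        rfl
    · have h := self (e := fun z : {z : ι × ℕ // z.2 < (L z.1).length} =>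
        enc ((L z.1.1).drop z.1.2, (e z.1.1, A z.1.1 z.1.2)))
      have h := h.congr_enc (g := fun z => (((L z.1.1)[z.1.2]'z.2, (L z.1.1).drop (z.1.2 + 1)),
        (e z.1.1, A z.1.1 z.1.2))) fun z => by
          rw [enc_val, List.drop_eq_getElem_cons z.2]; rfl
      have h' := (h.snd.pair h.fst.fst).comp
        ((hF.reindex fun z : {z : ι × ℕ // z.2 < (L z.1).length} =>
          ((z.1.1, A z.1.1 z.1.2), (L z.1.1)[z.1.2]'z.2)))
      refine (h.fst.snd.pair (h.snd.fst.pair h')).congr_enc fun z => ?_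
      simp only [A, List.take_add_one, List.foldl_append, List.getElem?_eq_getElem z.2]
      rfl
    · have h1 := size_enc_drop_le (L i) j
      have h2 := hs i _ (List.take_prefix j (L i))
      simp only [size_enc_prod, enc_val, A]
      omega
  refine (h.congr_enc (g := fun i => (([] : List β), (e i, A i (L i).length)))
      fun i => ?_).snd.snd.congr
    fun i => ?_
  · simp [enc_val]
  · simp [A]

theorem cons {x : ι → β} {l : ι → List β} (hx : Comp e x) (hl : Comp e l) :
    Comp e fun i => x i :: l i :=
  (hx.pair hl).congr_enc fun _ => rfl

theorem reverse {l : ι → List β} (hl : Comp e l) : Comp e fun i => (l i).reverse := by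
  refine (foldl (F := fun z : (ι × List β) × β => z.2 :: z.1.2) hl (const []) (var.cons var.wk)
    hl.pbdd fun i l' hl' => ?_).congr fun i => ?_
  · have : l'.foldl (fun c x => x :: c) [] = l'.reverse := by simp
    rw [this, size_enc_reverse]
    rw [List.prefix_iff_eq_take.1 hl']
    exact size_enc_take_le _ _
  · simp

/-- A fold that pushes the images in reverse order; each image is polynomially bounded because `F`
is computable in polynomial time. -/
theorem map {L : ι → List β} {F : ι × β → γ} (hL : Comp e L) (hF : Comp (ext e β) F) :
    Comp e fun i => (L i).map fun x => F (i, x) := by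
  have hF' : Comp (ext (ext e (List γ)) β) fun z : (ι × List γ) × β => F (z.1.1, z.2) :=
    (self.wk (γ := List γ)).wk.pair var |>.comp
        (hF.reindex fun z : (ι × List γ) × β => (z.1.1, z.2))
  obtain ⟨p, hp⟩ := hF.pbdd
  have hfold : ∀ i (l : List β), l.foldl (fun c x => F (i, x) :: c) [] =
      (l.map fun x => F (i, x)).reverse := fun i l => by
    induction l using List.reverseRecOn with
    | nil => rfl
    | append_singleton l x ih => simp [ih]
  refine ((foldl (F := fun z : (ι × List γ) × β => F (z.1.1, z.2) :: z.1.2) hL (const [])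
    (hF'.cons var.wk) (B := fun i => 1 + (L i).length *
      (1 + p.eval (1 + (e i).size + (enc (L i)).size)))
    ((PBdd.const 1).add (hL.pbdd_length.mul ((PBdd.const 1).add
      ((((PBdd.const 1).add .self).add hL.pbdd).eval p)))) fun i l hl => ?_).reverse).congr
    fun i => ?_
  · rw [hfold, size_enc_reverse]
    refine (size_enc_list_le (B := p.eval (1 + (e i).size + (enc (L i)).size)) ?_).trans ?_
    · intro y hy
      obtain ⟨x, hx, rfl⟩ := List.mem_map.1 hy
      refine (hp (i, x)).trans (eval_mono p ?_)
      have := size_enc_le_of_mem (hl.subset hx)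
      simp only [ext, Val.size]
      omega
    · rw [List.length_map]
      gcongr
      exact hl.length_le
  · rw [hfold, List.reverse_reverse]

theorem sum {l : ι → List ℕ} (hl : Comp e l) : Comp e fun i => (l i).sum := by
  refine (foldl (F := fun z : (ι × ℕ) × ℕ => z.1.2 + z.2) hl (const 0) (var.wk.add var)
    hl.pbdd fun i l' hl' => ?_).congr fun i => ?_
  · have : l'.foldl (fun c x => c + x) 0 = l'.sum := by rw [List.sum_eq_foldl]
    rw [this]
    refine (size_enc_sum_le _).trans ?_
    rw [List.prefix_iff_eq_take.1 hl']
    exact size_enc_take_le _ _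
  · rw [List.sum_eq_foldl]

theorem length {l : ι → List β} (hl : Comp e l) : Comp e fun i => (l i).length :=
  (hl.map (F := fun _ => 1) (const 1)).sum.congr fun i => by simp

/-- The bound of the range is the length of a list, that is, a number in unary. The range up to a
number in binary can be exponentially long. -/
theorem range_length {l : ι → List β} (hl : Comp e l) :
    Comp e fun i => List.range (l i).length := by
  have hfold : ∀ (l : List β), l.foldl (fun (c : ℕ × List ℕ) _ => (c.1 + 1, c.1 :: c.2)) (0, []) =
      (l.length, (List.range l.length).reverse) := fun l => by
    induction l using List.reverseRecOn with
    | nil => rfl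
    | append_singleton l x ih => simp [ih, List.range_succ]
  refine ((foldl (F := fun z : (ι × (ℕ × List ℕ)) × β => (z.1.2.1 + 1, z.1.2.1 :: z.1.2.2)) hl
    (const (0, [])) ((var.wk.fst.add (const 1)).pair (var.wk.fst.cons var.wk.snd))
    (B := fun i => 1 + (1 + (l i).length) + (1 + (l i).length * (1 + (1 + (l i).length))))
    (((PBdd.const 1).add ((PBdd.const 1).add hl.pbdd_length)).add ((PBdd.const 1).add
      (hl.pbdd_length.mul ((PBdd.const 1).add ((PBdd.const 1).add hl.pbdd_length)))))
    fun i l' hl' => ?_).snd.reverse).congr fun i => ?_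
  · have hlen := hl'.length_le
    have hsz : ∀ a : ℕ, Nat.size a ≤ a := fun a => by
      rw [Nat.size_le]; exact Nat.lt_two_pow_self
    rw [hfold, size_enc_prod, size_enc_nat, size_enc_reverse]
    have h1 := hsz l'.length
    have h2 : (enc (List.range l'.length)).size ≤ 1 + l'.length * (1 + (1 + (l i).length)) := by
      refine (size_enc_list_le (B := 1 + (l i).length) fun x hx => ?_).trans (by simp)
      rw [size_enc_nat]
      have := hsz x
      have := List.mem_range.1 hx
      omega
    have h3 : l'.length * (1 + (1 + (l i).length)) ≤ (l i).length * (1 + (1 + (l i).length)) := by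
      gcongr
    omega
  · rw [hfold, List.reverse_reverse]

theorem getD {l : ι → List β} {j : ι → ℕ} (hl : Comp e l) (hj : Comp e j) (d : β) :
    Comp e fun i => (l i).getD (j i) d := by
  have hfold : ∀ (j : ℕ) (l : List β),
      l.foldl (fun (c : ℕ × β) x => (c.1 + 1, if c.1 = j then x else c.2)) (0, d) =
      (l.length, l.getD j d) := fun j l => by
    induction l using List.reverseRecOn with
    | nil => rfl
    | append_singleton l x ih =>
      rw [List.foldl_append, ih]
      simp only [List.foldl_cons, List.foldl_nil, List.length_append, List.length_cons,
        List.length_nil, Prod.mk.injEq, zero_add, true_and]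
      rcases lt_trichotomy j l.length with h | rfl | h
      · rw [if_neg (by omega), List.getD_append _ _ _ _ h]
      · simp
      · rw [if_neg (by omega), List.getD_eq_default _ _ h.le,
            List.getD_eq_default _ _ (by simp; omega)]
  refine ((foldl (F := fun z : (ι × (ℕ × β)) × β =>
      (z.1.2.1 + 1, if z.1.2.1 = j z.1.1 then z.2 else z.1.2.2)) hl (const (0, d))
    ((var.wk.fst.add (const 1)).pair (var.wk.fst.ite_eq hj.wk.wk var var.wk.snd))
    (B := fun i => 1 + (1 + (l i).length) + ((enc (l i)).size + (enc d).size))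
    (((PBdd.const 1).add ((PBdd.const 1).add hl.pbdd_length)).add (hl.pbdd.add (.const _)))
    fun i l' hl' => ?_).snd).congr fun i => ?_
  · have hlen := hl'.length_le
    have hsz : Nat.size l'.length ≤ l'.length := by
      rw [Nat.size_le]; exact Nat.lt_two_pow_self
    have hd : (enc (l'.getD (j i) d)).size ≤ (enc (l i)).size + (enc d).size := by
      by_cases h : j i < l'.length
      · rw [List.getD_eq_getElem _ _ h]
        have := size_enc_le_of_mem (hl'.subset (List.getElem_mem h))
        omega
      · rw [List.getD_eq_default _ _ (by omega)]
        omega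
    rw [hfold (j i), size_enc_prod, size_enc_nat]
    omega
  · rw [hfold (j i)]

theorem flatten {l : ι → List (List β)} (hl : Comp e l) : Comp e fun i => (l i).flatten := by
  have hfold₁ : ∀ (l₁ l₂ : List β), l₁.foldl (fun c x => x :: c) l₂ = l₁.reverse ++ l₂ :=
    fun l₁ l₂ => by induction l₁ generalizing l₂ <;> simp_all
  have hfold₂ : ∀ (l : List (List β)),
      l.foldl (fun (c : List β) x => x.foldl (fun c x => x :: c) c) [] = l.flatten.reverse :=
    fun l => by
      induction l using List.reverseRecOn with
      | nil => rfl
      | append_singleton l x ih => rw [List.foldl_append, ih]; simp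
  have hsz : ∀ l : List (List β), (enc l.flatten).size ≤ (enc l).size := fun l => by
    induction l with
    | nil => rfl
    | cons x l ih =>
      have := size_enc_append x l.flatten
      rw [List.flatten_cons, size_enc_cons]
      omega
  refine ((foldl (F := fun z : (ι × List β) × List β => z.2.foldl (fun c x => x :: c) z.1.2) hl
    (const []) ?_ hl.pbdd fun i l' hl' => ?_).reverse).congr fun i => ?_
  · refine foldl (F := fun z : (((ι × List β) × List β) × List β) × β => z.2 :: z.1.2) var var.wk
      (var.cons var.wk) (B := fun z => (ext (ext e (List β)) (List β) z).size) .self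
      fun i l' hl' => ?_
    rw [hfold₁]
    have h1 := size_enc_append l'.reverse i.1.2
    rw [size_enc_reverse] at h1
    have h2 : (enc l').size ≤ (enc i.2).size := by
      rw [List.prefix_iff_eq_take.1 hl']
      exact size_enc_take_le _ _
    simp only [ext, Val.size]
    omega
  · rw [hfold₂, size_enc_reverse]
    refine (hsz _).trans ?_
    rw [List.prefix_iff_eq_take.1 hl']
    exact size_enc_take_le _ _
  · rw [hfold₂, List.reverse_reverse]

end Comp

/-! # Width of regular languages -/

section Width

variable {α : Type*} [Fintype α] {n : ℕ}

/-- The probability that the symbol `u` is played after the history `h`. -/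
noncomputable def moveProb (σ τ : Strategy α n) (h : List α) (u : α) : ℝ :=
  if Even h.length then σ.prob h u else τ.prob h u

theorem moveProb_nonneg (σ τ : Strategy α n) (h : List α) (u : α) : 0 ≤ moveProb σ τ h u := by
  unfold moveProb
  split_ifs
  exacts [σ.prob_nonneg h u, τ.prob_nonneg h u]

theorem sum_moveProb (σ τ : Strategy α n) {h : List α} (hh : h.length < n) :
    ∑ u, moveProb σ τ h u = 1 := by
  unfold moveProb
  split_ifs
  exacts [σ.sum_prob h hh, τ.sum_prob h hh]

theorem condProb_cons (σ τ : Strategy α n) (h : List α) (u : α) (w : List α) :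
    condProb σ τ h (u :: w) = moveProb σ τ h u * condProb σ τ (h ++ [u]) w := rfl

theorem condProb_nonneg (σ τ : Strategy α n) (h w : List α) : 0 ≤ condProb σ τ h w := by
  induction w generalizing h with
  | nil => exact zero_le_one
  | cons u w ih => exact mul_nonneg (moveProb_nonneg σ τ h u) (ih _)

theorem condProb_append (σ τ : Strategy α n) (h w w' : List α) :
    condProb σ τ h (w ++ w') = condProb σ τ h w * condProb σ τ (h ++ w) w' := by
  induction w generalizing h with
  | nil => simp [condProb]
  | cons u w ih => rw [List.cons_append, condProb_cons, condProb_cons, ih]; simp [mul_assoc]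

theorem playProb_append_singleton (σ τ : Strategy α n) (h : List α) (u : α) :
    playProb σ τ (h ++ [u]) = playProb σ τ h * moveProb σ τ h u := by
  unfold playProb
  rw [condProb_append, condProb_cons]
  simp [condProb]

open Classical in
/-- The strategy that plays `s h` after `h`. -/
noncomputable def Strategy.pure (s : List α → α) : Strategy α n where
  prob h u := if u = s h then 1 else 0
  prob_nonneg h u := by split_ifs <;> norm_num
  prob_le_one h u := by split_ifs <;> norm_num
  sum_prob h _ := by simp

/-- The strategy that plays all symbols with the same probability. -/
noncomputable def Strategy.uniform (α : Type*) [Fintype α] [Nonempty α] (n : ℕ) : Strategy α n where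
  prob _ _ := (Fintype.card α : ℝ)⁻¹
  prob_nonneg _ _ := by positivity
  prob_le_one _ _ := inv_le_one_of_one_le₀ (by exact_mod_cast Fintype.card_pos)
  sum_prob _ _ := by simp

variable {V : Type*} (D : DFA α V)

open Classical in
theorem dpWidth_end (v : V) : dpWidth D n v n = if v ∈ D.accept then 1 else 0 := by
  rw [dpWidth, dif_neg (lt_irrefl n)]

theorem dpWidth_even {i : ℕ} (hi : i < n) (h : Even i) (v : V) :
    dpWidth D n v i = ∑ u, dpWidth D n (D.step v u) (i + 1) := by
  rw [dpWidth, dif_pos hi, if_neg (by simpa using h)]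

theorem dpWidth_odd {i : ℕ} (hi : i < n) (h : ¬ Even i) (v : V) :
    dpWidth D n v i = ⨅ u, dpWidth D n (D.step v u) (i + 1) := by
  rw [dpWidth, dif_pos hi, if_pos (by simpa using h)]

theorem dpWidth_odd_le {i : ℕ} (hi : i < n) (h : ¬ Even i) (v : V) (u : α) :
    dpWidth D n v i ≤ dpWidth D n (D.step v u) (i + 1) := by
  rw [dpWidth_odd D hi h]
  exact ciInf_le (OrderBot.bddBelow _) u

theorem exists_dpWidth_odd [Nonempty α] {i : ℕ} (hi : i < n) (h : ¬ Even i) (v : V) :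
    ∃ u, dpWidth D n (D.step v u) (i + 1) = dpWidth D n v i := by
  rw [dpWidth_odd D hi h]
  exact exists_eq_ciInf_of_finite

/-- The minimizing replies of the adversary, which serve both for the upper bound on the width and
for the necessity of the realizability criterion. -/
theorem exists_worst_strategy [Nonempty α] (n : ℕ) : ∃ s : List α → α, ∀ h : List α, h.length < n →
    ¬ Even h.length → dpWidth D n (D.eval (h ++ [s h])) (h.length + 1) =
      dpWidth D n (D.eval h) h.length := by
  have : ∀ h : List α, ∃ u, h.length < n → ¬ Even h.length →
      dpWidth D n (D.eval (h ++ [u])) (h.length + 1) = dpWidth D n (D.eval h) h.length := by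
    intro h
    by_cases h1 : h.length < n ∧ ¬ Even h.length
    · obtain ⟨u, hu⟩ := exists_dpWidth_odd D h1.1 h1.2 (D.eval h)
      exact ⟨u, fun _ _ => by rw [DFA.eval_append_singleton, hu]⟩
    · exact ⟨Classical.arbitrary α, fun h2 h3 => absurd ⟨h2, h3⟩ h1⟩
  choose s hs using this
  exact ⟨s, hs⟩

/-- A simulation of one automaton by another can only increase widths. With the projection of the
product automaton to its first factor as the simulation, this compares the widths of `A` and `I`. -/
theorem dpWidth_mono {W : Type*} {E : DFA α W} {r : V → W → Prop}
    (hstep : ∀ v w u, r v w → r (D.step v u) (E.step w u))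
    (hacc : ∀ v w, r v w → v ∈ D.accept → w ∈ E.accept) {i : ℕ} (hi : i ≤ n) {v : V} {w : W}
    (hr : r v w) : dpWidth D n v i ≤ dpWidth E n w i := by
  induction hi using Nat.decreasingInduction generalizing v w with
  | self =>
    rw [dpWidth_end, dpWidth_end]
    have := hacc v w hr
    split_ifs <;> simp_all
  | of_succ i hi ih =>
    by_cases h : Even i
    · rw [dpWidth_even D hi h, dpWidth_even E hi h]
      exact Finset.sum_le_sum fun u _ => ih (hstep v w u hr)
    · rcases isEmpty_or_nonempty α with hα | hα
      · rw [dpWidth_odd D hi h, Nat.iInf_of_empty]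
        exact Nat.zero_le _
      · obtain ⟨u, hu⟩ := exists_dpWidth_odd E hi h w
        rw [← hu]
        exact (dpWidth_odd_le D hi h v u).trans (ih (hstep v w u hr))

open Classical in
-- Possible plays are sorted by their first symbol: a play is possible iff that symbol and the rest
-- are. A `Finset` is produced because `ncard` would be `0` on an infinite set.
theorem exists_finset_plays (σ τ : Strategy α n) (X : Set (List α)) (hX : ∀ w ∈ X, w.length = n)
    {h : List α} (hh : h.length < n) {F : α → Finset (List α)}
    (hF : ∀ u π, π ∈ F u ↔ h ++ [u] ++ π ∈ X ∧ 0 < condProb σ τ (h ++ [u]) π) :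
    ∃ S : Finset (List α), (∀ π, π ∈ S ↔ h ++ π ∈ X ∧ 0 < condProb σ τ h π) ∧
      S.card = ∑ u, if 0 < moveProb σ τ h u then (F u).card else 0 := by
  refine ⟨Finset.univ.biUnion fun u =>
      if 0 < moveProb σ τ h u then (F u).image (List.cons u) else ∅,
    fun π => ?_, ?_⟩
  · rcases π with _ | ⟨u, π⟩
    · have : h ∉ X := fun h' => (hX h h').not_lt hh
      simp only [List.append_nil, this, false_and, iff_false, Finset.mem_biUnion, not_exists]
      intro u
      split_ifs <;> simp
    · rw [condProb_cons]
      have h0 := moveProb_nonneg σ τ h u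
      have h1 := condProb_nonneg σ τ (h ++ [u]) π
      have : 0 < moveProb σ τ h u * condProb σ τ (h ++ [u]) π ↔
          0 < moveProb σ τ h u ∧ 0 < condProb σ τ (h ++ [u]) π := by
        constructor
        · intro h2
          exact ⟨h0.lt_of_ne fun h3 => by simp [← h3] at h2,
            h1.lt_of_ne fun h3 => by simp [← h3] at h2⟩
        · exact fun h2 => mul_pos h2.1 h2.2
      rw [this, Finset.mem_biUnion]
      constructor
      · rintro ⟨v, -, hv⟩
        split_ifs at hv with h2
        · obtain ⟨π', hπ', he⟩ := Finset.mem_image.1 hv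
          obtain ⟨rfl, rfl⟩ := List.cons.inj he
          have := (hF v π').1 hπ'
          exact ⟨by simpa using this.1, h2, this.2⟩
        · simp at hv
      · rintro ⟨h2, h3, h4⟩
        refine ⟨u, Finset.mem_univ _, ?_⟩
        rw [if_pos h3]
        exact Finset.mem_image_of_mem _ ((hF u π).2 ⟨by simpa using h2, h4⟩)
  · rw [Finset.card_biUnion]
    · refine Finset.sum_congr rfl fun u _ => ?_
      split_ifs
      · exact Finset.card_image_of_injective _ (List.cons_injective)
      · rfl
    · intro u _ v _ huv
      rw [Function.onFun, Finset.disjoint_left]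
      intro π h1 h2
      split_ifs at h1 h2 <;> simp at h1 h2
      obtain ⟨_, _, rfl⟩ := h1
      obtain ⟨_, _, h2⟩ := h2
      exact huv (List.cons.inj h2).1.symm

open Classical in
-- The induction common to both bounds on the width; `Q` will be `≤` or `≥`, and `hQ` is its step,
-- in which only symbols of positive probability are counted.
theorem exists_finset_plays_dpWidth {σ τ : Strategy α n} {Q : ℕ → ℕ → Prop}
    (hQ : ∀ h : List α, h.length < n → ∀ c : α → ℕ,
      (∀ u, Q (c u) (dpWidth D n (D.eval (h ++ [u])) (h.length + 1))) →
      Q (∑ u, if 0 < moveProb σ τ h u then c u else 0) (dpWidth D n (D.eval h) h.length))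
    (hQ0 : ∀ a, Q a a) (j : ℕ) (h : List α) (hj : h.length + j = n) :
    ∃ S : Finset (List α),
      (∀ π, π ∈ S ↔ h ++ π ∈ wordsOfLength D.accepts n ∧ 0 < condProb σ τ h π) ∧
      Q S.card (dpWidth D n (D.eval h) h.length) := by
  induction j generalizing h with
  | zero =>
    obtain rfl : h.length = n := by omega
    refine ⟨if D.eval h ∈ D.accept then {[]} else ∅, fun π => ?_, ?_⟩
    · rcases π with _ | ⟨u, π⟩
      · simp only [List.append_nil, wordsOfLength, Set.mem_ofPred_eq, DFA.mem_accepts, condProb]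
        split_ifs with h1 <;> simp [h1]
      · simp only [wordsOfLength, Set.mem_ofPred_eq]
        split_ifs <;> simp
    · rw [dpWidth_end]
      split_ifs
      exacts [hQ0 1, hQ0 0]
  | succ j ih =>
    choose F hF hF' using fun u => ih (h ++ [u]) (by simp; omega)
    obtain ⟨S, hS, hS'⟩ := exists_finset_plays σ τ (wordsOfLength D.accepts n) (fun w hw => hw.2)
      (h := h) (by omega) hF
    refine ⟨S, hS, ?_⟩
    rw [hS']
    exact hQ h (by omega) _ fun u => by simpa using hF' u

/-- The width of the set of the words of length `n` in a regular language is given by dynamic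
programming on the automaton. -/
theorem width_eq_dpWidth [Nonempty α] (h : List α) (hh : h.length ≤ n) :
    width n (wordsOfLength D.accepts n) h = dpWidth D n (D.eval h) h.length := by
  have hcard : ∀ {σ τ : Strategy α n} {S : Finset (List α)},
      (∀ π, π ∈ S ↔ h ++ π ∈ wordsOfLength D.accepts n ∧ 0 < condProb σ τ h π) →
      {π : List α | h ++ π ∈ wordsOfLength D.accepts n ∧ 0 < condProb σ τ h π}.ncard = S.card := by
    intro σ τ S hS
    rw [← Set.ncard_coe_finset]
    congr 1
    ext π
    simp [hS]
  have : Nonempty (Strategy α n) := ⟨Strategy.uniform α n⟩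
  have upper : ∀ σ : Strategy α n, ⨅ τ : Strategy α n,
      {π : List α | h ++ π ∈ wordsOfLength D.accepts n ∧ 0 < condProb σ τ h π}.ncard ≤
      dpWidth D n (D.eval h) h.length := by
    intro σ
    -- Against the minimizing adversary only the successor `s h` survives on odd turns; on even
    -- turns, discarding symbols that `σ` never plays only lowers the sum.
    obtain ⟨s, hs⟩ := exists_worst_strategy D n
    have step : ∀ h : List α, h.length < n → ∀ c : α → ℕ,
        (∀ u, c u ≤ dpWidth D n (D.eval (h ++ [u])) (h.length + 1)) →
        (∑ u, if 0 < moveProb σ (Strategy.pure s) h u then c u else 0) ≤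
          dpWidth D n (D.eval h) h.length := by
      intro h hh c hc
      by_cases he : Even h.length
      · rw [dpWidth_even D hh he]
        refine Finset.sum_le_sum fun u _ => ?_
        have := hc u
        rw [DFA.eval_append_singleton] at this
        split_ifs
        exacts [this, Nat.zero_le _]
      · rw [← hs h hh he]
        refine le_trans ?_ (hc (s h))
        rw [Finset.sum_eq_single (s h)]
        · split_ifs
          exacts [le_rfl, Nat.zero_le _]
        · intro u _ hu
          simp [moveProb, he, Strategy.pure, hu]
        · simp
    obtain ⟨S, hS, hS'⟩ := exists_finset_plays_dpWidth D (Q := fun a b => a ≤ b) step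
      (fun _ => le_rfl) (n - h.length) h (by omega)
    refine (ciInf_le (OrderBot.bddBelow _) (Strategy.pure s)).trans ?_
    rwa [hcard hS]
  refine le_antisymm (ciSup_le upper) ?_
  -- Uniform play attains the maximum. `upper` also shows that the range is bounded, without which
  -- the supremum in `ℕ` would be `0`.
  refine le_trans ?_ (le_ciSup ⟨_, Set.forall_mem_range.2 upper⟩ (Strategy.uniform α n))
  refine le_ciInf fun τ => ?_
  have step : ∀ h : List α, h.length < n → ∀ c : α → ℕ,
      (∀ u, dpWidth D n (D.eval (h ++ [u])) (h.length + 1) ≤ c u) →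
      dpWidth D n (D.eval h) h.length ≤
        ∑ u, if 0 < moveProb (Strategy.uniform α n) τ h u then c u else 0 := by
    intro h hh c hc
    by_cases he : Even h.length
    · rw [dpWidth_even D hh he]
      refine Finset.sum_le_sum fun u _ => ?_
      rw [if_pos, ← DFA.eval_append_singleton]
      · exact hc u
      · simp [moveProb, he, Strategy.uniform, Fintype.card_pos]
    -- The adversary must play some symbol with positive probability, and the plays through that
    -- symbol alone already reach the minimum.
    · obtain ⟨u, hu⟩ : ∃ u, 0 < moveProb (Strategy.uniform α n) τ h u := by
        by_contra! h1
        have := sum_moveProb (Strategy.uniform α n) τ hh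
        have h2 := Finset.sum_nonpos fun u (_ : u ∈ Finset.univ) => h1 u
        linarith
      have h1 := dpWidth_odd_le D hh he (D.eval h) u
      rw [← DFA.eval_append_singleton] at h1
      refine (h1.trans (hc u)).trans ?_
      have := Finset.single_le_sum (f := fun u => if 0 < moveProb (Strategy.uniform α n) τ h u
        then c u else 0) (fun _ _ => Nat.zero_le _) (Finset.mem_univ u)
      simpa [hu] using this
  obtain ⟨S, hS, hS'⟩ := exists_finset_plays_dpWidth D (Q := fun a b => b ≤ a) step
    (fun _ => le_rfl) (n - h.length) h (by omega)
  rwa [hcard hS]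

end Width

/-! # Realizability -/

section Mass

variable {α : Type*} [Fintype α] {n : ℕ}

open Classical in
/-- The probability that the play, continued from `h` by `j` symbols, ends up in `X`. -/
noncomputable def tailProb (σ τ : Strategy α n) (X : Set (List α)) (j : ℕ) (h : List α) : ℝ :=
  ∑ π : Fin j → α, if h ++ List.ofFn π ∈ X then condProb σ τ h (List.ofFn π) else 0

open Classical in
theorem tailProb_zero (σ τ : Strategy α n) (X : Set (List α)) (h : List α) :
    tailProb σ τ X 0 h = if h ∈ X then 1 else 0 := by
  simp [tailProb, condProb]

theorem tailProb_succ (σ τ : Strategy α n) (X : Set (List α)) (j : ℕ) (h : List α) :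
    tailProb σ τ X (j + 1) h = ∑ u, moveProb σ τ h u * tailProb σ τ X j (h ++ [u]) := by
  unfold tailProb
  rw [← (Fin.consEquiv fun _ => α).sum_comp, Fintype.sum_prod_type]
  refine Finset.sum_congr rfl fun u _ => ?_
  rw [Finset.mul_sum]
  refine Finset.sum_congr rfl fun π _ => ?_
  have : List.ofFn ((Fin.consEquiv fun _ => α) (u, π)) = u :: List.ofFn π := by
    change List.ofFn (Fin.cons u π) = _
    simp [List.ofFn_succ]
  rw [this, show h ++ u :: List.ofFn π = h ++ [u] ++ List.ofFn π by simp, condProb_cons, mul_ite,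
    mul_zero]

theorem setProb_eq_tailProb (σ τ : Strategy α n) (X : Set (List α)) :
    setProb σ τ X = tailProb σ τ X n [] := by
  simp [setProb, tailProb, playProb]

variable {V : Type*} (D : DFA α V)

/-- Against some adversary, a strategy that plays every word of a regular language with probability
at most `ρ` stays in it with probability at most `ρ` times the width. -/
theorem exists_setProb_le [Nonempty α] (σ : Strategy α n) {ρ : ℝ}
    (hσ : ∀ τ, ∀ π ∈ wordsOfLength D.accepts n, playProb σ τ π ≤ ρ) :
    ∃ τ, setProb σ τ (wordsOfLength D.accepts n) ≤ ρ * dpWidth D n D.start 0 := by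
  obtain ⟨s, hs⟩ := exists_worst_strategy D n
  refine ⟨Strategy.pure s, ?_⟩
  -- The bound `ρ` concerns whole plays, so the induction weights the tail by the probability of
  -- reaching `h`; at the end of the game this product is the probability of the play itself.
  have key : ∀ j h, h.length + j = n → playProb σ (Strategy.pure s) h *
      tailProb σ (Strategy.pure s) (wordsOfLength D.accepts n) j h ≤
      ρ * dpWidth D n (D.eval h) h.length := by
    intro j
    induction j with
    | zero =>
      intro h hj
      obtain rfl : h.length = n := by omega
      rw [tailProb_zero, dpWidth_end]
      have : h ∈ wordsOfLength D.accepts h.length ↔ D.eval h ∈ D.accept := by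
        simp [wordsOfLength, DFA.mem_accepts]
      rw [← this]
      split_ifs with h1
      · simpa using hσ _ h h1
      · simp
    | succ j ih =>
      intro h hj
      have hh : h.length < n := by omega
      have ih' := fun u => ih (h ++ [u]) (by simp; omega)
      simp only [playProb_append_singleton, List.length_append, List.length_singleton] at ih'
      rw [tailProb_succ, Finset.mul_sum]
      simp only [← mul_assoc]
      by_cases he : Even h.length
      · rw [dpWidth_even D hh he]
        push_cast
        rw [Finset.mul_sum]
        refine Finset.sum_le_sum fun u _ => ?_
        rw [← DFA.eval_append_singleton]
        exact ih' u
      · rw [← hs h hh he, Finset.sum_eq_single (s h)]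
        · exact ih' (s h)
        · intro u _ hu
          simp [moveProb, he, Strategy.pure, hu]
        · simp
  have := key n [] (by simp)
  simpa [playProb, condProb, setProb_eq_tailProb] using this

end Mass

/-! ## Splitting a budget -/

/-- Greedy distribution of the amounts `a` and `x` over a list of places with the capacities
`R * w.2` for the shares of `a` and `R * w.1` for the total shares. -/
def split (R : ℕ) : ℕ → ℕ → List (ℕ × ℕ) → List (ℕ × ℕ)
  | _, _, [] => []
  | a, x, w :: ws =>
      (min a (R * w.2), min x (R * w.1 - min a (R * w.2))) ::
        split R (a - min a (R * w.2)) (x - min x (R * w.1 - min a (R * w.2))) ws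

theorem length_split (R a x : ℕ) (ws : List (ℕ × ℕ)) : (split R a x ws).length = ws.length := by
  induction ws generalizing a x with
  | nil => rfl
  | cons w ws ih => simp [split, ih]

/-- After the first place is served, either it is full, so the rest fits by `hx`, or `x` is used up,
so the rest of `a` fits by `ha` and `w.2 ≤ w.1`. Hence greed wastes no capacity. -/
theorem sum_split {R a x : ℕ} {ws : List (ℕ × ℕ)} (hw : ∀ w ∈ ws, w.2 ≤ w.1)
    (ha : a ≤ R * (ws.map Prod.snd).sum) (hx : a + x ≤ R * (ws.map Prod.fst).sum) :
    ((split R a x ws).map Prod.fst).sum = a ∧ ((split R a x ws).map Prod.snd).sum = x := by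
  induction ws generalizing a x with
  | nil => simp at ha hx; simp [split, ha, hx]
  | cons w ws ih =>
    simp only [List.map_cons, List.sum_cons, mul_add] at ha hx
    have h1 : R * w.2 ≤ R * w.1 := Nat.mul_le_mul_left _ (hw w (by simp))
    have h2 : R * (ws.map Prod.snd).sum ≤ R * (ws.map Prod.fst).sum :=
      Nat.mul_le_mul_left _ (List.sum_le_sum fun w' hw' => hw w' (by simp [hw']))
    obtain ⟨h3, h4⟩ := ih (a := a - min a (R * w.2))
      (x := x - min x (R * w.1 - min a (R * w.2))) (fun w' hw' => hw w' (by simp [hw']))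
      (by omega) (by omega)
    simp only [split, List.map_cons, List.sum_cons, h3, h4]
    omega

theorem split_getD_le {R a x : ℕ} {ws : List (ℕ × ℕ)} (hw : ∀ w ∈ ws, w.2 ≤ w.1) (j : ℕ) :
    ((split R a x ws).getD j (0, 0)).1 ≤ R * (ws.getD j (0, 0)).2 ∧
    ((split R a x ws).getD j (0, 0)).1 + ((split R a x ws).getD j (0, 0)).2 ≤
      R * (ws.getD j (0, 0)).1 := by
  induction ws generalizing a x j with
  | nil => simp [split]
  | cons w ws ih =>
    have h1 : R * w.2 ≤ R * w.1 := Nat.mul_le_mul_left _ (hw w (by simp))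
    rcases j with _ | j
    · simp only [split, List.getD_cons_zero]
      omega
    · simp only [split, List.getD_cons_succ]
      exact ih (fun w' hw' => hw w' (by simp [hw'])) j

section Budget

variable {k : ℕ} (n R : ℕ) (w : List (Fin k) → ℕ × ℕ) (b₀ : ℕ × ℕ)

/-- The distribution of the budget `b` over the continuations of `h`. -/
def shares (h : List (Fin k)) (b : ℕ × ℕ) : List (ℕ × ℕ) :=
  split R b.1 b.2 (List.ofFn fun u => w (h ++ [u]))

/-- The part of the initial budget that is assigned to the words that extend a history. -/
def budget (h : List (Fin k)) : ℕ × ℕ :=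
  (h.foldl (fun z u => (z.1 ++ [u],
    if Odd z.1.length then z.2 else (shares R w z.1 z.2).getD u (0, 0))) ([], b₀)).2

/-- The weights with which the symbols are played after a history; outside of our turns, and where
no budget is left, the first symbol is played. -/
def weights (h : List (Fin k)) : List ℕ :=
  if h.length < n ∧ ¬ Odd h.length ∧ 0 < (budget R w b₀ h).1 + (budget R w b₀ h).2 then
    (shares R w h (budget R w b₀ h)).map fun s => s.1 + s.2
  else [1]

theorem budget_nil : budget R w b₀ [] = b₀ := rfl

/-- The adversary's probabilities are out of our control, so after his turn each successor keeps the
full budget. The fold defining `budget` carries the history along; `this` recovers it. -/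
theorem budget_append_singleton (h : List (Fin k)) (u : Fin k) : budget R w b₀ (h ++ [u]) =
    if Odd h.length then budget R w b₀ h else (shares R w h (budget R w b₀ h)).getD u (0, 0) := by
  have : ∀ h : List (Fin k), (h.foldl (fun z u => (z.1 ++ [u],
      if Odd z.1.length then z.2 else (shares R w z.1 z.2).getD u (0, 0))) ([], b₀)).1 = h := by
    intro h
    induction h using List.reverseRecOn with
    | nil => rfl
    | append_singleton h u ih => rw [List.foldl_append, List.foldl_cons, List.foldl_nil, ih]
  unfold budget
  rw [List.foldl_append]
  simp only [List.foldl_cons, List.foldl_nil, this]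

open Classical in
/-- The pairs `w h` bound how many plays that extend `h` can be forced into the sets `I` and `A`. -/
structure IsWidthBound (I A : Set (List (Fin k))) : Prop where
  fst_end : ∀ h, h.length = n → (w h).1 = if h ∈ I then 1 else 0
  snd_end : ∀ h, h.length = n → (w h).2 = if h ∈ A then 1 else 0
  snd_le_fst : ∀ h, h.length ≤ n → (w h).2 ≤ (w h).1
  sum_fst : ∀ h, h.length < n → Even h.length → (w h).1 ≤ ∑ u, (w (h ++ [u])).1
  sum_snd : ∀ h, h.length < n → Even h.length → (w h).2 ≤ ∑ u, (w (h ++ [u])).2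
  fst_le : ∀ h u, h.length < n → ¬ Even h.length → (w h).1 ≤ (w (h ++ [u])).1
  snd_le : ∀ h u, h.length < n → ¬ Even h.length → (w h).2 ≤ (w (h ++ [u])).2

variable {n R w b₀} {I A : Set (List (Fin k))}

theorem sum_getD {l : List ℕ} (hl : l.length ≤ k) : ∑ u : Fin k, l.getD u 0 = l.sum := by
  induction l generalizing k with
  | nil => simp
  | cons x l ih =>
    rcases k with _ | k
    · simp at hl
    · rw [Fin.sum_univ_succ, List.sum_cons, ← ih (k := k) (by simpa using hl)]
      rfl

theorem getD_ofFn {β : Type*} (f : Fin k → β) (u : Fin k) (d : β) :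
    (List.ofFn f).getD u d = f u := by
  simp [List.getD_eq_getElem?_getD]

/-- The invariant of the construction: the budget of a history never exceeds `R` times its widths.
Our turns preserve it by the capacities in `split`, the adversary's because widths do not decrease
there. -/
theorem budget_le (hw : IsWidthBound n w I A) (ha : b₀.1 ≤ R * (w []).2)
    (hx : b₀.1 + b₀.2 ≤ R * (w []).1) (h : List (Fin k)) (hh : h.length ≤ n) :
    (budget R w b₀ h).1 ≤ R * (w h).2 ∧
      (budget R w b₀ h).1 + (budget R w b₀ h).2 ≤ R * (w h).1 := by
  induction h using List.reverseRecOn with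
  | nil => exact ⟨ha, hx⟩
  | append_singleton h u ih =>
    simp only [List.length_append, List.length_singleton] at hh
    obtain ⟨h1, h2⟩ := ih (by omega)
    rw [budget_append_singleton]
    split_ifs with ho
    · rw [← Nat.not_even_iff_odd] at ho
      exact ⟨h1.trans (Nat.mul_le_mul_left _ (hw.snd_le h u (by omega) ho)),
        h2.trans (Nat.mul_le_mul_left _ (hw.fst_le h u (by omega) ho))⟩
    · have := split_getD_le (R := R) (a := (budget R w b₀ h).1) (x := (budget R w b₀ h).2)
        (ws := List.ofFn fun u => w (h ++ [u])) (fun z hz => ?_) u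
      · rwa [getD_ofFn] at this
      · obtain ⟨v, rfl⟩ := (List.mem_ofFn' _ _).1 hz
        exact hw.snd_le_fst _ (by simp; omega)

theorem sum_shares (hw : IsWidthBound n w I A) (ha : b₀.1 ≤ R * (w []).2)
    (hx : b₀.1 + b₀.2 ≤ R * (w []).1) (h : List (Fin k)) (hh : h.length < n) (he : Even h.length) :
    ((shares R w h (budget R w b₀ h)).map Prod.fst).sum = (budget R w b₀ h).1 ∧
    ((shares R w h (budget R w b₀ h)).map Prod.snd).sum = (budget R w b₀ h).2 := by
  obtain ⟨h1, h2⟩ := budget_le hw ha hx h hh.le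
  refine sum_split (fun z hz => ?_) ?_ ?_
  · obtain ⟨v, rfl⟩ := (List.mem_ofFn' _ _).1 hz
    exact hw.snd_le_fst _ (by simp; omega)
  · rw [List.map_ofFn, List.sum_ofFn]
    exact h1.trans (Nat.mul_le_mul_left _ (hw.sum_snd h hh he))
  · rw [List.map_ofFn, List.sum_ofFn]
    exact h2.trans (Nat.mul_le_mul_left _ (hw.sum_fst h hh he))

theorem sum_map_add (l : List (ℕ × ℕ)) :
    (l.map fun s => s.1 + s.2).sum = (l.map Prod.fst).sum + (l.map Prod.snd).sum := by
  induction l with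
  | nil => rfl
  | cons x l ih => simp only [List.map_cons, List.sum_cons, ih]; omega

theorem sum_weights_pos (hw : IsWidthBound n w I A) (ha : b₀.1 ≤ R * (w []).2)
    (hx : b₀.1 + b₀.2 ≤ R * (w []).1) (h : List (Fin k)) : 0 < (weights n R w b₀ h).sum := by
  unfold weights
  split_ifs with hc
  · obtain ⟨h1, h2⟩ := sum_shares hw ha hx h hc.1 (Nat.not_odd_iff_even.1 hc.2.1)
    rw [sum_map_add, h1, h2]
    exact hc.2.2
  · simp

theorem length_weights_le (hk : 0 < k) (h : List (Fin k)) : (weights n R w b₀ h).length ≤ k := by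
  unfold weights
  split_ifs
  · simp [shares, length_split]
  · exact hk

/-- The strategy that plays the symbols with probabilities proportional to the weights. -/
noncomputable def budgetStrategy (hk : 0 < k) (hw : IsWidthBound n w I A) (ha : b₀.1 ≤ R * (w []).2)
    (hx : b₀.1 + b₀.2 ≤ R * (w []).1) : Strategy (Fin k) n where
  prob h u := ((weights n R w b₀ h).getD u 0 : ℕ) / ((weights n R w b₀ h).sum : ℕ)
  prob_nonneg _ _ := by positivity
  prob_le_one h u := by
    refine div_le_one_of_le₀ ?_ (Nat.cast_nonneg _)
    rw [← sum_getD (length_weights_le hk h)]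
    exact_mod_cast Finset.single_le_sum (f := fun u : Fin k => (weights n R w b₀ h).getD u 0)
      (fun _ _ => Nat.zero_le _) (Finset.mem_univ u)
  sum_prob h _ := by
    rw [← Finset.sum_div, ← Nat.cast_sum, sum_getD (length_weights_le hk h), div_self]
    exact_mod_cast (sum_weights_pos hw ha hx h).ne'

/-- Iterated along a history, this makes the total budget the initial total times the product of our
own move probabilities. -/
theorem budget_mul_prob (hk : 0 < k) (hw : IsWidthBound n w I A) (ha : b₀.1 ≤ R * (w []).2)
    (hx : b₀.1 + b₀.2 ≤ R * (w []).1) (h : List (Fin k)) (hh : h.length < n) (he : Even h.length)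
    (u : Fin k) :
    (((budget R w b₀ h).1 : ℝ) + (budget R w b₀ h).2) * (budgetStrategy hk hw ha hx).prob h u =
      ((budget R w b₀ (h ++ [u])).1 : ℝ) + (budget R w b₀ (h ++ [u])).2 := by
  obtain ⟨h1, h2⟩ := sum_shares hw ha hx h hh he
  have h3 := sum_map_add (shares R w h (budget R w b₀ h))
  rw [h1, h2] at h3
  have h4 : ((shares R w h (budget R w b₀ h)).map fun s => s.1 + s.2).getD u 0 =
      ((shares R w h (budget R w b₀ h)).getD u (0, 0)).1 +
        ((shares R w h (budget R w b₀ h)).getD u (0, 0)).2 := by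
    exact List.getD_map _ (0, 0) fun s : ℕ × ℕ => s.1 + s.2
  have h5 : ((shares R w h (budget R w b₀ h)).map fun s => s.1 + s.2).length ≤ k := by
    simp [shares, length_split]
  -- No share exceeds the total. This settles the case of an empty budget, where the weights are
  -- `[1]` and unrelated to the shares, but both sides are `0`.
  have h6 := Finset.single_le_sum (f := fun u : Fin k =>
    ((shares R w h (budget R w b₀ h)).map fun s => s.1 + s.2).getD u 0)
      (fun _ _ => Nat.zero_le _) (Finset.mem_univ u)
  rw [sum_getD h5, h3, h4] at h6
  have ho : ¬ Odd h.length := Nat.not_odd_iff_even.2 he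
  rw [budget_append_singleton, if_neg ho]
  by_cases h0 : 0 < (budget R w b₀ h).1 + (budget R w b₀ h).2
  · have : weights n R w b₀ h = (shares R w h (budget R w b₀ h)).map fun s => s.1 + s.2 := by
      rw [weights, if_pos ⟨hh, ho, h0⟩]
    simp only [budgetStrategy, this, h4, h3]
    push_cast
    refine mul_div_cancel₀ _ ?_
    exact_mod_cast h0.ne'
  · have h7 : ((budget R w b₀ h).1 : ℝ) + (budget R w b₀ h).2 = 0 := by exact_mod_cast by omega
    rw [h7, zero_mul]
    exact_mod_cast by omega

open Classical in
-- The three requirements are multiplied by the budget instead of being stated as conditional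
-- probabilities, so empty budgets need no separate treatment. On our turns, budget times move
-- probability is the budget of the successor; on the adversary's turns, the budget is constant and
-- the claims are averaged over his moves.
theorem budgetStrategy_spec (hk : 0 < k) (hw : IsWidthBound n w I A) (ha : b₀.1 ≤ R * (w []).2)
    (hx : b₀.1 + b₀.2 ≤ R * (w []).1) (τ : Strategy (Fin k) n) (j : ℕ) (h : List (Fin k))
    (hj : h.length + j = n) :
    (((budget R w b₀ h).1 : ℝ) + (budget R w b₀ h).2) *
        tailProb (budgetStrategy hk hw ha hx) τ I j h =
      ((budget R w b₀ h).1 : ℝ) + (budget R w b₀ h).2 ∧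
    ((budget R w b₀ h).1 : ℝ) ≤ (((budget R w b₀ h).1 : ℝ) + (budget R w b₀ h).2) *
        tailProb (budgetStrategy hk hw ha hx) τ A j h ∧
    ∀ π : List (Fin k), π.length = j → (((budget R w b₀ h).1 : ℝ) + (budget R w b₀ h).2) *
        condProb (budgetStrategy hk hw ha hx) τ h π ≤ R := by
  induction j generalizing h with
  | zero =>
    obtain ⟨h1, h2⟩ := budget_le hw ha hx h (by omega)
    rw [hw.fst_end h (by omega)] at h2
    rw [hw.snd_end h (by omega)] at h1
    rw [tailProb_zero, tailProb_zero]
    have h3 : ((budget R w b₀ h).1 : ℝ) + (budget R w b₀ h).2 ≤ R * if h ∈ I then 1 else 0 := by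
      exact_mod_cast h2
    have h4 : ((budget R w b₀ h).1 : ℝ) ≤ R * if h ∈ A then 1 else 0 := by exact_mod_cast h1
    have h5 : (0 : ℝ) ≤ (budget R w b₀ h).1 := by positivity
    have h6 : (0 : ℝ) ≤ (budget R w b₀ h).2 := by positivity
    have h7 : (0 : ℝ) ≤ R := by positivity
    refine ⟨?_, ?_, fun π hπ => ?_⟩
    -- Outside `I` the width is `0`, so no budget is left there.
    · split_ifs at h3 ⊢ <;> linarith
    · split_ifs at h4 ⊢ <;> linarith
    · rw [List.length_eq_zero_iff.1 hπ]
      simp only [condProb]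
      split_ifs at h3 <;> linarith
  | succ j ih =>
    have hh : h.length < n := by omega
    have ih' := fun u => ih (h ++ [u]) (by simp; omega)
    have hb := budget_mul_prob hk hw ha hx h hh
    have hsum := sum_moveProb (budgetStrategy hk hw ha hx) τ hh
    have hshare := sum_shares hw ha hx h hh
    have hbud := budget_append_singleton R w b₀ h
    have hnn := moveProb_nonneg (budgetStrategy hk hw ha hx) τ h
    rw [tailProb_succ, tailProb_succ, Finset.mul_sum, Finset.mul_sum]
    simp only [← mul_assoc]
    by_cases he : Even h.length
    · have hm : ∀ u, moveProb (budgetStrategy hk hw ha hx) τ h u =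
          (budgetStrategy hk hw ha hx).prob h u := fun u => by simp [moveProb, he]
      simp only [hm] at hsum hnn ⊢
      simp only [hb he]
      have hlen : (shares R w h (budget R w b₀ h)).length = k := by
        simp [shares, length_split]
      obtain ⟨h1, -⟩ := hshare he
      refine ⟨?_, ?_, fun π hπ => ?_⟩
      · simp only [(ih' _).1]
        rw [← Finset.sum_congr rfl fun u _ => hb he u, ← Finset.mul_sum, hsum, mul_one]
      · refine le_trans (le_of_eq ?_) (Finset.sum_le_sum fun u _ => (ih' u).2.1)
        rw [← h1, ← sum_getD (k := k) (by simp [hlen])]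
        push_cast
        refine Finset.sum_congr rfl fun u _ => ?_
        rw [hbud, if_neg (Nat.not_odd_iff_even.2 he),
          show (0 : ℕ) = Prod.fst ((0, 0) : ℕ × ℕ) from rfl, List.getD_map]
      · rcases π with _ | ⟨u, π⟩
        · simp at hπ
        · rw [condProb_cons, hm, ← mul_assoc, hb he]
          exact (ih' u).2.2 π (by simpa using hπ)
    · simp only [hbud, if_pos (Nat.not_even_iff_odd.1 he)] at ih'
      refine ⟨?_, ?_, fun π hπ => ?_⟩
      · simp only [mul_assoc, mul_left_comm _ (moveProb _ _ _ _), (ih' _).1]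
        rw [← Finset.sum_mul, hsum, one_mul]
      · simp only [mul_assoc, mul_left_comm _ (moveProb _ _ _ _)]
        refine le_trans (le_of_eq ?_) (Finset.sum_le_sum fun u _ =>
          mul_le_mul_of_nonneg_left (ih' u).2.1 (hnn u))
        rw [← Finset.sum_mul, hsum, one_mul]
      · rcases π with _ | ⟨u, π⟩
        · simp at hπ
        · rw [condProb_cons, mul_left_comm]
          -- For a single play no averaging is needed: a move of the adversary multiplies its
          -- probability by a factor at most `1`.
          have h1 : moveProb (budgetStrategy hk hw ha hx) τ h u ≤ 1 := by
            rw [← hsum]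
            exact Finset.single_le_sum (fun u _ => hnn u) (Finset.mem_univ u)
          have h2 := (ih' u).2.2 π (by simpa using hπ)
          have h3 : (0 : ℝ) ≤ R := by positivity
          nlinarith [hnn u]

end Budget

/-! ### The realizability criterion for automata -/

section Realizable

variable {k n : ℕ} {V W : Type} (D : DFA (Fin k) V) (E : DFA (Fin k) W)

/-- The numbers of the plays in the hard language, and in both languages, that can be forced. -/
noncomputable def widths (n : ℕ) (h : List (Fin k)) : ℕ × ℕ :=
  (dpWidth D n (D.eval h) h.length, dpWidth (D.inter E) n (D.eval h, E.eval h) h.length)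

/-- The multiple `ρ.den * ε.den` of the probability bound. -/
def capacity (ε ρ : ℚ) : ℕ := ρ.num.natAbs * ε.den

/-- The multiples by `ρ.den * ε.den` of the probability that the play is required to lie in the soft
language, and of the remaining probability. -/
def startBudget (ε ρ : ℚ) : ℕ × ℕ :=
  ((ε.den - ε.num.natAbs) * ρ.den, ε.num.natAbs * ρ.den)

theorem wordsOfLength_inf {α : Type*} (H S : Language α) (n : ℕ) :
    wordsOfLength (H ⊓ S) n = wordsOfLength H n ∩ wordsOfLength S n := by
  ext w
  constructor
  · rintro ⟨⟨h1, h2⟩, h3⟩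
    exact ⟨⟨h1, h3⟩, h2, h3⟩
  · rintro ⟨⟨h1, h3⟩, h2, -⟩
    exact ⟨⟨h1, h2⟩, h3⟩

theorem isWidthBound_widths (n : ℕ) : IsWidthBound n (widths D E n)
    (wordsOfLength D.accepts n) (wordsOfLength D.accepts n ∩ wordsOfLength E.accepts n) where
  fst_end h hh := by
    subst hh
    simp only [widths, dpWidth_end]
    congr 1
    simp [wordsOfLength, DFA.mem_accepts]
  snd_end h hh := by
    subst hh
    simp only [widths, dpWidth_end]
    congr 1
    simp [wordsOfLength, DFA.mem_accepts, DFA.inter]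
  snd_le_fst h hh := dpWidth_mono (D := D.inter E) (E := D) (r := fun v w => v.1 = w)
    (fun v w u hr => by subst hr; rfl) (fun v w hr hv => by subst hr; exact hv.1) hh rfl
  sum_fst h hh he := by
    simp only [widths, dpWidth_even D hh he, DFA.eval_append_singleton, List.length_append,
      List.length_singleton, le_refl]
  sum_snd h hh he := by
    simp only [widths, dpWidth_even (D.inter E) hh he, DFA.eval_append_singleton,
        List.length_append,
      List.length_singleton]
    rfl
  fst_le h u hh he := by
    simp only [widths, DFA.eval_append_singleton, List.length_append, List.length_singleton]
    exact dpWidth_odd_le D hh he _ u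
  snd_le h u hh he := by
    simp only [widths, DFA.eval_append_singleton, List.length_append, List.length_singleton]
    exact dpWidth_odd_le (D.inter E) hh he _ u

variable {ε ρ : ℚ} (hε : 0 ≤ ε) (hε1 : ε ≤ 1) (hρ : 0 ≤ ρ)

include hε hε1 in
theorem cast_startBudget : ((startBudget ε ρ).1 : ℝ) = (1 - ε) * (ρ.den * ε.den) ∧
    (((startBudget ε ρ).1 + (startBudget ε ρ).2 : ℕ) : ℝ) = ρ.den * ε.den := by
  have h1 : (ε.num.natAbs : ℤ) = ε.num := Int.natAbs_of_nonneg (Rat.num_nonneg.2 hε)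
  -- Because `ε ≤ 1`, the truncated subtraction in `startBudget` is exact.
  have h2 : ε.num.natAbs ≤ ε.den := by
    have h3 : (ε.num : ℚ) ≤ ε.den := by
      rw [← Rat.num_div_den ε, div_le_one (by exact_mod_cast ε.den_pos)] at hε1
      exact hε1
    have h4 : ε.num ≤ ε.den := by exact_mod_cast h3
    omega
  have h5 : (ε : ℝ) * ε.den = ε.num.natAbs := by
    have h6 : ε * ε.den = (ε.num.natAbs : ℚ) :=
      (Rat.mul_den_eq_num ε).trans (by rw [← Int.cast_natCast, h1])
    generalize ε.num.natAbs = a at h6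
    exact_mod_cast h6
  constructor
  · simp only [startBudget]
    push_cast [Nat.cast_sub h2]
    rw [← h5]
    ring
  · simp only [startBudget]
    push_cast [Nat.cast_sub h2]
    ring

include hρ in
theorem cast_capacity : (capacity ε ρ : ℝ) = ρ * (ρ.den * ε.den) := by
  have h1 : (ρ.num.natAbs : ℤ) = ρ.num := Int.natAbs_of_nonneg (Rat.num_nonneg.2 hρ)
  have h5 : (ρ : ℝ) * ρ.den = ρ.num.natAbs := by
    have h6 : ρ * ρ.den = (ρ.num.natAbs : ℚ) :=
      (Rat.mul_den_eq_num ρ).trans (by rw [← Int.cast_natCast, h1])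
    generalize ρ.num.natAbs = a at h6
    exact_mod_cast h6
  simp only [capacity]
  push_cast
  rw [← h5]
  ring

include hε hε1 hρ in
-- Sufficiency: `budgetStrategy_spec` at the empty history, divided by the total budget `ρ.den *
-- ε.den`.
theorem isImprovising_budgetStrategy (hk : 0 < k)
    (ha : (startBudget ε ρ).1 ≤ capacity ε ρ * (widths D E n []).2)
    (hx : (startBudget ε ρ).1 + (startBudget ε ρ).2 ≤ capacity ε ρ * (widths D E n []).1) :
    IsImprovising D.accepts E.accepts ε ρ
      (budgetStrategy hk (isWidthBound_widths D E n) ha hx) := by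
  have spec := fun τ => budgetStrategy_spec hk (isWidthBound_widths D E n) ha hx τ n [] (by simp)
  obtain ⟨h1, h2⟩ := cast_startBudget (ρ := ρ) hε hε1
  have h3 := cast_capacity (ε := ε) hρ
  have h4 : (0 : ℝ) < ρ.den * ε.den := by
    have := ρ.den_pos
    have := ε.den_pos
    positivity
  push_cast at h2
  simp only [budget_nil, h2, ← setProb_eq_tailProb] at spec
  rw [h1, h3] at spec
  refine ⟨fun τ => ?_, fun τ => ?_, fun τ π hπ => ?_⟩
  · exact mul_left_cancel₀ h4.ne' ((spec τ).1.trans (mul_one _).symm)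
  · have := (spec τ).2.1
    rw [mul_comm] at this
    exact le_of_mul_le_mul_left this h4
  · have := (spec τ).2.2 π hπ.2
    rw [mul_comm (ρ : ℝ)] at this
    exact le_of_mul_le_mul_left this h4

include hε hε1 hρ in
-- Necessity: the soft requirement is tested against the worst adversary for the product automaton,
-- the hard one against the worst adversary for `D`; these may be different adversaries.
theorem budget_le_of_isImprovising (hk : 0 < k) {σ : Strategy (Fin k) n}
    (hσ : IsImprovising D.accepts E.accepts ε ρ σ) :
    (startBudget ε ρ).1 ≤ capacity ε ρ * (widths D E n []).2 ∧
    (startBudget ε ρ).1 + (startBudget ε ρ).2 ≤ capacity ε ρ * (widths D E n []).1 := by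
  have : Nonempty (Fin k) := ⟨⟨0, hk⟩⟩
  obtain ⟨h1, h2⟩ := cast_startBudget (ρ := ρ) hε hε1
  have h3 := cast_capacity (ε := ε) hρ
  have h4 : (0 : ℝ) ≤ ρ.den * ε.den := by positivity
  constructor
  · obtain ⟨τ, hτ⟩ := exists_setProb_le (D.inter E) σ (ρ := ρ) fun τ π hπ => by
      rw [DFA.accepts_inter, wordsOfLength_inf] at hπ
      exact hσ.random τ π hπ.1
    rw [DFA.accepts_inter, wordsOfLength_inf] at hτ
    have h5 := (hσ.soft τ).trans hτ
    have h6 : (((startBudget ε ρ).1 : ℕ) : ℝ) ≤ (capacity ε ρ * (widths D E n []).2 : ℕ) := by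
      push_cast
      rw [h1, h3]
      calc (1 - (ε : ℝ)) * (ρ.den * ε.den) ≤ _ := mul_le_mul_of_nonneg_right h5 h4
        _ = _ := mul_right_comm _ _ _
    exact_mod_cast h6
  · obtain ⟨τ, hτ⟩ := exists_setProb_le D σ (ρ := ρ) fun τ π hπ => hσ.random τ π hπ
    rw [hσ.hard τ] at hτ
    have h6 : (((startBudget ε ρ).1 + (startBudget ε ρ).2 : ℕ) : ℝ) ≤
        (capacity ε ρ * (widths D E n []).1 : ℕ) := by
      rw [h2]
      push_cast
      rw [h3]
      calc (ρ.den * ε.den : ℝ) = 1 * (ρ.den * ε.den) := (one_mul _).symm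
        _ ≤ _ := mul_le_mul_of_nonneg_right hτ h4
        _ = _ := mul_right_comm _ _ _
    exact_mod_cast h6

end Realizable

/-! # Sums over coin tosses -/

open scoped ENNReal

section Sums

variable {P : Prog} {x : Val} {κ : Type} {code : κ → List Bool} {y : κ → Val} {t : κ → ℕ}

/-- The executions of `P` on `x` are listed by `κ`. -/
structure Lists (P : Prog) (x : Val) (code : κ → List Bool) (y : κ → Val) (t : κ → ℕ) : Prop where
  inj : Function.Injective code
  exec : ∀ i, Exec P x (code i) (y i) (t i)
  complete : ∀ b, ∃ c d i, b ++ c = code i ++ d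

namespace Lists

/-- By `complete`, the tosses of any halting execution are compatible with some listed code word,
and prefix-freeness turns compatibility into equality. So the listed executions are all of them. -/
theorem exists_eq (h : Lists P x code y t) {b : List Bool} {z : Val} {s : ℕ} (hb : Exec P x b z s) :
    ∃ i, code i = b ∧ y i = z ∧ t i = s := by
  obtain ⟨c, d, i, hi⟩ := h.complete b
  obtain ⟨h1, h2, h3⟩ := hb.prefix_free (h.exec i) hi
  exact ⟨i, h1.symm, h2.symm, h3.symm⟩

theorem exec_iff (h : Lists P x code y t) (i : κ) {z : Val} {s : ℕ} :
    Exec P x (code i) z s ↔ y i = z ∧ t i = s := by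
  constructor
  · intro hi
    obtain ⟨-, h2, h3⟩ := hi.prefix_free (c := []) (c' := []) (h.exec i) rfl
    exact ⟨h2.symm, h3.symm⟩
  · rintro ⟨rfl, rfl⟩
    exact h.exec i

open Classical in
theorem outProb_eq (h : Lists P x code y t) (z : Val) : P.outProb x z =
    ∑' i, if y i = z then (2⁻¹ : ℝ≥0∞) ^ (code i).length else 0 := by
  unfold Prog.outProb
  rw [← h.inj.tsum_eq]
  · refine tsum_congr fun i => ?_
    simp only [h.exec_iff, exists_and_left, exists_eq', and_true]
  · intro b hb
    rw [Function.mem_support, ne_eq, ite_eq_right_iff, not_forall] at hb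
    obtain ⟨⟨s, hs⟩, -⟩ := hb
    obtain ⟨i, hi, -⟩ := h.exists_eq hs
    exact ⟨i, hi⟩

open Classical in
theorem haltProb_eq (h : Lists P x code y t) : P.haltProb x =
    ∑' i, (2⁻¹ : ℝ≥0∞) ^ (code i).length := by
  unfold Prog.haltProb
  rw [← h.inj.tsum_eq]
  · refine tsum_congr fun i => ?_
    rw [if_pos ⟨_, _, h.exec i⟩]
  · intro b hb
    rw [Function.mem_support, ne_eq, ite_eq_right_iff, not_forall] at hb
    obtain ⟨⟨z, s, hs⟩, -⟩ := hb
    obtain ⟨i, hi, -⟩ := h.exists_eq hs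
    exact ⟨i, hi⟩

open Classical in
theorem expectedTime_eq (h : Lists P x code y t) (h1 : P.haltProb x = 1) : P.expectedTime x =
    ∑' i, (2⁻¹ : ℝ≥0∞) ^ (code i).length * t i := by
  unfold Prog.expectedTime
  rw [if_pos h1]
  have hinj : Function.Injective fun i => (code i, t i) := fun i j hij =>
    h.inj (congrArg Prod.fst hij)
  rw [← hinj.tsum_eq]
  · refine tsum_congr fun i => ?_
    rw [if_pos ⟨_, h.exec i⟩]
  · intro b hb
    rw [Function.mem_support, ne_eq, ite_eq_right_iff, not_forall] at hb
    obtain ⟨⟨z, hs⟩, -⟩ := hb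
    obtain ⟨i, hi, -, hi'⟩ := h.exists_eq hs
    exact ⟨i, Prod.ext hi hi'⟩

end Lists

theorem tsum_list_length (N : ℕ) (f : ℕ → ℝ≥0∞) :
    ∑' l : List (Fin N), f l.length = ∑' j : ℕ, (N : ℝ≥0∞) ^ j * f j := by
  rw [← List.equivSigmaTuple.symm.tsum_eq, ENNReal.tsum_sigma']
  refine tsum_congr fun j => ?_
  have : ∀ b : Fin j → Fin N, (List.equivSigmaTuple.symm ⟨j, b⟩).length = j := fun b => by
    simp [List.equivSigmaTuple]
  simp only [this]
  rw [tsum_fintype]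
  simp

/-- This bounds the expected number of rounds when each is rejected with probability at most one
half; the sum is `4`, but only its finiteness is needed. -/
theorem tsum_succ_mul_geometric_ne_top : ∑' j : ℕ, ((j : ℝ≥0∞) + 1) * 2⁻¹ ^ j ≠ ∞ := by
  have h1 : Summable fun j : ℕ => ((j : ℝ) + 1) * (2⁻¹ : ℝ) ^ j := by
    have h2 := summable_pow_mul_geometric_of_norm_lt_one (R := ℝ) 1 (r := 2⁻¹)
      (by rw [Real.norm_eq_abs, abs_of_pos] <;> norm_num)
    have h3 := summable_geometric_of_lt_one (r := (2⁻¹ : ℝ)) (by norm_num) (by norm_num)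
    simpa [add_mul] using h2.add h3
  convert h1.tsum_ofReal_ne_top using 3 with j
  rw [ENNReal.ofReal_mul (by positivity), ENNReal.ofReal_pow (by positivity),
    ENNReal.ofReal_add (by positivity) (by positivity), ENNReal.ofReal_natCast, ENNReal.ofReal_one,
    ENNReal.ofReal_inv_of_pos (by norm_num)]
  simp

end Sums

/-! # Blocks of bits -/

/-- The number with the binary digits `b`. -/
def bitsVal (b : List Bool) : ℕ := b.foldl (fun r c => 2 * r + c.toNat) 0

/-- The last `s` binary digits of `r`. -/
def bitsOf : ℕ → ℕ → List Bool
  | 0, _ => []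
  | s + 1, r => bitsOf s (r / 2) ++ [decide (r % 2 = 1)]

theorem length_bitsOf (s r : ℕ) : (bitsOf s r).length = s := by
  induction s generalizing r with
  | zero => rfl
  | succ s ih => simp [bitsOf, ih]

theorem bitsVal_append_singleton (b : List Bool) (c : Bool) :
    bitsVal (b ++ [c]) = 2 * bitsVal b + c.toNat := by
  simp [bitsVal]

theorem bitsVal_bitsOf {s r : ℕ} (h : r < 2 ^ s) : bitsVal (bitsOf s r) = r := by
  induction s generalizing r with
  | zero => simp at h; simp [bitsOf, bitsVal, h]
  | succ s ih =>
    rw [bitsOf, bitsVal_append_singleton, ih (by rw [pow_succ] at h; omega)]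
    rcases Nat.mod_two_eq_zero_or_one r with h1 | h1 <;> simp [h1] <;> omega

theorem bitsOf_bitsVal (b : List Bool) : bitsOf b.length (bitsVal b) = b := by
  induction b using List.reverseRecOn with
  | nil => rfl
  | append_singleton b c ih =>
    rw [List.length_append, List.length_singleton, bitsOf, bitsVal_append_singleton]
    have h1 : (2 * bitsVal b + c.toNat) / 2 = bitsVal b := by cases c <;> (simp; try omega)
    have h2 : decide ((2 * bitsVal b + c.toNat) % 2 = 1) = c := by cases c <;> simp
    rw [h1, h2, ih]

theorem bitsVal_lt (b : List Bool) : bitsVal b < 2 ^ b.length := by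
  induction b using List.reverseRecOn with
  | nil => simp [bitsVal]
  | append_singleton b c ih =>
    rw [List.length_append, List.length_singleton, bitsVal_append_singleton, pow_succ]
    have : c.toNat ≤ 1 := by cases c <;> simp
    omega

/-- Rejected blocks, with the values `p + i`, followed by an accepted block. -/
def blockCode (s p : ℕ) (z : List (Fin (2 ^ s - p)) × Fin p) : List Bool :=
  z.1.flatMap (fun i => bitsOf s (p + i)) ++ bitsOf s z.2

theorem length_blockCode (s p : ℕ) (z : List (Fin (2 ^ s - p)) × Fin p) :
    (blockCode s p z).length = s * z.1.length + s := by
  simp [blockCode, length_bitsOf, List.length_flatMap, mul_comm]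

theorem blockCode_cons (s p : ℕ) (i : Fin (2 ^ s - p)) (l : List (Fin (2 ^ s - p))) (g : Fin p) :
    blockCode s p (i :: l, g) = bitsOf s (p + i) ++ blockCode s p (l, g) := by
  simp [blockCode]

/-- All blocks have length `s`, so codes can be compared block by block; a value below `p` ends the
code and a value from `p` on does not. -/
theorem blockCode_injective {s p : ℕ} (hp : p ≤ 2 ^ s) :
    Function.Injective (blockCode s p) := by
  have hval : ∀ {i j}, i < 2 ^ s → j < 2 ^ s → bitsOf s i = bitsOf s j → i = j :=
    fun hi hj h => by rw [← bitsVal_bitsOf hi, h, bitsVal_bitsOf hj]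
  rintro ⟨l, g⟩ ⟨l', g'⟩ h
  induction l generalizing l' with
  | nil =>
    rcases l' with _ | ⟨j, l'⟩
    · have := hval (by omega) (by omega)
          (show bitsOf s g = bitsOf s g' by simpa [blockCode] using h)
      rw [Fin.ext this]
    · rw [blockCode_cons] at h
      have h1 := (List.append_inj (t₁ := []) (by simpa [blockCode] using h)
        (by simp [length_bitsOf] : (bitsOf s g).length = (bitsOf s (p + j)).length)).1
      have := hval (by omega) (by omega) h1
      omega
  | cons i l ih =>
    rcases l' with _ | ⟨j, l'⟩
    · rw [blockCode_cons] at h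
      have h1 := (List.append_inj (t₂ := []) (by simpa [blockCode] using h)
        (by simp [length_bitsOf] : (bitsOf s (p + i)).length = (bitsOf s g').length)).1
      have := hval (by omega) (by omega) h1
      omega
    · rw [blockCode_cons, blockCode_cons] at h
      obtain ⟨h1, h2⟩ := List.append_inj h (by simp [length_bitsOf])
      have h3 := hval (by omega) (by omega) h1
      have h4 := ih l' h2
      simp only [Prod.mk.injEq, List.cons.injEq] at h4 ⊢
      exact ⟨⟨Fin.ext (by omega), h4.1⟩, h4.2⟩

/-- Cut the tosses into blocks of length `s > 0` up to the first accepted one. If none is accepted,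
pad the last block and append the accepted block of value `0`. -/
theorem exists_blockCode_prefix {s p : ℕ} (hp : 0 < p) (hs : 0 < s) (b : List Bool) :
    ∃ c d z, b ++ c = blockCode s p z ++ d := by
  have block : ∀ b : List Bool, b.length = s → ∀ b' : List Bool,
      (∃ c d z, b' ++ c = blockCode s p z ++ d) → ∃ c d z, b ++ b' ++ c = blockCode s p z ++ d := by
    rintro b hb b' ⟨c, d, ⟨l, g⟩, h⟩
    have h0 := bitsVal_lt b
    have h1 := bitsOf_bitsVal b
    rw [hb] at h0 h1
    by_cases hv : bitsVal b < p
    · exact ⟨[], b', ([], ⟨bitsVal b, hv⟩), by simp [blockCode, h1]⟩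
    · refine ⟨c, d, (⟨bitsVal b - p, by omega⟩ :: l, g), ?_⟩
      rw [blockCode_cons, List.append_assoc, h, show p + (bitsVal b - p) = bitsVal b by omega, h1,
        List.append_assoc]
  induction hn : b.length using Nat.strong_induction_on generalizing b with
  | _ m ih =>
    by_cases hb : b.length ≤ s
    · obtain ⟨c, d, z, h⟩ := block (b ++ List.replicate (s - b.length) false) (by simp; omega) []
        ⟨bitsOf s 0, [], ([], ⟨0, hp⟩), by simp [blockCode]⟩
      exact ⟨List.replicate (s - b.length) false ++ c, d, z, by simpa using h⟩
    · have := block (b.take s) (by simp; omega) (b.drop s)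
          (ih (b.length - s) (by omega) _ (by simp))
      rwa [List.take_append_drop] at this

/-! # Sampling -/

/-- The index of the interval that contains `g`, when intervals with the lengths in `l` are laid out
one after the other. -/
def locate : List ℕ → ℕ → ℕ
  | [], _ => 0
  | x :: l, g => if g < x then 0 else locate l (g - x) + 1

/-- A uniform `g` below `l.sum` therefore hits the index `u` with probability `l.getD u 0 / l.sum`.
-/
theorem sum_locate (l : List ℕ) (u : ℕ) :
    (∑ g ∈ Finset.range l.sum, if locate l g = u then 1 else 0) = l.getD u 0 := by
  induction l generalizing u with
  | nil => simp
  | cons x l ih =>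
    rw [List.sum_cons, Finset.sum_range_add]
    have h1 : ∀ g ∈ Finset.range x, (if locate (x :: l) g = u then 1 else 0) =
        if u = 0 then 1 else 0 := fun g hg => by
      rw [locate, if_pos (Finset.mem_range.1 hg)]
      exact if_congr eq_comm rfl rfl
    have h2 : ∀ g ∈ Finset.range l.sum, (if locate (x :: l) (x + g) = u then 1 else 0) =
        if locate l g + 1 = u then 1 else 0 := fun g _ => by
      have : locate (x :: l) (x + g) = locate l g + 1 := by
        rw [locate, if_neg (by omega), Nat.add_sub_cancel_left]
      rw [this]
    rw [Finset.sum_congr rfl h1, Finset.sum_congr rfl h2]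
    rcases u with _ | u
    · simp
    · simpa using ih u

/-- `locate` in one scan: the index is the number of partial sums that do not exceed `g`. The
running sum is `c`; once it exceeds `g` the count is frozen. -/
theorem foldl_locate (l : List ℕ) (g c u : ℕ) :
    (l.foldl (fun z x => (z.1 + x, if z.1 + x ≤ g then z.2 + 1 else z.2)) (c, u)).2 =
      if g < c then u else u + locate l (g - c) := by
  induction l generalizing c u with
  | nil => simp [locate]
  | cons x l ih =>
    rw [List.foldl_cons, ih, locate]
    simp only [Nat.sub_sub]
    split_ifs <;> omega

theorem foldl_locate_le (l : List ℕ) (g c u : ℕ) :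
    l.foldl (fun z x => (z.1 + x, if z.1 + x ≤ g then z.2 + 1 else z.2)) (c, u) =
      (c + l.sum, (l.foldl (fun z x => (z.1 + x, if z.1 + x ≤ g then z.2 + 1 else z.2)) (c, u)).2) ∧
    (l.foldl (fun z x => (z.1 + x, if z.1 + x ≤ g then z.2 + 1 else z.2)) (c, u)).2 ≤
      u + l.length := by
  induction l generalizing c u with
  | nil => simp
  | cons x l ih =>
    simp only [List.foldl_cons]
    obtain ⟨h1, h2⟩ := ih (c + x) (if c + x ≤ g then u + 1 else u)
    refine ⟨h1.trans (by simp [add_assoc]), h2.trans ?_⟩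
    rw [List.length_cons]
    split_ifs <;> omega

theorem natSize_le (a : ℕ) : Nat.size a ≤ a := by
  rw [Nat.size_le]
  exact Nat.lt_two_pow_self

/-! ### Polynomial time of the auxiliary functions for sampling -/

namespace Comp

variable {ι : Type} {e : ι → Val}

theorem locate {l : ι → List ℕ} {g : ι → ℕ} (hl : Comp e l) (hg : Comp e g) :
    Comp e fun i => locate (l i) (g i) := by
  refine ((foldl (F := fun z : (ι × (ℕ × ℕ)) × ℕ => (z.1.2.1 + z.2,
    if z.1.2.1 + z.2 ≤ g z.1.1 then z.1.2.2 + 1 else z.1.2.2)) hl (const (0, 0))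
    ((var.wk.fst.add var).pair
      ((var.wk.fst.add var).ite_le hg.wk.wk (var.wk.snd.add (const 1)) var.wk.snd))
    (B := fun i => 1 + (enc (l i)).size + (1 + (l i).length))
    (((PBdd.const 1).add hl.pbdd).add ((PBdd.const 1).add hl.pbdd_length))
    fun i l' hl' => ?_).snd).congr fun i => ?_
  · obtain ⟨h1, h2⟩ := foldl_locate_le l' (g i) 0 0
    dsimp only
    rw [h1, size_enc_prod, zero_add, size_enc_nat (Prod.snd _)]
    have h3 := size_enc_sum_le l'
    have h4 := size_enc_take_le (l i) l'.length
    rw [← List.prefix_iff_eq_take.1 hl'] at h4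
    have h5 := natSize_le
      (l'.foldl (fun z x => (z.1 + x, if z.1 + x ≤ g i then z.2 + 1 else z.2)) (0, 0)).2
    have h6 := hl'.length_le
    omega
  · dsimp only
    rw [foldl_locate]
    simp

theorem replicate_size {a : ι → ℕ} (ha : Comp e a) :
    Comp e fun i => List.replicate (Nat.size (a i)) 0 := by
  have h : Comp e fun i => enc (a i / 2 ^ Nat.size (a i), List.replicate (Nat.size (a i)) 0) := by
    -- Repeated halving, with one unary mark per round; the quotient first becomes `0` after exactly
    -- `Nat.size (a i)` rounds.
    refine loop (fun i => Nat.size (a i)) (fun i j => enc (a i / 2 ^ j, List.replicate j 0))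
      ((ha.pair (const ([] : List ℕ))).congr_enc fun i => by simp [enc_val]) ?_ ?_ ha.pbdd_nat
      (((PBdd.const 2).add ha.pbdd).add ((PBdd.const 1).add (ha.pbdd_nat.mul (.const 2))))
      fun i j hj => ?_
    · have h := self (e := fun z : {z : ι × ℕ // z.2 ≤ Nat.size (a z.1)} =>
        enc (a z.1.1 / 2 ^ z.1.2, List.replicate z.1.2 0))
      have h := h.congr_enc (g := fun z => (a z.1.1 / 2 ^ z.1.2, List.replicate z.1.2 0))
        fun z => rfl
      refine (h.fst.ite (const 1) (const 0)).congr fun z => ?_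
      have : a z.1.1 / 2 ^ z.1.2 = 0 ↔ ¬ 2 ^ z.1.2 ≤ a z.1.1 := by
        rw [Nat.div_eq_zero_iff]
        simp
      simp only [Nat.lt_size, this, ite_not]
    · have h := self (e := fun z : {z : ι × ℕ // z.2 < Nat.size (a z.1)} =>
        enc (a z.1.1 / 2 ^ z.1.2, List.replicate z.1.2 0))
      have h := h.congr_enc (g := fun z => (a z.1.1 / 2 ^ z.1.2, List.replicate z.1.2 0))
        fun z => rfl
      refine ((h.fst.div (const 2)).pair ((const 0).cons h.snd)).congr_enc fun z => ?_
      rw [enc_val, pow_succ, Nat.div_div_eq_div_mul, List.replicate_succ]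
    · have h1 := size_enc_list_le (l := List.replicate j 0) (B := 1) fun x hx => by
        rw [(List.mem_replicate.1 hx).2]; rfl
      have h2 := Nat.size_le_size (Nat.div_le_self (a i) (2 ^ j))
      rw [List.length_replicate] at h1
      rw [size_enc_prod, size_enc_nat, size_enc_nat]
      have h3 : j * (1 + 1) ≤ Nat.size (a i) * 2 := Nat.mul_le_mul hj le_rfl
      omega
  exact (h.congr_enc (g := fun i => (a i / 2 ^ Nat.size (a i), List.replicate (Nat.size (a i)) 0))
    fun i => rfl).snd

end Comp

/-! ### Output distribution and expected time of rejection sampling -/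

namespace Lists

variable {P D : Prog} {x x' : Val}

theorem seq_of_exec {κ : Type} {code : κ → List Bool} {y : κ → Val} {t : κ → ℕ} {t₀ : ℕ}
    (h : Lists P x' code y t) (hD : Exec D x [] x' t₀) :
    Lists (.seq D P) x code y fun i => 1 + t₀ + t i :=
  ⟨h.inj, fun i => hD.seq (h.exec i), h.complete⟩

variable {l : List ℕ}
  {t : List (Fin (2 ^ Nat.size l.sum - l.sum)) × Fin l.sum → ℕ}

theorem pow_length_blockCode (s p : ℕ) (z : List (Fin (2 ^ s - p)) × Fin p) :
    (2⁻¹ : ℝ≥0∞) ^ (blockCode s p z).length = (2⁻¹ ^ s) ^ z.1.length * 2⁻¹ ^ s := by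
  rw [length_blockCode, pow_add, pow_mul]

theorem rejection_prob {s p : ℕ} (hp : p ≤ 2 ^ s) :
    1 - ((2 ^ s - p : ℕ) : ℝ≥0∞) * 2⁻¹ ^ s = p * 2⁻¹ ^ s := by
  have h : ((2 ^ s - p : ℕ) : ℝ≥0∞) * 2⁻¹ ^ s + p * 2⁻¹ ^ s = 1 := by
    rw [← add_mul, ← Nat.cast_add, Nat.sub_add_cancel hp, Nat.cast_pow, Nat.cast_ofNat, ← mul_pow,
      ENNReal.mul_inv_cancel (by simp) (by simp), one_pow]
  rw [← h]
  refine ENNReal.add_sub_cancel_left (ne_top_of_le_ne_top ENNReal.one_ne_top ?_)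
  rw [← h]
  exact le_self_add

/-- The geometric series over the rejected blocks turns `c * 2⁻¹ ^ s`, the probability that one
block falls among `c` given accepted values, into `c / p`. -/
theorem tsum_blocks {s p : ℕ} (hp : p ≤ 2 ^ s) (c : ℝ≥0∞) :
    ∑' l : List (Fin (2 ^ s - p)), (2⁻¹ ^ s) ^ l.length * (2⁻¹ ^ s * c) = c / p := by
  rw [tsum_list_length _ fun j => (2⁻¹ ^ s) ^ j * (2⁻¹ ^ s * c)]
  simp only [← mul_assoc, ← mul_pow]
  rw [ENNReal.tsum_mul_right, ENNReal.tsum_mul_right, ENNReal.tsum_geometric, rejection_prob hp]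
  have h1 : (2⁻¹ : ℝ≥0∞) ^ s ≠ 0 := by simp
  have h2 : (2⁻¹ : ℝ≥0∞) ^ s ≠ ∞ := by simp
  rw [ENNReal.mul_inv (Or.inr h2) (Or.inr h1), mul_assoc (_⁻¹) (_⁻¹), ENNReal.inv_mul_cancel h1 h2,
    mul_one, mul_comm, ENNReal.div_eq_inv_mul, mul_comm]

theorem le_two_pow_size (p : ℕ) : p ≤ 2 ^ Nat.size p := (Nat.lt_size_self p).le

theorem blocks_outProb (h : Lists P x (blockCode (Nat.size l.sum) l.sum)
    (fun z => .num (locate l z.2)) t) (u : ℕ) :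
    P.outProb x (.num u) = (l.getD u 0 : ℕ) / (l.sum : ℕ) := by
  rw [h.outProb_eq, ENNReal.tsum_prod', ← tsum_blocks (le_two_pow_size _)]
  refine tsum_congr fun b => ?_
  simp only [pow_length_blockCode, tsum_fintype, Val.num.injEq]
  rw [← sum_locate, ← Fin.sum_univ_eq_sum_range fun g => if locate l g = u then 1 else 0,
    Nat.cast_sum, Finset.mul_sum, Finset.mul_sum]
  refine Finset.sum_congr rfl fun g _ => ?_
  split_ifs <;> simp

theorem blocks_haltProb (hl : 0 < l.sum)
    {y : List (Fin (2 ^ Nat.size l.sum - l.sum)) × Fin l.sum → Val}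
    (h : Lists P x (blockCode (Nat.size l.sum) l.sum) y t) : P.haltProb x = 1 := by
  have h1 : ((l.sum : ℕ) : ℝ≥0∞) / (l.sum : ℕ) = 1 :=
    ENNReal.div_self (by exact_mod_cast hl.ne') (ENNReal.natCast_ne_top _)
  rw [h.haltProb_eq, ENNReal.tsum_prod', ← h1, ← tsum_blocks (le_two_pow_size _)]
  refine tsum_congr fun b => ?_
  simp [pow_length_blockCode, tsum_fintype]
  ring

theorem blocks_expectedTime (hl : 0 < l.sum)
    {y : List (Fin (2 ^ Nat.size l.sum - l.sum)) × Fin l.sum → Val}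
    (h : Lists P x (blockCode (Nat.size l.sum) l.sum) y t) {T : ℕ}
    (hT : ∀ z, t z ≤ (z.1.length + 1) * T) :
    P.expectedTime x ≤ (∑' j : ℕ, ((j : ℝ≥0∞) + 1) * 2⁻¹ ^ j) * T := by
  rw [h.expectedTime_eq (h.blocks_haltProb hl), ENNReal.tsum_prod']
  set s := Nat.size l.sum with hs
  have h1 : ((l.sum : ℕ) : ℝ≥0∞) * 2⁻¹ ^ s ≤ 1 := by
    rw [← rejection_prob (le_two_pow_size _)]
    exact tsub_le_self
  have h2 : ((2 ^ s - l.sum : ℕ) : ℝ≥0∞) * 2⁻¹ ^ s ≤ 2⁻¹ := by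
    -- As `s` is the exact bit length of `l.sum`, at least half of the blocks are accepted.
    have h3 : 2 ^ (s - 1) ≤ l.sum := Nat.lt_size.1 (by have := Nat.size_pos.2 hl; omega)
    have h4 : s = s - 1 + 1 := by have := Nat.size_pos.2 hl; omega
    have h5 : 2 ^ s - l.sum ≤ 2 ^ (s - 1) := by
      have h6 : 2 ^ s = 2 ^ (s - 1) * 2 := by rw [← pow_succ, ← h4]
      omega
    calc ((2 ^ s - l.sum : ℕ) : ℝ≥0∞) * 2⁻¹ ^ s ≤ ((2 ^ (s - 1) : ℕ) : ℝ≥0∞) * 2⁻¹ ^ s := by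
          gcongr
      _ = 2⁻¹ := by
          rw [h4, pow_succ, ← h4, ← mul_assoc]
          push_cast
          rw [← mul_pow, ENNReal.mul_inv_cancel (by simp) (by simp), one_pow, one_mul]
  calc _ ≤ ∑' b : List (Fin (2 ^ s - l.sum)),
      (2⁻¹ ^ s) ^ b.length * ((b.length + 1) * T : ℝ≥0∞) := by
        refine ENNReal.tsum_le_tsum fun b => ?_
        rw [tsum_fintype]
        refine (Finset.sum_le_card_nsmul _ _
          ((2⁻¹ ^ s) ^ b.length * 2⁻¹ ^ s * ((b.length + 1) * T : ℝ≥0∞)) fun g _ => ?_).trans ?_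
        · rw [pow_length_blockCode]
          gcongr
          exact_mod_cast hT (b, g)
        · rw [Finset.card_univ, Fintype.card_fin, nsmul_eq_mul]
          calc _ = (((l.sum : ℕ) : ℝ≥0∞) * 2⁻¹ ^ s) *
                ((2⁻¹ ^ s) ^ b.length * ((b.length + 1) * T : ℝ≥0∞)) := by ring
            _ ≤ 1 * ((2⁻¹ ^ s) ^ b.length * ((b.length + 1) * T : ℝ≥0∞)) := by gcongr
            _ = _ := one_mul _
    _ = ∑' j : ℕ, (((2 ^ s - l.sum : ℕ) : ℝ≥0∞) * 2⁻¹ ^ s) ^ j * ((j + 1) * T : ℝ≥0∞) := by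
        rw [tsum_list_length _ fun j => (2⁻¹ ^ s) ^ j * ((j + 1) * T : ℝ≥0∞)]
        simp only [mul_pow, mul_assoc]
    _ ≤ ∑' j : ℕ, (2⁻¹ : ℝ≥0∞) ^ j * ((j + 1) * T : ℝ≥0∞) := by
        gcongr
    _ = _ := by
        rw [← ENNReal.tsum_mul_right]
        exact tsum_congr fun j => by ring

end Lists

/-! ## The sampler -/

/-- A program that replaces the first component of its argument, a number, by a number with `s`
random binary digits, where `s` is the length of the list in the third component. -/
theorem exists_draw : ∃ (P : Prog) (q : Polynomial ℕ), ∀ (x : ℕ × ℕ × List ℕ × List ℕ)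
    (b : List Bool), b.length = x.2.2.1.length → ∃ t, t ≤ q.eval (enc x).size ∧
      Exec P (enc x) b (enc (bitsVal b, x.2)) t := by
  obtain ⟨I, pI, hI⟩ : Comp (fun x : ℕ × ℕ × List ℕ × List ℕ => enc x)
      fun x => (x.2.2.1, 0, x.2) :=
    have h : Comp (fun x : ℕ × ℕ × List ℕ × List ℕ => enc x) fun x => x := Comp.self
    h.snd.snd.fst.pair ((Comp.const 0).pair h.snd)
  obtain ⟨C, pC, hC⟩ : Comp (fun x : List ℕ × ℕ × ℕ × List ℕ × List ℕ => enc x)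
      fun x => if x.1 = [] then (0 : ℕ) else 1 := by
    have h : Comp (fun x : List ℕ × ℕ × ℕ × List ℕ × List ℕ => enc x) fun x => x := Comp.self
    refine ((h.fst.congr_enc (g := fun x => enc x.1) fun _ => rfl).isPair).congr fun x => ?_
    rcases x with ⟨_ | ⟨_, _⟩, _⟩ <;> rfl
  obtain ⟨U, pU, hU⟩ : Comp
      (fun z : ((ℕ × List ℕ) × ℕ × ℕ × List ℕ × List ℕ) × ℕ =>
        enc ((z.1.1.1 :: z.1.1.2, z.1.2), z.2))
      fun z => (z.1.1.2, 2 * z.1.2.1 + z.2, z.1.2.2) := by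
    have h : Comp (fun z : ((ℕ × List ℕ) × ℕ × ℕ × List ℕ × List ℕ) × ℕ =>
        enc ((z.1.1.1 :: z.1.1.2, z.1.2), z.2)) fun z => z := Comp.self.congr_enc fun _ => rfl
    exact h.fst.fst.snd.pair ((((Comp.const 2).mul h.fst.snd.fst).add h.snd).pair h.fst.snd.snd)
  obtain ⟨S, pS, hS⟩ : Comp (fun x : List ℕ × ℕ × ℕ × List ℕ × List ℕ => enc x)
      fun x => x.2 :=
    (Comp.self (e := fun x : List ℕ × ℕ × ℕ × List ℕ × List ℕ => enc x)).congr_enc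
      (g := fun x => x) (fun _ => rfl) |>.snd
  -- In each round `us` loses an entry while `r` gains at most one bit, so `m + us.length` is
  -- constant and one `M` bounds all states.
  have loop : ∀ (b : List Bool) (us : List ℕ) (r m M : ℕ) (y : ℕ × List ℕ × List ℕ),
      b.length = us.length → r < 2 ^ m →
      (enc us).size + (m + us.length) + (enc y).size + 3 ≤ M → ∃ t,
        t ≤ (b.length + 1) * (5 + 4 * M + pC.eval M + pU.eval (4 + M)) ∧
        Exec (.loop C (.seq (.pair (.prim .nop) .flip) U)) (enc (us, r, y)) b
          (enc (([] : List ℕ), b.foldl (fun r c => 2 * r + c.toNat) r, y)) t := by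
    intro b
    induction b with
    | nil =>
      intro us r m M y hb hr hM
      obtain rfl := List.length_eq_zero_iff.1 hb.symm
      obtain ⟨t, ht, h⟩ := hC ([], r, y)
      have h1 : (enc (([] : List ℕ), r, y)).size ≤ M := by
        rw [size_enc_prod, size_enc_prod, size_enc_nat]
        have := Nat.size_le.2 hr
        simp only [List.length_nil] at hM
        omega
      have h2 := eval_mono pC h1
      dsimp only at ht h
      rw [if_pos rfl] at h
      refine ⟨_, ?_, .loop_done h⟩
      simp only [List.length_nil, zero_add, one_mul]
      omega
    | cons c b ih =>
      intro us r m M y hb hr hM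
      rcases us with _ | ⟨u, us⟩
      · simp at hb
      rw [size_enc_cons, List.length_cons] at hM
      obtain ⟨t, ht, h⟩ := hC (u :: us, r, y)
      dsimp only at ht h
      rw [if_neg (by simp)] at h
      obtain ⟨t', ht', h'⟩ := hU (((u, us), r, y), c.toNat)
      have hc : c.toNat ≤ 1 := by cases c <;> simp
      obtain ⟨t'', ht'', h''⟩ := ih us (2 * r + c.toNat) (m + 1) M y (by simpa using hb)
        (by rw [pow_succ]; omega) (by omega)
      have h1 : (enc (u :: us, r, y)).size ≤ M := by
        rw [size_enc_prod, size_enc_prod, size_enc_cons, size_enc_nat r]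
        have := Nat.size_le.2 hr
        omega
      have h2 : (enc ((u :: us, r, y), c.toNat)).size ≤ 4 + M := by
        rw [size_enc_prod, size_enc_nat]
        have := natSize_le c.toNat
        omega
      have h3 := eval_mono pC h1
      have h4 := eval_mono pU h2
      have hn := Exec.prim .nop (enc (u :: us, r, y))
      rw [show Prim.nop.eval (enc (u :: us, r, y)) = enc (u :: us, r, y) from rfl] at hn
      refine ⟨_, ?_, .loop_step h (by simp [enc_nat])
        (.seq (.pair hn (.flip c _)) h') h''⟩
      simp only [Prim.cost, List.length_cons, add_mul (b.length + 1), one_mul]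
      dsimp only at ht'
      omega
  refine ⟨I.seq ((Prog.loop C (.seq (.pair (.prim .nop) .flip) U)).seq S),
    2 + pI + (.X + 1) * (5 + 4 * (6 + 4 * .X) + pC.comp (6 + 4 * .X) +
      pU.comp (4 + (6 + 4 * .X))) + pS.comp (6 + 4 * .X), fun x b hb => ?_⟩
  obtain ⟨r, p, us, l⟩ := x
  obtain ⟨t, ht, h⟩ := hI (r, p, us, l)
  have h0 : (enc (r, p, us, l)).size =
      1 + (1 + Nat.size r) + (1 + (1 + Nat.size p) + (1 + (enc us).size + (enc l).size)) := rfl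
  have h1 := length_lt_size_enc us
  dsimp only at hb ht
  obtain ⟨t', ht', h'⟩ := loop b us 0 0 (6 + 4 * (enc (r, p, us, l)).size) (p, us, l) hb
    (by simp) (by
      rw [show (enc (p, us, l)).size = 1 + (1 + Nat.size p) + (1 + (enc us).size + (enc l).size)
        from rfl]
      omega)
  obtain ⟨t'', ht'', h''⟩ := hS ([], bitsVal b, p, us, l)
  refine ⟨_, ?_, by simpa using h.seq (h'.seq h'')⟩
  have h2 : (enc (([] : List ℕ), bitsVal b, p, us, l)).size ≤ 6 + 4 * (enc (r, p, us, l)).size := by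
    have h3 := Nat.size_le.2 (bitsVal_lt b)
    rw [size_enc_prod, size_enc_prod, size_enc_nat (bitsVal b), size_enc_nil,
      show (enc (p, us, l)).size = 1 + (1 + Nat.size p) + (1 + (enc us).size +
          (enc l).size) from rfl]
    omega
  have h3 := eval_mono pS h2
  simp only [Polynomial.eval_add, Polynomial.eval_mul, Polynomial.eval_comp, Polynomial.eval_X,
    Polynomial.eval_one, Polynomial.eval_ofNat]
  have h4 : t' ≤ _ := ht'.trans (Nat.mul_le_mul_right _
    (show b.length + 1 ≤ (enc (r, p, us, l)).size + 1 by omega))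
  dsimp only at ht''
  omega

/-- A program that returns each index of a list of numbers with a probability proportional to its
entry. -/
theorem exists_sampler : ∃ (P : Prog) (q : Polynomial ℕ), ∀ l : List ℕ, 0 < l.sum → ∃ t,
    Lists P (enc l) (blockCode (Nat.size l.sum) l.sum) (fun z => .num (locate l z.2)) t ∧
    ∀ z, t z ≤ (z.1.length + 1) * q.eval (enc l).size := by
  obtain ⟨I, pI, hI⟩ : Comp (fun l : List ℕ => enc l)
      -- The first component is the current value. It starts at `l.sum`, itself a rejected value, so
      -- a block is always drawn.
      fun l => (l.sum, l.sum, List.replicate (Nat.size l.sum) 0, l) :=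
    have h : Comp (fun l : List ℕ => enc l) fun l => l := Comp.self
    h.sum.pair (h.sum.pair (h.sum.replicate_size.pair h))
  -- With truncated subtraction this test is `0` exactly when the value is below `l.sum`, that is,
  -- accepted.
  obtain ⟨C, pC, hC⟩ : Comp (fun x : ℕ × ℕ × List ℕ × List ℕ => enc x) fun x => x.1 + 1 - x.2.1 :=
    have h : Comp (fun x : ℕ × ℕ × List ℕ × List ℕ => enc x) fun x => x := Comp.self
    (h.fst.add (Comp.const 1)).sub h.snd.fst
  obtain ⟨F, pF, hF⟩ : Comp (fun x : ℕ × ℕ × List ℕ × List ℕ => enc x)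
      fun x => locate x.2.2.2 x.1 :=
    have h : Comp (fun x : ℕ × ℕ × List ℕ × List ℕ => enc x) fun x => x := Comp.self
    h.snd.snd.snd.locate h.fst
  obtain ⟨B, pB, hB⟩ := exists_draw
  dsimp only at hI hC hF
  have size_state : ∀ (l : List ℕ) (r : ℕ), r < 2 ^ Nat.size l.sum →
      (enc (r, l.sum, List.replicate (Nat.size l.sum) 0, l)).size ≤ 4 + 6 * (enc l).size := by
    intro l r hr
    have h1 := size_enc_sum_le l
    have h2 := size_enc_list_le (l := List.replicate (Nat.size l.sum) 0) (B := 1) fun x hx => by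
      rw [(List.mem_replicate.1 hx).2]; rfl
    have h3 := Nat.size_le.2 hr
    rw [List.length_replicate] at h2
    rw [size_enc_nat] at h1
    rw [size_enc_prod, size_enc_prod, size_enc_prod, size_enc_nat, size_enc_nat]
    omega
  have loop : ∀ (l : List ℕ) (b : List (Fin (2 ^ Nat.size l.sum - l.sum))) (g : Fin l.sum) (r : ℕ),
      l.sum ≤ r → r < 2 ^ Nat.size l.sum → ∃ t,
        t ≤ (b.length + 1) * (2 + 2 * (4 + 6 * (enc l).size) + 2 * pC.eval (4 + 6 * (enc l).size) +
          pB.eval (4 + 6 * (enc l).size)) ∧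
        Exec (.loop C B) (enc (r, l.sum, List.replicate (Nat.size l.sum) 0, l))
          (blockCode (Nat.size l.sum) l.sum (b, g))
          (enc ((g : ℕ), l.sum, List.replicate (Nat.size l.sum) 0, l)) t := by
    intro l b g
    have hle := Lists.le_two_pow_size l.sum
    have step : ∀ r i : ℕ, l.sum ≤ r → r < 2 ^ Nat.size l.sum → i < 2 ^ Nat.size l.sum →
        ∀ (c : List Bool) (z : Val) (t : ℕ),
        Exec (.loop C B) (enc (i, l.sum, List.replicate (Nat.size l.sum) 0, l)) c z t → ∃ t',
        t' ≤ 1 + (4 + 6 * (enc l).size) + pC.eval (4 + 6 * (enc l).size) +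
          pB.eval (4 + 6 * (enc l).size) + t ∧
        Exec (.loop C B) (enc (r, l.sum, List.replicate (Nat.size l.sum) 0, l))
          (bitsOf (Nat.size l.sum) i ++ c) z t' := by
      intro r i hr hr' hi c z t ht
      obtain ⟨t₁, ht₁, h₁⟩ := hC (r, l.sum, List.replicate (Nat.size l.sum) 0, l)
      obtain ⟨t₂, ht₂, h₂⟩ := hB (r, l.sum, List.replicate (Nat.size l.sum) 0, l)
        (bitsOf (Nat.size l.sum) i) (by simp [length_bitsOf])
      rw [bitsVal_bitsOf hi] at h₂
      have h3 := size_state l r hr'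
      have h4 := eval_mono pC h3
      have h5 := eval_mono pB h3
      exact ⟨_, by omega, .loop_step h₁ (by simp only [enc_nat, ne_eq, Val.num.injEq]; omega) h₂ ht⟩
    induction b with
    | nil =>
      intro r hr hr'
      obtain ⟨t₁, ht₁, h₁⟩ := hC ((g : ℕ), l.sum, List.replicate (Nat.size l.sum) 0, l)
      rw [show (g : ℕ) + 1 - l.sum = 0 by omega] at h₁
      have h3 := size_state l g (by omega)
      have h4 := eval_mono pC h3
      obtain ⟨t, ht, h⟩ := step r g hr hr' (by omega) _ _ _ (.loop_done h₁)
      refine ⟨t, ?_, by simpa [blockCode] using h⟩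
      simp only [List.length_nil, zero_add, one_mul]
      omega
    | cons i b ih =>
      intro r hr hr'
      obtain ⟨t₁, ht₁, h₁⟩ := ih (l.sum + i) (by omega) (by omega)
      obtain ⟨t, ht, h⟩ := step r (l.sum + i) hr hr' (by omega) _ _ _ h₁
      refine ⟨t, ?_, by rwa [blockCode_cons]⟩
      rw [List.length_cons, add_mul (b.length + 1)]
      omega
  refine ⟨I.seq ((Prog.loop C B).seq F), 2 + pI + pF.comp (4 + 6 * .X) + (2 + 2 * (4 + 6 * .X) +
    2 * pC.comp (4 + 6 * .X) + pB.comp (4 + 6 * .X)), fun l hl => ?_⟩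
  have exec : ∀ z : List (Fin (2 ^ Nat.size l.sum - l.sum)) × Fin l.sum, ∃ t,
      t ≤ (z.1.length + 1) * (2 + pI.eval (enc l).size + pF.eval (4 + 6 * (enc l).size) +
        (2 + 2 * (4 + 6 * (enc l).size) + 2 * pC.eval (4 + 6 * (enc l).size) +
          pB.eval (4 + 6 * (enc l).size))) ∧
      Exec (I.seq ((Prog.loop C B).seq F)) (enc l) (blockCode (Nat.size l.sum) l.sum z)
        (.num (locate l z.2)) t := by
    rintro ⟨b, g⟩
    obtain ⟨t₁, ht₁, h₁⟩ := hI l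
    obtain ⟨t₂, ht₂, h₂⟩ := loop l b g l.sum le_rfl (Nat.lt_size_self _)
    obtain ⟨t₃, ht₃, h₃⟩ := hF ((g : ℕ), l.sum, List.replicate (Nat.size l.sum) 0, l)
    have h4 := eval_mono pF (size_state l g (by have := Lists.le_two_pow_size l.sum; omega))
    refine ⟨_, ?_, by simpa [enc_nat] using h₁.seq (h₂.seq h₃)⟩
    have h5 := Nat.le_mul_of_pos_left
      (2 + pI.eval (enc l).size + pF.eval (4 + 6 * (enc l).size)) (Nat.succ_pos b.length)
    rw [mul_add]
    dsimp only
    rw [Nat.succ_eq_add_one] at h5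
    omega
  choose t ht h using exec
  refine ⟨t, ⟨blockCode_injective (Lists.le_two_pow_size _), h,
    exists_blockCode_prefix hl (Nat.size_pos.2 hl)⟩, fun z => (ht z).trans (le_of_eq ?_)⟩
  simp only [Polynomial.eval_add, Polynomial.eval_mul, Polynomial.eval_comp, Polynomial.eval_X,
    Polynomial.eval_ofNat]

/-! # Dynamic programming on transition tables -/

/-- The minimum of a nonempty list. -/
def listMin (l : List ℕ) : ℕ := l.foldl min (l.getD 0 0)

theorem foldl_min_spec (l : List ℕ) (a : ℕ) :
    l.foldl min a ≤ a ∧ (∀ x ∈ l, l.foldl min a ≤ x) ∧ (l.foldl min a = a ∨ l.foldl min a ∈ l) := by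
  induction l generalizing a with
  | nil => simp
  | cons y l ih =>
    obtain ⟨h1, h2, h3⟩ := ih (min a y)
    rw [List.foldl_cons]
    refine ⟨h1.trans (min_le_left _ _), fun x hx => ?_, ?_⟩
    · rcases List.mem_cons.1 hx with rfl | hx
      exacts [h1.trans (min_le_right _ _), h2 x hx]
    · rcases h3 with h3 | h3
      · rw [h3]
        rcases min_choice a y with h | h
        · exact Or.inl h
        · right; rw [h]; simp
      · exact Or.inr (List.mem_cons_of_mem _ h3)

theorem listMin_ofFn {k : ℕ} (hk : 0 < k) (f : Fin k → ℕ) : listMin (List.ofFn f) = ⨅ u, f u := by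
  have : Nonempty (Fin k) := ⟨⟨0, hk⟩⟩
  obtain ⟨-, h2, h3⟩ := foldl_min_spec (List.ofFn f) ((List.ofFn f).getD 0 0)
  refine le_antisymm (le_ciInf fun u => h2 _ ((List.mem_ofFn' _ _).2 ⟨u, rfl⟩)) ?_
  have h4 : listMin (List.ofFn f) ∈ List.ofFn f := by
    rcases h3 with h3 | h3
    · unfold listMin
      rw [h3, List.getD_eq_getElem _ _ (by simpa using hk)]
      exact List.getElem_mem _
    · exact h3
  obtain ⟨u, hu⟩ := (List.mem_ofFn' _ _).1 h4
  rw [← hu]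
  exact ciInf_le (OrderBot.bddBelow _) u

/-- The entries of the table `lev` at the successors of the pair of states `q`, `q'`. -/
def childWidths (A B : List (ℕ × List ℕ)) (lev : List (List (ℕ × ℕ))) (q q' : ℕ) : List (ℕ × ℕ) :=
  (List.range (A.getD q (0, [])).2.length).map fun u =>
    (lev.getD ((A.getD q (0, [])).2.getD u 0) []).getD ((B.getD q' (0, [])).2.getD u 0) (0, 0)

/-- The table of the widths at the end of the game. -/
def lastLevel (A B : List (ℕ × List ℕ)) : List (List (ℕ × ℕ)) :=
  A.map fun r => B.map fun r' => (r.1, r.1 * r'.1)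

/-- The table of the widths after `i` moves, from the one after `i + 1` moves. -/
def prevLevel (A B : List (ℕ × List ℕ)) (i : ℕ) (lev : List (List (ℕ × ℕ))) :
    List (List (ℕ × ℕ)) :=
  (List.range A.length).map fun q => (List.range B.length).map fun q' =>
    if Odd i then
      (listMin ((childWidths A B lev q q').map Prod.fst),
        listMin ((childWidths A B lev q q').map Prod.snd))
    else (((childWidths A B lev q q').map Prod.fst).sum,
        ((childWidths A B lev q q').map Prod.snd).sum)

/-- The tables of the widths after `0, …, n` moves, where `l` has length `n`. -/
def levels (A B : List (ℕ × List ℕ)) (l : List ℕ) : ℕ × List (List (List (ℕ × ℕ))) :=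
  l.foldl (fun z _ => (z.1 - 1, prevLevel A B (z.1 - 1) (z.2.getD 0 []) :: z.2))
    (l.length, [lastLevel A B])

/-! ### Correctness and size of the tables -/

section Semantics

variable {k mA mB : ℕ} (D : DFA (Fin k) (Fin mA)) (E : DFA (Fin k) (Fin mB))

open Classical in
/-- The transition table of an automaton. -/
noncomputable def rows {m : ℕ} (D : DFA (Fin k) (Fin m)) : List (ℕ × List ℕ) :=
  List.ofFn fun v => (if v ∈ D.accept then 1 else 0, List.ofFn fun u => (D.step v u : ℕ))

/-- The table of the widths after `i` moves. -/
noncomputable def level (n i : ℕ) : List (List (ℕ × ℕ)) :=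
  List.ofFn fun q => List.ofFn fun q' => (dpWidth D n q i, dpWidth (D.inter E) n (q, q') i)

theorem map_range_eq_ofFn {β : Type*} (m : ℕ) (f : ℕ → β) :
    (List.range m).map f = List.ofFn fun u : Fin m => f u :=
  List.ext_getElem (by simp) fun i _ _ => by simp

open Classical in
theorem getD_rows {m : ℕ} (D : DFA (Fin k) (Fin m)) (q : Fin m) : (rows D).getD q (0, []) =
    (if q ∈ D.accept then 1 else 0, List.ofFn fun u => (D.step q u : ℕ)) := by
  rw [rows, getD_ofFn]

theorem childWidths_rows (n i : ℕ) (q : Fin mA) (q' : Fin mB) :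
    childWidths (rows D) (rows E) (level D E n i) q q' = List.ofFn fun u =>
      (dpWidth D n (D.step q u) i, dpWidth (D.inter E) n (D.step q u, E.step q' u) i) := by
  rw [childWidths, getD_rows, getD_rows, map_range_eq_ofFn]
  dsimp only
  refine List.ext_getElem (by simp) fun j h1 h2 => ?_
  have hj : j < k := by simpa using h2
  have h3 := getD_ofFn (fun u => (D.step q u : ℕ)) ⟨j, hj⟩ 0
  have h4 := getD_ofFn (fun u => (E.step q' u : ℕ)) ⟨j, hj⟩ 0
  dsimp only at h3 h4
  rw [List.getElem_ofFn, List.getElem_ofFn]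
  dsimp only
  rw [h3, h4, level, getD_ofFn, getD_ofFn]

theorem lastLevel_rows (n : ℕ) : lastLevel (rows D) (rows E) = level D E n n := by
  rw [lastLevel, rows.eq_def D, List.map_ofFn, level]
  refine congrArg List.ofFn (funext fun q => ?_)
  rw [Function.comp, rows, List.map_ofFn]
  refine congrArg List.ofFn (funext fun q' => ?_)
  simp only [Function.comp, dpWidth_end, DFA.inter]
  by_cases h1 : q ∈ D.accept <;> by_cases h2 : q' ∈ E.accept <;> simp [h1, h2]

theorem prevLevel_rows (hk : 0 < k) {n i : ℕ} (hi : i < n) :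
    prevLevel (rows D) (rows E) i (level D E n (i + 1)) = level D E n i := by
  have h1 : (rows D).length = mA := by simp [rows]
  have h2 : (rows E).length = mB := by simp [rows]
  rw [prevLevel, h1, h2, map_range_eq_ofFn]
  conv_rhs => rw [level]
  refine congrArg List.ofFn (funext fun q => ?_)
  rw [map_range_eq_ofFn]
  refine congrArg List.ofFn (funext fun q' => ?_)
  rw [childWidths_rows, List.map_ofFn, List.map_ofFn]
  split_ifs with h
  · rw [← Nat.not_even_iff_odd] at h
    rw [dpWidth_odd D hi h, dpWidth_odd (D.inter E) hi h, listMin_ofFn hk, listMin_ofFn hk]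
    rfl
  · rw [Nat.not_odd_iff_even] at h
    rw [dpWidth_even D hi h, dpWidth_even (D.inter E) hi h, List.sum_ofFn, List.sum_ofFn]
    rfl

/-- The state after `j` rounds, and not just after `n`, is described because the size bound in
`comp_tables` concerns every prefix of the fold. -/
theorem foldl_levels (hk : 0 < k) {n j : ℕ} (hj : j ≤ n) :
    (List.replicate j 0).foldl (fun (z : ℕ × List (List (List (ℕ × ℕ)))) _ => (z.1 - 1,
      prevLevel (rows D) (rows E) (z.1 - 1) (z.2.getD 0 []) :: z.2))
      (n, [lastLevel (rows D) (rows E)]) =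
    (n - j, (List.range (j + 1)).map fun t => level D E n (n - j + t)) := by
  induction j with
  | zero => simp [lastLevel_rows D E n]
  | succ j ih =>
    obtain ⟨m, hm⟩ : ∃ m, n - j = m + 1 := ⟨n - j - 1, by omega⟩
    rw [List.replicate_succ', List.foldl_append, ih (by omega), hm, show n - (j + 1) = m by omega,
      List.range_succ_eq_map (n := j + 1)]
    simp only [List.foldl_cons, List.foldl_nil, List.map_cons, List.map_map]
    rw [List.range_succ_eq_map (n := j), List.map_cons, List.getD_cons_zero, add_zero,
      Nat.add_sub_cancel, prevLevel_rows D E hk (by omega)]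
    simp only [List.map_cons, List.map_map, add_zero]
    congr 4
    funext t
    simp only [Function.comp]
    congr 1
    omega

theorem levels_rows (hk : 0 < k) (n : ℕ) : levels (rows D) (rows E) (List.replicate n 0) =
    (0, (List.range (n + 1)).map (level D E n)) := by
  rw [levels, List.length_replicate, foldl_levels D E hk le_rfl]
  simp

theorem dpWidth_le {V : Type*} (D : DFA (Fin k) V) {n i : ℕ} (hk : 0 < k) (hi : i ≤ n) (v : V) :
    dpWidth D n v i ≤ k ^ (n - i) := by
  induction hi using Nat.decreasingInduction generalizing v with
  | self =>
    rw [dpWidth_end]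
    split_ifs <;> simp
  | of_succ i hi ih =>
    have h1 : n - i = n - (i + 1) + 1 := by omega
    by_cases h : Even i
    · rw [dpWidth_even D hi h, h1, pow_succ']
      refine (Finset.sum_le_sum fun u _ => ih _).trans ?_
      simp
    · refine (dpWidth_odd_le D hi h v ⟨0, hk⟩).trans ((ih _).trans ?_)
      exact Nat.pow_le_pow_right hk (by omega)

/-- Widths can be as large as `k ^ n`, but this many bits are polynomial in the size of the
instance, where `n` is unary. -/
theorem natSize_dpWidth_le {V : Type*} (D : DFA (Fin k) V) {n i : ℕ} (hk : 0 < k) (hi : i ≤ n)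
    (v : V) : Nat.size (dpWidth D n v i) ≤ n * Nat.size k + 1 := by
  rw [Nat.size_le]
  calc dpWidth D n v i ≤ k ^ (n - i) := dpWidth_le D hk hi v
    _ ≤ k ^ n := Nat.pow_le_pow_right hk (by omega)
    _ ≤ (2 ^ Nat.size k) ^ n := Nat.pow_le_pow_left (Nat.lt_size_self k).le n
    _ = 2 ^ (n * Nat.size k) := by rw [← pow_mul, mul_comm]
    _ < 2 ^ (n * Nat.size k + 1) := Nat.pow_lt_pow_right (by norm_num) (by omega)

theorem size_level_le (hk : 0 < k) {n i : ℕ} (hi : i ≤ n) : (enc (level D E n i)).size ≤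
    1 + mA * (1 + (1 + mB * (1 + (5 + 2 * (n * Nat.size k))))) := by
  refine (size_enc_list_le (B := 1 + mB * (1 + (5 + 2 * (n * Nat.size k)))) fun x hx => ?_).trans
    (by simp [level])
  obtain ⟨q, rfl⟩ := (List.mem_ofFn' _ _).1 hx
  refine (size_enc_list_le (B := 5 + 2 * (n * Nat.size k)) fun x hx => ?_).trans (by simp)
  obtain ⟨q', rfl⟩ := (List.mem_ofFn' _ _).1 hx
  have h1 := natSize_dpWidth_le D hk hi q
  have h2 := natSize_dpWidth_le (D.inter E) hk hi (q, q')
  rw [size_enc_prod, size_enc_nat, size_enc_nat]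
  omega

end Semantics

/-! ### Polynomial time of splitting budgets and building tables -/

theorem mem_split_le {R a x : ℕ} {ws : List (ℕ × ℕ)} {y : ℕ × ℕ} (hy : y ∈ split R a x ws) :
    y.1 ≤ a ∧ y.2 ≤ x := by
  induction ws generalizing a x with
  | nil => simp [split] at hy
  | cons w ws ih =>
    rw [split, List.mem_cons] at hy
    rcases hy with rfl | hy
    · exact ⟨min_le_left _ _, min_le_left _ _⟩
    · obtain ⟨h1, h2⟩ := ih hy
      exact ⟨h1.trans (Nat.sub_le _ _), h2.trans (Nat.sub_le _ _)⟩

namespace Comp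

variable {ι : Type} {e : ι → Val}

/-- A fold with the unspent amounts and the reversed output as its state. The amounts only decrease
and every share is at most the initial amounts, which bounds the state. -/
theorem split {R a x : ι → ℕ} {ws : ι → List (ℕ × ℕ)} (hR : Comp e R) (ha : Comp e a)
    (hx : Comp e x) (hw : Comp e ws) : Comp e fun i => split (R i) (a i) (x i) (ws i) := by
  have hfold : ∀ (R : ℕ) (l : List (ℕ × ℕ)) (a x : ℕ) (out : List (ℕ × ℕ)),
      (l.foldl (fun (z : (ℕ × ℕ) × List (ℕ × ℕ)) w =>
        ((z.1.1 - Min.min z.1.1 (R * w.2),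
          z.1.2 - Min.min z.1.2 (R * w.1 - Min.min z.1.1 (R * w.2))),
          (Min.min z.1.1 (R * w.2), Min.min z.1.2 (R * w.1 - Min.min z.1.1 (R * w.2))) :: z.2))
        ((a, x), out)).2 = (RCI.split R a x l).reverse ++ out ∧
      (l.foldl (fun (z : (ℕ × ℕ) × List (ℕ × ℕ)) w =>
        ((z.1.1 - Min.min z.1.1 (R * w.2),
          z.1.2 - Min.min z.1.2 (R * w.1 - Min.min z.1.1 (R * w.2))),
          (Min.min z.1.1 (R * w.2), Min.min z.1.2 (R * w.1 - Min.min z.1.1 (R * w.2))) :: z.2))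
        ((a, x), out)).1.1 ≤ a ∧
      (l.foldl (fun (z : (ℕ × ℕ) × List (ℕ × ℕ)) w =>
        ((z.1.1 - Min.min z.1.1 (R * w.2),
          z.1.2 - Min.min z.1.2 (R * w.1 - Min.min z.1.1 (R * w.2))),
          (Min.min z.1.1 (R * w.2), Min.min z.1.2 (R * w.1 - Min.min z.1.1 (R * w.2))) :: z.2))
        ((a, x), out)).1.2 ≤ x := by
    intro R l
    induction l with
    | nil => simp [RCI.split]
    | cons w l ih =>
      intro a x out
      simp only [List.foldl_cons, RCI.split, List.reverse_cons, List.append_assoc,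
        List.singleton_append]
      obtain ⟨h1, h2, h3⟩ := ih (a - Min.min a (R * w.2))
        (x - Min.min x (R * w.1 - Min.min a (R * w.2)))
        ((Min.min a (R * w.2), Min.min x (R * w.1 - Min.min a (R * w.2))) :: out)
      exact ⟨h1, h2.trans (Nat.sub_le _ _), h3.trans (Nat.sub_le _ _)⟩
  have hcur : Comp (ext (ext e ((ℕ × ℕ) × List (ℕ × ℕ))) (ℕ × ℕ)) fun z => z.1.2.1 := var.wk.fst
  have hshare := hcur.fst.min (hR.wk.wk.mul var.snd)
  have hrest := hcur.snd.min ((hR.wk.wk.mul var.fst).sub hshare)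
  refine ((foldl (F := fun z : (ι × ((ℕ × ℕ) × List (ℕ × ℕ))) × (ℕ × ℕ) =>
        ((z.1.2.1.1 - Min.min z.1.2.1.1 (R z.1.1 * z.2.2),
          z.1.2.1.2 - Min.min z.1.2.1.2 (R z.1.1 * z.2.1 - Min.min z.1.2.1.1 (R z.1.1 * z.2.2))),
          (Min.min z.1.2.1.1 (R z.1.1 * z.2.2),
            Min.min z.1.2.1.2 (R z.1.1 * z.2.1 - Min.min z.1.2.1.1 (R z.1.1 * z.2.2))) :: z.1.2.2))
    hw ((ha.pair hx).pair (const []))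
    (((hcur.fst.sub hshare).pair (hcur.snd.sub hrest)).pair ((hshare.pair hrest).cons var.wk.snd))
    (B := fun i => 4 + Nat.size (a i) + Nat.size (x i) +
      (1 + (ws i).length * (1 + (3 + Nat.size (a i) + Nat.size (x i)))))
    ((((PBdd.const 4).add ha.pbdd_nat).add hx.pbdd_nat).add ((PBdd.const 1).add
      (hw.pbdd_length.mul ((PBdd.const 1).add (((PBdd.const 3).add ha.pbdd_nat).add hx.pbdd_nat)))))
    fun i l' hl' => ?_).snd.reverse).congr fun i => ?_
  · dsimp only
    obtain ⟨h1, h2, h3⟩ := hfold (R i) l' (a i) (x i) []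
    have h4 := size_enc_list_le (l := RCI.split (R i) (a i) (x i) l')
      (B := 3 + Nat.size (a i) + Nat.size (x i)) fun y hy => by
        obtain ⟨h5, h6⟩ := mem_split_le hy
        have h5 := Nat.size_le_size h5
        have h6 := Nat.size_le_size h6
        rw [size_enc_prod, size_enc_nat, size_enc_nat]
        omega
    rw [length_split] at h4
    have h5 := Nat.mul_le_mul_right (1 + (3 + Nat.size (a i) + Nat.size (x i))) hl'.length_le
    have h6 := Nat.size_le_size h2
    have h7 := Nat.size_le_size h3
    rw [size_enc_prod, h1, List.append_nil, size_enc_reverse, size_enc_prod, size_enc_nat,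
      size_enc_nat]
    have h8 : ∀ u v w : ℕ, u ≤ Nat.size (a i) → v ≤ Nat.size (x i) →
        w ≤ 1 + (ws i).length * (1 + (3 + Nat.size (a i) + Nat.size (x i))) →
        1 + (1 + (1 + u) + (1 + v)) + w ≤ 4 + Nat.size (a i) + Nat.size (x i) +
          (1 + (ws i).length * (1 + (3 + Nat.size (a i) + Nat.size (x i)))) := by omega
    exact h8 _ _ _ h6 h7 (h4.trans (Nat.add_le_add_left h5 1))
  · dsimp only
    rw [(hfold (R i) (ws i) (a i) (x i) []).1, List.append_nil, List.reverse_reverse]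

theorem listMin {l : ι → List ℕ} (hl : Comp e l) : Comp e fun i => listMin (l i) := by
  refine foldl (F := fun z : (ι × ℕ) × ℕ => Min.min z.1.2 z.2) hl (hl.getD (const 0) 0)
    (var.wk.min var) ((PBdd.const 1).add hl.pbdd) fun i l' hl' => ?_
  dsimp only
  have h1 : l'.foldl (fun c x => Min.min c x) ((l i).getD 0 0) ≤ (l i).getD 0 0 :=
    (foldl_min_spec l' ((l i).getD 0 0)).1
  have h2 : Nat.size ((l i).getD 0 0) ≤ (enc (l i)).size := by
    rcases l i with _ | ⟨y, l⟩
    · exact Nat.zero_le _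
    · rw [List.getD_cons_zero, size_enc_cons, size_enc_nat]
      omega
  rw [size_enc_nat]
  exact Nat.add_le_add_left ((Nat.size_le_size h1).trans h2) 1

theorem childWidths {A B : ι → List (ℕ × List ℕ)} {lev : ι → List (List (ℕ × ℕ))} {q q' : ι → ℕ}
    (hA : Comp e A) (hB : Comp e B) (hlev : Comp e lev) (hq : Comp e q) (hq' : Comp e q') :
    Comp e fun i => childWidths (A i) (B i) (lev i) (q i) (q' i) := by
  have h1 : Comp e fun i => ((A i).getD (q i) (0, [])).2 := (hA.getD hq (0, [])).snd
  have h2 : Comp e fun i => ((B i).getD (q' i) (0, [])).2 := (hB.getD hq' (0, [])).snd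
  exact map (F := fun z : ι × ℕ => ((lev z.1).getD (((A z.1).getD (q z.1) (0, [])).2.getD z.2 0)
    []).getD (((B z.1).getD (q' z.1) (0, [])).2.getD z.2 0) (0, 0)) h1.range_length
    ((hlev.wk.getD (h1.wk.getD var 0) []).getD (h2.wk.getD var 0) (0, 0))

theorem lastLevel {A B : ι → List (ℕ × List ℕ)} (hA : Comp e A) (hB : Comp e B) :
    Comp e fun i => lastLevel (A i) (B i) :=
  map (F := fun z : ι × (ℕ × List ℕ) => (B z.1).map fun r' => (z.2.1, z.2.1 * r'.1)) hA
    (map (F := fun z : (ι × (ℕ × List ℕ)) × (ℕ × List ℕ) => (z.1.2.1, z.1.2.1 * z.2.1)) hB.wk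
      (var.wk.fst.pair (var.wk.fst.mul var.fst)))

theorem prevLevel {A B : ι → List (ℕ × List ℕ)} {j : ι → ℕ} {lev : ι → List (List (ℕ × ℕ))}
    (hA : Comp e A) (hB : Comp e B) (hj : Comp e j) (hlev : Comp e lev) :
    Comp e fun i => prevLevel (A i) (B i) (j i) (lev i) := by
  have h : Comp (ext (ext e ℕ) ℕ) fun z =>
      RCI.childWidths (A z.1.1) (B z.1.1) (lev z.1.1) z.1.2 z.2 :=
    hA.wk.wk.childWidths hB.wk.wk hlev.wk.wk var.wk var
  have h1 := map (F := fun z : ((ι × ℕ) × ℕ) × (ℕ × ℕ) => z.2.1) h var.fst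
  have h2 := map (F := fun z : ((ι × ℕ) × ℕ) × (ℕ × ℕ) => z.2.2) h var.snd
  exact map (F := fun z : ι × ℕ => (List.range (B z.1).length).map fun q' =>
      if Odd (j z.1) then
        (RCI.listMin ((RCI.childWidths (A z.1) (B z.1) (lev z.1) z.2 q').map Prod.fst),
          RCI.listMin ((RCI.childWidths (A z.1) (B z.1) (lev z.1) z.2 q').map Prod.snd))
      else (((RCI.childWidths (A z.1) (B z.1) (lev z.1) z.2 q').map Prod.fst).sum,
        ((RCI.childWidths (A z.1) (B z.1) (lev z.1) z.2 q').map Prod.snd).sum)) hA.range_length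
    (map (F := fun z : (ι × ℕ) × ℕ => if Odd (j z.1.1) then
        (RCI.listMin ((RCI.childWidths (A z.1.1) (B z.1.1) (lev z.1.1) z.1.2 z.2).map Prod.fst),
          RCI.listMin ((RCI.childWidths (A z.1.1) (B z.1.1) (lev z.1.1) z.1.2 z.2).map Prod.snd))
      else (((RCI.childWidths (A z.1.1) (B z.1.1) (lev z.1.1) z.1.2 z.2).map Prod.fst).sum,
        ((RCI.childWidths (A z.1.1) (B z.1.1) (lev z.1.1) z.1.2 z.2).map Prod.snd).sum))
      hB.range_length.wk (hj.wk.wk.ite_odd (h1.listMin.pair h2.listMin) (h1.sum.pair h2.sum)))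

end Comp

/-! # Instances given by automata -/

namespace DFAInstance

/-- The hard specification. -/
def hard (C : RCIInstance dfaClass dfaClass) : DFASpec C.k := C.H

/-- The soft specification. -/
def soft (C : RCIInstance dfaClass dfaClass) : DFASpec C.k := C.S

/-- The entries of the representation of an instance. -/
noncomputable def data (C : RCIInstance dfaClass dfaClass) :
    ℕ × (ℕ × List (ℕ × List ℕ)) × (ℕ × List (ℕ × List ℕ)) × List ℕ × (ℕ × ℕ) × (ℕ × ℕ) × ℕ :=
  (C.k, (((hard C).D.start : ℕ), rows (hard C).D), (((soft C).D.start : ℕ), rows (soft C).D),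
    List.replicate C.n 0, (C.ε.num.natAbs, C.ε.den), (C.ρ.num.natAbs, C.ρ.den), 0)

theorem encode_dfa {k : ℕ} (X : DFASpec k) :
    dfaClass.encode X = enc ((X.D.start : ℕ), rows X.D) := by
  simp only [dfaClass, rows, enc_prod]
  refine congrArg₂ Val.pair rfl ?_
  change Val.ofList _ = Val.ofList _
  rw [List.map_ofFn]
  refine congrArg Val.ofList (congrArg List.ofFn (funext fun v => ?_))
  refine congrArg₂ Val.pair rfl ?_
  change Val.ofList _ = Val.ofList _
  rw [List.map_ofFn]
  rfl

/-- This exposes the entries of an instance to the projections of `Comp`. The final `0` of `data` is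
the end of the encoded list. -/
theorem encode_eq (C : RCIInstance dfaClass dfaClass) : C.encode = enc (data C) := by
  have h : Val.unary C.n = enc (List.replicate C.n 0) := by
    change Val.ofList _ = Val.ofList _
    rw [List.map_replicate]
    rfl
  rw [RCIInstance.encode, h, show dfaClass.encode C.H = _ from encode_dfa (hard C),
    show dfaClass.encode C.S = _ from encode_dfa (soft C)]
  rfl

/-- The tables of the widths for an instance. -/
noncomputable def tables (C : RCIInstance dfaClass dfaClass) : List (List (List (ℕ × ℕ))) :=
  (List.range (C.n + 1)).map (level (hard C).D (soft C).D C.n)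

theorem getD_tables (C : RCIInstance dfaClass dfaClass) {i : ℕ} (hi : i ≤ C.n) :
    (tables C).getD i [] = level (hard C).D (soft C).D C.n i := by
  rw [tables, map_range_eq_ofFn]
  exact getD_ofFn (fun u : Fin (C.n + 1) => level (hard C).D (soft C).D C.n u) ⟨i, by omega⟩ []

/-- The budget of the words that extend a history. -/
noncomputable def budget (C : RCIInstance dfaClass dfaClass) : List (Fin C.k) → ℕ × ℕ :=
  RCI.budget (capacity C.ε C.ρ) (widths (hard C).D (soft C).D C.n) (startBudget C.ε C.ρ)

/-- The weights of the symbols after a history. -/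
noncomputable def weights (C : RCIInstance dfaClass dfaClass) : List (Fin C.k) → List ℕ :=
  RCI.weights C.n (capacity C.ε C.ρ) (widths (hard C).D (soft C).D C.n) (startBudget C.ε C.ρ)

/-- The states of the automata after a history, its length and its budget. -/
noncomputable def state (C : RCIInstance dfaClass dfaClass) (h : List (Fin C.k)) :
    (ℕ × ℕ) × ℕ × ℕ × ℕ :=
  ((((hard C).D.eval h : ℕ), ((soft C).D.eval h : ℕ)), h.length, budget C h)

/-- The distribution of the budget in the state `z`. -/
def stateShares (A B : List (ℕ × List ℕ)) (T : List (List (List (ℕ × ℕ)))) (R : ℕ)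
    (z : (ℕ × ℕ) × ℕ × ℕ × ℕ) : List (ℕ × ℕ) :=
  split R z.2.2.1 z.2.2.2 (childWidths A B (T.getD (z.2.1 + 1) []) z.1.1 z.1.2)

/-- The state after the symbol `u`. -/
def nextState (A B : List (ℕ × List ℕ)) (T : List (List (List (ℕ × ℕ)))) (R : ℕ)
    (z : (ℕ × ℕ) × ℕ × ℕ × ℕ) (u : ℕ) : (ℕ × ℕ) × ℕ × ℕ × ℕ :=
  (((A.getD z.1.1 (0, [])).2.getD u 0, (B.getD z.1.2 (0, [])).2.getD u 0), z.2.1 + 1,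
    if Odd z.2.1 then z.2.2 else (stateShares A B T R z).getD u (0, 0))

/-- The widths depend on a history only through the automaton states and the length, so the shares
can be computed from `state`. -/
theorem stateShares_state (C : RCIInstance dfaClass dfaClass) {h : List (Fin C.k)}
    (hh : h.length < C.n) :
    stateShares (rows (hard C).D) (rows (soft C).D) (tables C) (capacity C.ε C.ρ) (state C h) =
      shares (capacity C.ε C.ρ) (widths (hard C).D (soft C).D C.n) h (budget C h) := by
  simp only [stateShares, state, getD_tables C hh, childWidths_rows, shares, widths,
    DFA.eval_append_singleton, List.length_append, List.length_singleton]

theorem nextState_state (C : RCIInstance dfaClass dfaClass) {h : List (Fin C.k)} (u : Fin C.k)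
    (hh : h.length < C.n) :
    nextState (rows (hard C).D) (rows (soft C).D) (tables C) (capacity C.ε C.ρ) (state C h) u =
      state C (h ++ [u]) := by
  rw [nextState, stateShares_state C hh]
  simp only [state, getD_rows, getD_ofFn, DFA.eval_append_singleton, List.length_append,
    List.length_singleton]
  rw [budget, budget_append_singleton]
  rfl

theorem foldl_nextState (C : RCIInstance dfaClass dfaClass) (h : List (Fin C.k))
    (hh : h.length ≤ C.n) :
    (h.map Fin.val).foldl (nextState (rows (hard C).D) (rows (soft C).D) (tables C)
      (capacity C.ε C.ρ)) (state C []) = state C h := by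
  induction h using List.reverseRecOn with
  | nil => rfl
  | append_singleton h u ih =>
    simp only [List.length_append, List.length_singleton] at hh
    rw [List.map_append, List.foldl_append, ih (by omega)]
    exact nextState_state C u (by omega)

/-- The conjunction in `weights` unfolded into nested tests of the kinds for which `Comp` has
closure lemmas. -/
theorem weights_eq (C : RCIInstance dfaClass dfaClass) {h : List (Fin C.k)} : weights C h =
    if h.length + 1 ≤ C.n then
      if Odd h.length then [1] else
        if (budget C h).1 + (budget C h).2 = 0 then [1] else
        (stateShares (rows (hard C).D) (rows (soft C).D) (tables C) (capacity C.ε C.ρ)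
          (state C h)).map fun s => s.1 + s.2
    else [1] := by
  have hb : RCI.budget (capacity C.ε C.ρ) (widths (hard C).D (soft C).D C.n)
      (startBudget C.ε C.ρ) h =
    budget C h := rfl
  rw [weights, RCI.weights, hb]
  by_cases h1 : h.length < C.n
  · rw [if_pos (show h.length + 1 ≤ C.n from h1), stateShares_state C h1]
    by_cases h2 : Odd h.length
    · simp [h2]
    · by_cases h3 : (budget C h).1 + (budget C h).2 = 0
      · rw [if_neg (by omega), if_neg h2, if_pos h3]
      · rw [if_pos ⟨h1, h2, by omega⟩, if_neg h2, if_neg h3]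
  · rw [if_neg (by omega), if_neg (by omega)]

/-- Budgets never grow along a history; this bounds the size of the state while a history is read.
-/
theorem budget_le_startBudget (C : RCIInstance dfaClass dfaClass) (h : List (Fin C.k)) :
    (budget C h).1 ≤ (startBudget C.ε C.ρ).1 ∧ (budget C h).2 ≤ (startBudget C.ε C.ρ).2 := by
  induction h using List.reverseRecOn with
  | nil => exact ⟨le_rfl, le_rfl⟩
  | append_singleton h u ih =>
    rw [budget, budget_append_singleton]
    split_ifs
    · exact ih
    · rw [List.getD_eq_getElem?_getD]
      rcases hu : (shares (capacity C.ε C.ρ) (widths (hard C).D (soft C).D C.n) h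
        (budget C h))[(u : ℕ)]? with _ | s
      · rw [budget] at hu
        rw [hu]
        exact ⟨Nat.zero_le _, Nat.zero_le _⟩
      · have := mem_split_le (List.mem_of_getElem? hu)
        rw [budget] at hu
        rw [hu]
        exact ⟨this.1.trans ih.1, this.2.trans ih.2⟩

section Comp

variable {ι : Type} {e : ι → Val} {C : ι → RCIInstance dfaClass dfaClass}

theorem comp_tables (hC : Comp e fun i => data (C i)) : Comp e fun i => tables (C i) := by
  have hA : Comp e fun i => rows (hard (C i)).D := hC.snd.fst.snd
  have hB : Comp e fun i => rows (soft (C i)).D := hC.snd.snd.fst.snd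
  have hn : Comp e fun i => List.replicate (C i).n 0 := hC.snd.snd.snd.fst
  have hk : Comp e fun i => (C i).k := hC.fst
  have hA' : PBdd (fun i => (e i).size) fun i => (hard (C i)).m :=
    hA.pbdd_length.mono fun i => by simp [rows]
  have hB' : PBdd (fun i => (e i).size) fun i => (soft (C i)).m :=
    hB.pbdd_length.mono fun i => by simp [rows]
  have hn' : PBdd (fun i => (e i).size) fun i => (C i).n :=
    hn.pbdd_length.mono fun i => by simp
  have hlen : Comp e fun i => (C i).n :=
    hn.length.congr fun i => by simp
  -- The bound from `size_level_le` for one table; it is polynomial because the numbers of states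
  -- and `n` are lengths of lists in the representation.
  have hlev : PBdd (fun i => (e i).size) fun i => 1 + (hard (C i)).m * (1 + (1 + (soft (C i)).m *
      (1 + (5 + 2 * ((C i).n * Nat.size (C i).k))))) :=
    (PBdd.const 1).add (hA'.mul ((PBdd.const 1).add ((PBdd.const 1).add (hB'.mul
      ((PBdd.const 1).add ((PBdd.const 5).add ((PBdd.const 2).mul (hn'.mul hk.pbdd_nat))))))))
  have hz : Comp (ext (ext e (ℕ × List (List (List (ℕ × ℕ))))) ℕ) fun z => z.1.2 := Comp.var.wk
  refine ((Comp.foldl (F := fun z : (ι × (ℕ × List (List (List (ℕ × ℕ))))) × ℕ => (z.1.2.1 - 1,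
      prevLevel (rows (hard (C z.1.1)).D) (rows (soft (C z.1.1)).D) (z.1.2.1 - 1)
        (z.1.2.2.getD 0 []) :: z.1.2.2)) hn (hlen.pair ((hA.lastLevel hB).cons (Comp.const [])))
    ((hz.fst.sub (Comp.const 1)).pair ((hA.wk.wk.prevLevel hB.wk.wk (hz.fst.sub (Comp.const 1))
      (hz.snd.getD (Comp.const 0) [])).cons hz.snd))
    (((PBdd.const 2).add hn').add ((PBdd.const 1).add ((hn'.add (.const 1)).mul
      ((PBdd.const 1).add hlev)))) fun i l hl => ?_).snd).congr fun i => ?_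
  · dsimp only
    -- A prefix of the unary `n` is again unary, so `foldl_levels` gives the intermediate tables.
    have hl1 : l = List.replicate l.length 0 := by
      refine List.eq_replicate_of_mem fun x hx => ?_
      exact (List.mem_replicate.1 (hl.subset hx)).2
    have hl2 : l.length ≤ (C i).n := by simpa using hl.length_le
    rw [hl1, foldl_levels _ _ (C i).k_pos hl2, size_enc_prod, size_enc_nat]
    have h1 := natSize_le ((C i).n - l.length)
    refine le_trans (Nat.add_le_add_left (size_enc_list_le
      (B := 1 + (hard (C i)).m * (1 + (1 + (soft (C i)).m *
      (1 + (5 + 2 * ((C i).n * Nat.size (C i).k)))))) fun x hx => ?_) _) ?_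
    · obtain ⟨j, hj, rfl⟩ := List.mem_map.1 hx
      rw [List.mem_range] at hj
      exact size_level_le _ _ (C i).k_pos (by omega)
    · rw [List.length_map, List.length_range]
      exact Nat.add_le_add (by omega) (Nat.add_le_add_left (Nat.mul_le_mul_right _ (by omega)) 1)
  · have := levels_rows (hard (C i)).D (soft (C i)).D (C i).k_pos (C i).n
    rw [levels, List.length_replicate] at this
    dsimp only
    rw [this]
    rfl

theorem comp_capacity (hC : Comp e fun i => data (C i)) :
    Comp e fun i => capacity (C i).ε (C i).ρ :=
  hC.snd.snd.snd.snd.snd.fst.fst.mul hC.snd.snd.snd.snd.fst.snd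

theorem comp_startBudget (hC : Comp e fun i => data (C i)) :
    Comp e fun i => startBudget (C i).ε (C i).ρ :=
  have hε : Comp e fun i => ((C i).ε.num.natAbs, (C i).ε.den) := hC.snd.snd.snd.snd.fst
  have hρ : Comp e fun i => ((C i).ρ.num.natAbs, (C i).ρ.den) := hC.snd.snd.snd.snd.snd.fst
  ((hε.snd.sub hε.fst).mul hρ.snd).pair (hε.fst.mul hρ.snd)

theorem comp_stateShares {A B : ι → List (ℕ × List ℕ)} {T : ι → List (List (List (ℕ × ℕ)))}
    {R : ι → ℕ} {z : ι → (ℕ × ℕ) × ℕ × ℕ × ℕ} (hA : Comp e A) (hB : Comp e B) (hT : Comp e T)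
    (hR : Comp e R) (hz : Comp e z) :
    Comp e fun i => stateShares (A i) (B i) (T i) (R i) (z i) :=
  hR.split hz.snd.snd.fst hz.snd.snd.snd
    (hA.childWidths hB (hT.getD (hz.snd.fst.add (Comp.const 1)) []) hz.fst.fst hz.fst.snd)

theorem comp_nextState {A B : ι → List (ℕ × List ℕ)} {T : ι → List (List (List (ℕ × ℕ)))}
    {R u : ι → ℕ} {z : ι → (ℕ × ℕ) × ℕ × ℕ × ℕ} (hA : Comp e A) (hB : Comp e B) (hT : Comp e T)
    (hR : Comp e R) (hz : Comp e z) (hu : Comp e u) :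
    Comp e fun i => nextState (A i) (B i) (T i) (R i) (z i) (u i) :=
  have hA' : Comp e fun i => ((A i).getD (z i).1.1 (0, [])).2 := (hA.getD hz.fst.fst (0, [])).snd
  have hB' : Comp e fun i => ((B i).getD (z i).1.2 (0, [])).2 := (hB.getD hz.fst.snd (0, [])).snd
  ((hA'.getD hu 0).pair (hB'.getD hu 0)).pair ((hz.snd.fst.add (Comp.const 1)).pair
    (hz.snd.fst.ite_odd hz.snd.snd ((comp_stateShares hA hB hT hR hz).getD hu (0, 0))))

theorem comp_state (hC : Comp e fun i => data (C i)) {h : (i : ι) → List (Fin (C i).k)}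
    (hlen : ∀ i, (h i).length ≤ (C i).n) (hh : Comp e fun i => (h i).map Fin.val) :
    Comp e fun i => state (C i) (h i) := by
  have hA : Comp e fun i => rows (hard (C i)).D := hC.snd.fst.snd
  have hB : Comp e fun i => rows (soft (C i)).D := hC.snd.snd.fst.snd
  have hn : Comp e fun i => List.replicate (C i).n 0 := hC.snd.snd.snd.fst
  have hA' : PBdd (fun i => (e i).size) fun i => (hard (C i)).m :=
    hA.pbdd_length.mono fun i => by simp [rows]
  have hB' : PBdd (fun i => (e i).size) fun i => (soft (C i)).m :=
    hB.pbdd_length.mono fun i => by simp [rows]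
  have hn' : PBdd (fun i => (e i).size) fun i => (C i).n :=
    hn.pbdd_length.mono fun i => by simp
  have hb := comp_startBudget hC
  refine (Comp.foldl (F := fun z : (ι × ((ℕ × ℕ) × ℕ × ℕ × ℕ)) × ℕ =>
      nextState (rows (hard (C z.1.1)).D) (rows (soft (C z.1.1)).D) (tables (C z.1.1))
        (capacity (C z.1.1).ε (C z.1.1).ρ) z.1.2 z.2) (a := fun i => state (C i) []) hh
    ((hC.snd.fst.fst.pair hC.snd.snd.fst.fst).pair ((Comp.const 0).pair hb))
    (comp_nextState hA.wk.wk hB.wk.wk (comp_tables hC).wk.wk (comp_capacity hC).wk.wk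
      Comp.var.wk Comp.var)
    ((((PBdd.const 10).add (hA'.add (hB'.add hn'))).add hb.fst.pbdd_nat).add hb.snd.pbdd_nat)
    fun i l hl => ?_).congr fun i => foldl_nextState (C i) (h i) (hlen i)
  dsimp only
  obtain ⟨l', hl', rfl⟩ := List.prefix_map_iff.1 hl
  have h0 := hl'.length_le.trans (hlen i)
  have h1 := foldl_nextState (C i) l' h0
  rw [show (fun c x => nextState (rows (hard (C i)).D) (rows (soft (C i)).D) (tables (C i))
    (capacity (C i).ε (C i).ρ) c x) = nextState (rows (hard (C i)).D) (rows (soft (C i)).D)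
    (tables (C i)) (capacity (C i).ε (C i).ρ) from rfl, h1]
  obtain ⟨h2, h3⟩ := budget_le_startBudget (C i) l'
  have h2 := Nat.size_le_size h2
  have h3 := Nat.size_le_size h3
  have h4 := natSize_le ((hard (C i)).D.eval l')
  have h5 := natSize_le ((soft (C i)).D.eval l')
  have h6 := natSize_le l'.length
  have h7 := ((hard (C i)).D.eval l').isLt
  have h8 := ((soft (C i)).D.eval l').isLt
  simp only [state, size_enc_prod, size_enc_nat]
  rw [show budget (C i) l' = ((budget (C i) l').1, (budget (C i) l').2) from rfl, size_enc_prod,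
    size_enc_nat, size_enc_nat]
  omega

theorem comp_weights (hC : Comp e fun i => data (C i)) {h : (i : ι) → List (Fin (C i).k)}
    (hlen : ∀ i, (h i).length ≤ (C i).n) (hh : Comp e fun i => (h i).map Fin.val) :
    Comp e fun i => weights (C i) (h i) := by
  have hn : Comp e fun i => List.replicate (C i).n 0 := hC.snd.snd.snd.fst
  have hn' : Comp e fun i => (C i).n :=
    hn.length.congr fun i => by simp
  have hz := comp_state hC hlen hh
  have hsh := comp_stateShares hC.snd.fst.snd hC.snd.snd.fst.snd (comp_tables hC)
    (comp_capacity hC) hz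
  refine (Comp.ite_le (hz.snd.fst.add (Comp.const 1)) hn' (hz.snd.fst.ite_odd (Comp.const [1])
    (Comp.ite (hz.snd.snd.fst.add hz.snd.snd.snd)
      (hsh.map (F := fun z : ι × (ℕ × ℕ) => z.2.1 + z.2.2) (Comp.var.fst.add Comp.var.snd))
      (Comp.const [1]))) (Comp.const [1])).congr fun i => (weights_eq (C i)).symm

end Comp

end DFAInstance

open scoped ENNReal

/-! # The improvisation scheme for automata -/

theorem Prim.index_injective : Function.Injective Prim.index := by
  intro p q h
  cases p <;> cases q <;> first | rfl | cases h

/-- `improviser_efficiency` quantifies over all programs with the given output, so that program has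
to be recovered from its encoding. -/
theorem Prog.encode_injective : Function.Injective Prog.encode := by
  intro P
  induction P with
  | prim p =>
    intro Q h
    cases Q <;> simp only [Prog.encode, Val.pair.injEq, Val.num.injEq] at h <;> try omega
    rw [Prim.index_injective h.2]
  | const v =>
    intro Q h
    cases Q <;> simp only [Prog.encode, Val.pair.injEq, Val.num.injEq] at h <;> try omega
    rw [h.2]
  | flip =>
    intro Q h
    cases Q <;> simp only [Prog.encode, Val.pair.injEq, Val.num.injEq] at h <;> try omega
    rfl
  | seq f g ihf ihg =>
    intro Q h
    cases Q <;> simp only [Prog.encode, Val.pair.injEq, Val.num.injEq] at h <;> try omega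
    rw [ihf h.2.1, ihg h.2.2]
  | pair f g ihf ihg =>
    intro Q h
    cases Q <;> simp only [Prog.encode, Val.pair.injEq, Val.num.injEq] at h <;> try omega
    rw [ihf h.2.1, ihg h.2.2]
  | ite c f g ihc ihf ihg =>
    intro Q h
    cases Q <;> simp only [Prog.encode, Val.pair.injEq, Val.num.injEq] at h <;> try omega
    rw [ihc h.2.1, ihf h.2.2.1, ihg h.2.2.2]
  | loop c f ihc ihf =>
    intro Q h
    cases Q <;> simp only [Prog.encode, Val.pair.injEq, Val.num.injEq] at h <;> try omega
    rw [ihc h.2.1, ihf h.2.2]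

theorem progOutput_injective : Function.Injective progOutput := fun _ _ h =>
  Prog.encode_injective (Val.pair.inj h).2

theorem ofWord_eq {k : ℕ} (h : List (Fin k)) : Val.ofWord h = enc (h.map Fin.val) := by
  -- In `Val.ofWord` the whole history is coerced to a list of naturals, through the list monad.
  have h1 : (do let a ← h; pure (a : ℕ)) = h.map Fin.val := by
    induction h with
    | nil => rfl
    | cons u h ih => simpa using ih
  rw [Val.ofWord, h1]
  rfl

namespace DFAInstance

/-- The criterion for realizability. -/
def Feasible (C : RCIInstance dfaClass dfaClass) : Prop :=
  (startBudget C.ε C.ρ).1 ≤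
    capacity C.ε C.ρ * (widths (hard C).D (soft C).D C.n []).2 ∧
  (startBudget C.ε C.ρ).1 + (startBudget C.ε C.ρ).2 ≤
    capacity C.ε C.ρ * (widths (hard C).D (soft C).D C.n []).1

theorem feasible_of_realizable {C : RCIInstance dfaClass dfaClass} (h : C.Realizable) :
    Feasible C := by
  obtain ⟨σ, hσ⟩ := h
  exact budget_le_of_isImprovising (hard C).D (soft C).D C.ε_nonneg C.ε_le_one C.ρ_nonneg C.k_pos hσ

/-- The program that runs `Q` on its argument together with the representation of `C`. -/
noncomputable def generator (Q : Prog) (C : RCIInstance dfaClass dfaClass) : Prog :=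
  .seq (.pair (.prim .nop) (.const C.encode)) Q

/-- The improviser recomputes the tables and the state from scratch on each history. Indexing `Comp`
by all pairs of an instance and a history makes the program `Q` and the polynomial `q` uniform. -/
theorem exists_generator : ∃ (Q : Prog) (q : Polynomial ℕ), ∀ C, Feasible C →
    C.IsImproviser (generator Q C) ∧ ∀ h : List (Fin C.k), h.length ≤ C.n →
      (generator Q C).expectedTime (Val.ofWord h) ≤ ((q.eval C.size : ℕ) : ℝ≥0∞) := by
  let ι := Σ C : RCIInstance dfaClass dfaClass, {h : List (Fin C.k) // h.length ≤ C.n}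
  let e : ι → Val := fun i => .pair (Val.ofWord i.2.1) i.1.encode
  have he : Comp e fun i => (i.2.1.map Fin.val, data i.1) :=
    Comp.self.congr_enc fun i => by
      change Val.pair _ _ = Val.pair _ _
      rw [encode_eq, ofWord_eq]
  have hw := comp_weights (C := fun i : ι => i.1) he.snd (fun i => i.2.2) he.fst
  have hwsize := hw.pbdd
  obtain ⟨W, tW, htW, hW⟩ := Comp.iff_time.1 hw
  obtain ⟨P, q, hP⟩ := exists_sampler
  -- Bounds for `IsImproviser` are in terms of the instance alone, so the size of the history is
  -- bounded through `n` and the bits of `k`.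
  have hx : PBdd (fun i : ι => i.1.size) fun i => (Val.ofWord i.2.1).size := by
    have h1 : Comp (fun i : ι => i.1.encode) fun i => data i.1 :=
      Comp.self.congr_enc fun i => by rw [enc_val, encode_eq]
    have h2 : PBdd (fun i : ι => i.1.size) fun i => i.1.n :=
      h1.snd.snd.snd.fst.pbdd_length.mono fun i => by simp [data]
    refine ((PBdd.const 1).add (h2.mul ((PBdd.const 2).add h1.fst.pbdd_nat))).mono fun i => ?_
    have h3 := size_enc_list_le (l := i.2.1.map Fin.val) (B := 1 + Nat.size i.1.k) fun x hx => by
      obtain ⟨u, -, rfl⟩ := List.mem_map.1 hx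
      rw [size_enc_nat]
      exact Nat.add_le_add_left (Nat.size_le_size u.isLt.le) 1
    rw [List.length_map] at h3
    rw [ofWord_eq]
    refine h3.trans (Nat.add_le_add_left (Nat.mul_le_mul i.2.2 ?_) 1)
    simp only [data]
    omega
  have hes : PBdd (fun i : ι => i.1.size) fun i => (e i).size := ((PBdd.const 1).add hx).add .self
  -- `T` covers one computation of the weights and one round of sampling; `N` below exceeds the
  -- bound on the expected number of rounds.
  obtain ⟨T, hT⟩ : PBdd (fun i : ι => i.1.size) fun i =>
      (1 + (1 + (Val.ofWord i.2.1).size + (1 + (Val.ofWord i.2.1).size) +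
        (1 + (Val.ofWord i.2.1).size + i.1.encode.size))) +
        (1 + tW i + q.eval (enc (weights i.1 i.2.1)).size) :=
    ((PBdd.const 1).add ((((PBdd.const 1).add hx).add ((PBdd.const 1).add hx)).add
      (((PBdd.const 1).add hx).add .self))).add
      (((PBdd.const 1).add (hes.trans htW)).add ((hes.trans hwsize).eval q))
  obtain ⟨N, hN⟩ := ENNReal.exists_nat_gt tsum_succ_mul_geometric_ne_top
  refine ⟨W.seq P, .C N * T, fun C hC => ?_⟩
  have hwb := isWidthBound_widths (hard C).D (soft C).D C.n
  have hpos : ∀ h, 0 < (weights C h).sum := sum_weights_pos hwb hC.1 hC.2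
  have hlist : ∀ h : List (Fin C.k), h.length ≤ C.n → ∃ t,
      Lists (generator (W.seq P) C) (Val.ofWord h)
        (blockCode (Nat.size (weights C h).sum) (weights C h).sum)
        (fun z => .num (locate (weights C h) z.2)) t ∧
      ∀ z, t z ≤ (z.1.length + 1) * T.eval C.size := by
    intro h hh
    obtain ⟨t, ht, ht'⟩ := hP _ (hpos h)
    have hn := Exec.prim .nop (Val.ofWord h)
    rw [show Prim.nop.eval (Val.ofWord h) = Val.ofWord h by cases Val.ofWord h <;> rfl] at hn
    refine ⟨_, (ht.seq_of_exec (hW ⟨C, h, hh⟩)).seq_of_exec (hn.pair (.const C.encode _)),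
      fun z => ?_⟩
    refine le_trans ?_ (Nat.mul_le_mul_left _ (hT ⟨C, h, hh⟩))
    have h1 := ht' z
    have h2 : 1 ≤ z.1.length + 1 := by omega
    have h3 := Nat.le_mul_of_pos_left (1 + (1 + (Val.ofWord h).size + (1 + (Val.ofWord h).size) +
        (1 + (Val.ofWord h).size + C.encode.size)) + (1 + tW ⟨C, h, hh⟩)) h2
    have h4 : (z.1.length + 1) * ((1 + (1 + (Val.ofWord h).size + (1 + (Val.ofWord h).size) +
        (1 + (Val.ofWord h).size + C.encode.size))) +
        (1 + tW ⟨C, h, hh⟩ + q.eval (enc (weights C h)).size)) =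
        (z.1.length + 1) * (1 + (1 + (Val.ofWord h).size + (1 + (Val.ofWord h).size) +
        (1 + (Val.ofWord h).size + C.encode.size)) + (1 + tW ⟨C, h, hh⟩)) +
        (z.1.length + 1) * q.eval (enc (weights C h)).size := by ring
    rw [h4]
    have h5 : Prim.nop.cost (Val.ofWord h) = 1 + (Val.ofWord h).size := rfl
    rw [h5]
    omega
  have htime : ∀ h : List (Fin C.k), h.length ≤ C.n →
      (generator (W.seq P) C).expectedTime (Val.ofWord h) ≤
        (((Polynomial.C N * T).eval C.size : ℕ) : ℝ≥0∞) := by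
    intro h hh
    obtain ⟨t, ht, ht'⟩ := hlist h hh
    refine (ht.blocks_expectedTime (hpos h) ht').trans ?_
    rw [Polynomial.eval_mul, Polynomial.eval_C, Nat.cast_mul]
    gcongr
  refine ⟨⟨_, isImprovising_budgetStrategy (hard C).D (soft C).D C.ε_nonneg C.ε_le_one C.ρ_nonneg
    C.k_pos hC.1 hC.2, fun h hh => ⟨(htime h hh).trans_lt (ENNReal.natCast_lt_top _), fun u => ?_⟩⟩,
    htime⟩
  obtain ⟨t, ht, -⟩ := hlist h hh
  rw [ht.blocks_outProb]
  have h1 : (0 : ℝ) < ((weights C h).sum : ℕ) := by exact_mod_cast hpos h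
  change _ = ENNReal.ofReal (((weights C h).getD u 0 : ℕ) / ((weights C h).sum : ℕ))
  rw [ENNReal.ofReal_div_of_pos h1, ENNReal.ofReal_natCast, ENNReal.ofReal_natCast]

end DFAInstance

open DFAInstance in
theorem exists_dfa_scheme : ∃ S : Prog, IsPolyTimeImprovisationScheme dfaClass dfaClass S := by
  classical
  obtain ⟨Q, q, hQ⟩ := exists_generator
  have hcomp : Comp (fun C : RCIInstance dfaClass dfaClass => C.encode) fun C =>
      if Feasible C then progOutput (generator Q C) else botOutput := by
    have hC : Comp (fun C : RCIInstance dfaClass dfaClass => C.encode) fun C => data C :=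
      Comp.self.congr_enc fun C => by rw [enc_val, encode_eq]
    have hw : Comp (fun C : RCIInstance dfaClass dfaClass => C.encode) fun C =>
        widths (hard C).D (soft C).D C.n [] :=
      ((((comp_tables hC).getD (Comp.const 0) []).getD hC.snd.fst.fst []).getD hC.snd.snd.fst.fst
        (0, 0)).congr fun C => by
          rw [getD_tables C (Nat.zero_le _)]
          simp only [data, level, getD_ofFn]
          rfl
    -- The encoded generator is fixed data around a single copy of `C.encode`, so writing it down
    -- takes polynomial time.
    have hout : Comp (fun C : RCIInstance dfaClass dfaClass => C.encode) fun C =>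
        progOutput (generator Q C) :=
      ((Comp.const 1).pair ((Comp.const 3).pair (((Comp.const 4).pair ((Comp.const
        (Prog.prim .nop).encode).pair ((Comp.const 1).pair Comp.self))).pair
        (Comp.const Q.encode)))).congr_enc fun C => rfl
    have hR := comp_capacity hC
    have hb := comp_startBudget hC
    refine (hb.fst.ite_le (hR.mul hw.snd) ((hb.fst.add hb.snd).ite_le (hR.mul hw.fst) hout
      (Comp.const botOutput)) (Comp.const botOutput)).congr fun C => ?_
    unfold Feasible
    split_ifs <;> first | rfl | tauto
  obtain ⟨S, p, hS⟩ := hcomp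
  dsimp only at hS
  refine ⟨S, fun C => ⟨fun hC => ?_, fun hC => ?_⟩, ⟨p, fun C bits out t h => ?_⟩,
    ⟨q, fun C G t h w hw => ?_⟩⟩
  · have hf := feasible_of_realizable hC
    obtain ⟨t, -, ht⟩ := hS C
    rw [if_pos hf] at ht
    exact ⟨_, t, ht, (hQ C hf).1⟩
  · obtain ⟨t, -, ht⟩ := hS C
    rw [if_neg] at ht
    · exact ⟨t, ht⟩
    · intro hf
      -- Feasibility implies realizability, since an improviser comes with an improvising strategy.
      obtain ⟨σ, hσ, -⟩ := (hQ C hf).1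
      exact hC ⟨σ, hσ⟩
  · obtain ⟨t', ht', h'⟩ := hS C
    -- The scheme has an execution without tosses, so every other execution coincides with it.
    obtain ⟨-, -, rfl⟩ := h'.deterministic h
    exact ht'
  · obtain ⟨t', -, h'⟩ := hS C
    obtain ⟨-, h1, -⟩ := h'.deterministic h
    by_cases hf : Feasible C
    · rw [if_pos hf] at h1
      rw [progOutput_injective h1]
      exact (hQ C hf).2 w hw
    · rw [if_neg hf] at h1
      cases h1

open scoped ENNReal

/-! # Reachability/safety games -/

namespace RSGame

variable {k : ℕ} (X : RSGame k)

open Classical in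
/-- The status of a play that had the status `f` and then visits `v`: `2` after an unsafe state,
otherwise `1` after a target state, and `0` initially. -/
noncomputable def visit (f : Fin 3) (v : Fin X.m) : Fin 3 :=
  if v ∈ X.unsafeStates then 2 else if f = 2 then 2 else if v ∈ X.target then 1 else f

/-- The automaton that keeps track of the current state and of the status of the play before it. -/
noncomputable def toDFA : DFASpec k where
  m := 3 * X.m
  D :=
    { step := fun q u => finProdFinEquiv
        (X.visit (finProdFinEquiv.symm q).1 (finProdFinEquiv.symm q).2,
          X.step (finProdFinEquiv.symm q).2 u)
      start := finProdFinEquiv (0, X.start)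
      accept := {q | X.visit (finProdFinEquiv.symm q).1 (finProdFinEquiv.symm q).2 = 1} }

theorem eval_append_singleton (w : List (Fin k)) (u : Fin k) :
    X.eval (w ++ [u]) = X.step (X.eval w) u := by
  simp [eval]

open Classical in
-- The stored status lags behind by the current state, so a transition row needs only the bits of
-- its own state. Applying `visit` once more, as acceptance does, accounts for the last state of the
-- play.
theorem exists_eval_toDFA (w : List (Fin k)) :
    ∃ f, X.toDFA.D.eval w = finProdFinEquiv (f, X.eval w) ∧
    X.visit f (X.eval w) =
      if ∃ h, h <+: w ∧ X.eval h ∈ X.unsafeStates then 2 else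
      if ∃ h, h <+: w ∧ X.eval h ∈ X.target then 1 else 0 := by
  induction w using List.reverseRecOn with
  | nil =>
    refine ⟨0, rfl, ?_⟩
    simp [visit]
  | append_singleton w u ih =>
    obtain ⟨f, h1, h2⟩ := ih
    refine ⟨X.visit f (X.eval w), ?_, ?_⟩
    · rw [DFA.eval_append_singleton, h1, eval_append_singleton]
      change finProdFinEquiv
        (X.visit (finProdFinEquiv.symm (finProdFinEquiv (f, X.eval w))).1
          (finProdFinEquiv.symm (finProdFinEquiv (f, X.eval w))).2,
        X.step (finProdFinEquiv.symm (finProdFinEquiv (f, X.eval w))).2 u) = _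
      rw [Equiv.symm_apply_apply]
    · simp only [List.prefix_concat_iff, or_and_right, exists_or, exists_eq_left]
      rw [visit, h2]
      by_cases h3 : X.eval (w ++ [u]) ∈ X.unsafeStates <;>
      by_cases h4 : X.eval (w ++ [u]) ∈ X.target <;>
      by_cases h5 : ∃ h, h <+: w ∧ X.eval h ∈ X.unsafeStates <;>
      by_cases h6 : ∃ h, h <+: w ∧ X.eval h ∈ X.target <;> simp [h3, h4, h5, h6]

theorem accepts_toDFA : X.toDFA.D.accepts = X.wins := by
  classical
  ext w
  obtain ⟨f, h1, h2⟩ := X.exists_eval_toDFA w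
  rw [DFA.mem_accepts, h1]
  change X.visit (finProdFinEquiv.symm (finProdFinEquiv (f, X.eval w))).1
    (finProdFinEquiv.symm (finProdFinEquiv (f, X.eval w))).2 = 1 ↔
    (∃ h, h <+: w ∧ X.eval h ∈ X.target) ∧ ∀ h, h <+: w → X.eval h ∉ X.unsafeStates
  rw [Equiv.symm_apply_apply, h2]
  have h3 : (∀ h, h <+: w → X.eval h ∉ X.unsafeStates) ↔
      ¬ ∃ h, h <+: w ∧ X.eval h ∈ X.unsafeStates := by push Not; rfl
  rw [h3]
  by_cases h5 : ∃ h, h <+: w ∧ X.eval h ∈ X.unsafeStates <;>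
  by_cases h6 : ∃ h, h <+: w ∧ X.eval h ∈ X.target <;> simp [h5, h6]

open Classical in
/-- The table of a game. -/
noncomputable def rows : List ((ℕ × ℕ) × List ℕ) :=
  List.ofFn fun v => ((if v ∈ X.target then 1 else 0, if v ∈ X.unsafeStates then 1 else 0),
    List.ofFn fun u => (X.step v u : ℕ))

theorem encode_eq : rsgClass.encode X = enc ((X.start : ℕ), X.rows) := by
  simp only [rsgClass, rows, enc_prod]
  refine congrArg₂ Val.pair rfl ?_
  change Val.ofList _ = Val.ofList _
  rw [List.map_ofFn]
  refine congrArg Val.ofList (congrArg List.ofFn (funext fun v => ?_))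
  refine congrArg₂ Val.pair rfl ?_
  change Val.ofList _ = Val.ofList _
  rw [List.map_ofFn]
  rfl

/-- The status `visit f v`, from the bits that tell whether `v` is a target or unsafe. -/
def visitNat (f : ℕ) (b : ℕ × ℕ) : ℕ :=
  if b.2 = 0 then if f = 2 then 2 else if b.1 = 0 then f else 1 else 2

/-- The transition table of the automaton for a game. -/
def dfaRows (A : List ((ℕ × ℕ) × List ℕ)) : List (ℕ × List ℕ) :=
  ([0, 1, 2].map fun f => A.map fun r =>
    (if visitNat f r.1 = 1 then 1 else 0, r.2.map fun v => v + A.length * visitNat f r.1)).flatten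

open Classical in
theorem visitNat_eq (f : Fin 3) (v : Fin X.m) : visitNat f
    (if v ∈ X.target then 1 else 0, if v ∈ X.unsafeStates then 1 else 0) = X.visit f v := by
  have h : (f : ℕ) = 2 ↔ f = 2 := by
    rw [Fin.ext_iff]
    rfl
  unfold visitNat visit
  by_cases h1 : v ∈ X.unsafeStates <;> by_cases h2 : v ∈ X.target <;> by_cases h3 : f = 2 <;>
    simp [h1, h2, h3, h]

theorem rows_toDFA : RCI.rows X.toDFA.D = dfaRows X.rows := by
  classical
  -- `List.ofFn_mul` enumerates the product states copy by copy, at position `f * X.m + v`, which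
  -- agrees with the numbering by `finProdFinEquiv`.
  have h : ∀ (f : Fin 3) (v : Fin X.m) (hlt : (f : ℕ) * X.m + v < 3 * X.m),
      (⟨f * X.m + v, hlt⟩ : Fin (3 * X.m)) = finProdFinEquiv (f, v) := by
    intro f v hlt
    rw [Fin.ext_iff, finProdFinEquiv_apply_val]
    simp only
    ring
  have hlen : X.rows.length = X.m := by simp [rows]
  have h3 : ([0, 1, 2] : List ℕ) = List.ofFn fun f : Fin 3 => (f : ℕ) := by simp [List.ofFn_succ]
  have hrows : RCI.rows X.toDFA.D = List.ofFn (n := 3 * X.m) fun q =>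
      (if X.visit (finProdFinEquiv.symm q).1 (finProdFinEquiv.symm q).2 = 1 then 1 else 0,
        List.ofFn fun u => ((finProdFinEquiv
          (X.visit (finProdFinEquiv.symm q).1 (finProdFinEquiv.symm q).2,
            X.step (finProdFinEquiv.symm q).2 u) : Fin (3 * X.m)) : ℕ)) := by
    refine congrArg List.ofFn (funext fun q => ?_)
    refine congrArg₂ Prod.mk ?_ rfl
    exact if_congr Iff.rfl rfl rfl
  rw [hrows, List.ofFn_mul, dfaRows, hlen, h3, List.map_ofFn]
  refine congrArg List.flatten (congrArg List.ofFn (funext fun f => ?_))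
  rw [Function.comp, rows, List.map_ofFn]
  refine congrArg List.ofFn (funext fun v => ?_)
  have h4 : (X.visit f v : ℕ) = 1 ↔ X.visit f v = 1 := by
    rw [Fin.ext_iff]
    rfl
  simp only [Function.comp, visitNat_eq, List.map_ofFn]
  rw [h f v, Equiv.symm_apply_apply]
  refine congrArg₂ Prod.mk (if_congr h4.symm rfl rfl) (congrArg List.ofFn (funext fun u => ?_))
  rw [finProdFinEquiv_apply_val]
  rfl

theorem _root_.RCI.Comp.dfaRows {ι : Type} {e : ι → Val} {A : ι → List ((ℕ × ℕ) × List ℕ)}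
    (hA : Comp e A) : Comp e fun i => dfaRows (A i) := by
  have hr : Comp (ext (ext e ℕ) ((ℕ × ℕ) × List ℕ)) fun z => z.2 := Comp.var
  have hf : Comp (ext (ext e ℕ) ((ℕ × ℕ) × List ℕ)) fun z => z.1.2 := Comp.var.wk
  have hv : Comp (ext (ext e ℕ) ((ℕ × ℕ) × List ℕ)) fun z => visitNat z.1.2 z.2.1 :=
    hr.fst.snd.ite_eq (Comp.const 0) (hf.ite_eq (Comp.const 2) (Comp.const 2)
      (hr.fst.fst.ite_eq (Comp.const 0) hf (Comp.const 1))) (Comp.const 2)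
  exact ((Comp.const [0, 1, 2]).map (hA.wk.map ((hv.ite_eq (Comp.const 1) (Comp.const 1)
    (Comp.const 0)).pair (hr.snd.map (Comp.var.add (hA.length.wk.wk.wk.mul hv.wk)))))).flatten

/-- The instance given by automata that an instance given by games reduces to. -/
noncomputable def toDFAInstance (C : RCIInstance rsgClass rsgClass) :
    RCIInstance dfaClass dfaClass where
  k := C.k
  k_pos := C.k_pos
  H := toDFA (k := C.k) C.H
  S := toDFA (k := C.k) C.S
  n := C.n
  ε := C.ε
  ρ := C.ρ
  ε_nonneg := C.ε_nonneg
  ε_le_one := C.ε_le_one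
  ρ_nonneg := C.ρ_nonneg
  ρ_le_one := C.ρ_le_one

theorem encode_toDFA : dfaClass.encode X.toDFA = enc ((X.start : ℕ), dfaRows X.rows) := by
  rw [DFAInstance.encode_dfa, rows_toDFA]
  have h : ((X.toDFA.D.start : Fin X.toDFA.m) : ℕ) = X.start := by
    change ((finProdFinEquiv (0, X.start) : Fin (3 * X.m)) : ℕ) = _
    rw [finProdFinEquiv_apply_val]
    simp
  rw [h]

theorem comp_toDFAInstance : Comp (fun C : RCIInstance rsgClass rsgClass => C.encode) fun C =>
    (toDFAInstance C).encode := by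
  have h : Comp (fun C : RCIInstance rsgClass rsgClass => C.encode) fun C =>
      (C.k, (((C.H : RSGame C.k).start : ℕ), rows (k := C.k) C.H),
        (((C.S : RSGame C.k).start : ℕ), rows (k := C.k) C.S),
        Val.ofList [Val.unary C.n, Val.ofRat C.ε, Val.ofRat C.ρ]) :=
    Comp.self.congr_enc fun C => by
      rw [enc_val, RCIInstance.encode, encode_eq (k := C.k) C.H, encode_eq (k := C.k) C.S]
      rfl
  refine (h.fst.pair ((h.snd.fst.fst.pair h.snd.fst.snd.dfaRows).pair
    ((h.snd.snd.fst.fst.pair h.snd.snd.fst.snd.dfaRows).pair h.snd.snd.snd))).congr_enc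
    fun C => ?_
  rw [enc_val, RCIInstance.encode, show dfaClass.encode (toDFAInstance C).H = _ from
    encode_toDFA (k := C.k) C.H, show dfaClass.encode (toDFAInstance C).S = _ from
    encode_toDFA (k := C.k) C.S]
  rfl

theorem isImprovisingStrategy_toDFAInstance (C : RCIInstance rsgClass rsgClass)
    (σ : Strategy (Fin C.k) C.n) :
    (toDFAInstance C).IsImprovisingStrategy σ ↔ C.IsImprovisingStrategy σ := by
  have hH : dfaClass.lang (toDFAInstance C).H = rsgClass.lang C.H := accepts_toDFA (k := C.k) C.H
  have hS : dfaClass.lang (toDFAInstance C).S = rsgClass.lang C.S := accepts_toDFA (k := C.k) C.S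
  unfold RCIInstance.IsImprovisingStrategy
  rw [hH, hS]
  rfl

theorem isImproviser_toDFAInstance (C : RCIInstance rsgClass rsgClass) (G : Prog) :
    (toDFAInstance C).IsImproviser G ↔ C.IsImproviser G :=
  exists_congr fun σ => and_congr_left' (isImprovisingStrategy_toDFAInstance C σ)

theorem realizable_toDFAInstance (C : RCIInstance rsgClass rsgClass) :
    (toDFAInstance C).Realizable ↔ C.Realizable :=
  exists_congr (isImprovisingStrategy_toDFAInstance C)

end RSGame

open RSGame in
theorem exists_rsg_scheme : ∃ S : Prog, IsPolyTimeImprovisationScheme rsgClass rsgClass S := by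
  obtain ⟨S, hS⟩ := exists_dfa_scheme
  obtain ⟨P, t, ht, hP⟩ := Comp.iff_time.1 comp_toDFAInstance
  have hsize : PBdd (fun C : RCIInstance rsgClass rsgClass => C.size) fun C =>
      (toDFAInstance C).size := comp_toDFAInstance.pbdd
  have hrun : ∀ (C : RCIInstance rsgClass rsgClass) {y s},
      Exec S (toDFAInstance C).encode [] y s → Exec (P.seq S) C.encode [] y (1 + t C + s) :=
    fun C _ _ h => (hP C).seq h
  -- `S` halts without tosses on every reduced instance, so by determinism any execution of the
  -- composite arises from one of `S`.
  have htot : ∀ C : RCIInstance rsgClass rsgClass, ∃ y s,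
      Exec S (toDFAInstance C).encode [] y s := by
    intro C
    by_cases hC : (toDFAInstance C).Realizable
    · obtain ⟨G, s, h, -⟩ := (hS.correctness _).1 hC
      exact ⟨_, s, h⟩
    · obtain ⟨s, h⟩ := (hS.correctness _).2 hC
      exact ⟨_, s, h⟩
  obtain ⟨p, hp⟩ := hS.scheme_efficiency
  obtain ⟨q, hq⟩ := hS.improviser_efficiency
  obtain ⟨p', hp'⟩ := ((PBdd.const 1).add ht).add (hsize.eval p)
  obtain ⟨q', hq'⟩ := hsize.eval q
  refine ⟨P.seq S, fun C => ⟨fun hC => ?_, fun hC => ?_⟩, ⟨p', fun C bits out s h => ?_⟩,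
    ⟨q', fun C G s h w hw => ?_⟩⟩
  · obtain ⟨G, s, h, hG⟩ := (hS.correctness _).1 ((realizable_toDFAInstance C).2 hC)
    exact ⟨G, _, hrun C h, (isImproviser_toDFAInstance C G).1 hG⟩
  · obtain ⟨s, h⟩ := (hS.correctness _).2 (mt (realizable_toDFAInstance C).1 hC)
    exact ⟨_, hrun C h⟩
  · obtain ⟨y, s', h'⟩ := htot C
    obtain ⟨-, -, rfl⟩ := (hrun C h').deterministic h
    exact (Nat.add_le_add_left (hp _ _ _ _ h') _).trans (hp' C)
  · obtain ⟨y, s', h'⟩ := htot C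
    obtain ⟨-, rfl, -⟩ := (hrun C h').deterministic h
    exact (hq (toDFAInstance C) G s' h' w hw).trans (Nat.cast_le.2 (hq' C))

end RCI

theorem mainTheorem4 :
    (∀ (α V : Type*) [Fintype α] [Nonempty α] [Fintype V] (D : DFA α V) (n : ℕ) (h : List α),
      h.length ≤ n →
        RCI.width n (RCI.wordsOfLength D.accepts n) h = RCI.dpWidth D n (D.eval h) h.length) ∧
    (∀ (α : Type*) (V W : Type) (D : DFA α V) (E : DFA α W),
      (D.inter E).accepts = D.accepts ⊓ E.accepts) ∧
    (∃ S : RCI.Prog, RCI.IsPolyTimeImprovisationScheme RCI.dfaClass RCI.dfaClass S) ∧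
    (∃ S : RCI.Prog, RCI.IsPolyTimeImprovisationScheme RCI.rsgClass RCI.rsgClass S) :=
  ⟨fun _ _ _ _ _ D _ h hh => RCI.width_eq_dpWidth D h hh,
    fun _ _ _ D E => D.accepts_inter E, RCI.exists_dfa_scheme, RCI.exists_rsg_scheme⟩
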